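/- Let $K$ be an algebraically closed field of characteristic $0$ (for example $K=\mathbb{C}$). Let $(S,D)$ be a formal smooth surface pair over $K$, i.e. $S=\operatorname{Spec}\mathcal{O}$ with $\mathcal{O}\cong K[[x,y]]$, and $D\subset S$ a closed subscheme isomorphic to $\operatorname{Spec}K[[x]]$, with ideal $\mathbf{I}_D$; let $P$ be the closed point of $S$. Let $C=\mathbf{V}(F)\subset S$ be a reduced algebroid curve ($F\neq 0$) not containing $D$, and let $w=C.D=\dim_K\mathcal{O}/(\langle F\rangle+\mathbf{I}_D)$. Let $$I^{\mathrm{ea}}_{\log}(C)=\bigl(\mathcal{T}_{S\supset D\ni P}F+\langle F\rangle\bigr):\mathbf{I}_D,$$ where $\mathcal{T}_{S\supset D\ni P}$ is the module of $K$-derivations of $\mathcal{O}$ preserving $\mathbf{I}_D$ and the ideal of $P$. For a local artinian $K$-algebra $A$ with residue field $K$, let $\underline{\mathcal{D}ef}^{\,w}_{C\to(S\supset D\ni P)}(A)$ be the set of isomorphism classes of data $(\mathcal{C},\mathcal{S},\mathcal{D},\mathcal{P},\tilde\iota)$ consisting of flat deformations $\mathcal{C}$ of $C$ and $\mathcal{S}$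 of $S$ over $A$, a closed subscheme $\mathcal{D}\subset\mathcal{S}$ flat over $A$, a section $\mathcal{P}\subset\mathcal{D}$ over $A$ and an $A$-morphism $\tilde\iota:\mathcal{C}\to\mathcal{S}$, restricting on the closed fibre to $D$, $P$ and the inclusion $C\hookrightarrow S$, such that $\mathcal{C}|_{\mathcal{D}}\supseteq w\mathcal{P}$ as divisors on $\mathcal{D}$ (constant intersection multiplicity $w$); isomorphisms are pairs of $A$-isomorphisms of the $\mathcal{C}$'s and of the $\mathcal{S}$'s that restrict to the identity on the closed fibres, commute with the morphisms $\tilde\iota$ and respect $\mathcal{D}$ and $\mathcal{P}$. This is a functor in $A$ by base change. For a complete local noetherian $K$-algebra $R$ with residue field $K$ and maximal ideal $\mathfrak m$, a formal deformation over $R$ is a compatible system of classes over the quotients $R/\mathfrak m^{n+1}$; it is semiuniversal if the induced morphism of functors $\operatorname{Hom}(R,-)\to\underline{\mathcal{D}ef}^{\,w}_{C\to(S\supset D\ni P)}$ is smooth and is bijective on $K[\epsilon]$, $\epsilon^2=0$. Then: (1) $\mathcal{O}/I^{\mathrm{ea}}_{\log}(C)$ is finite dimensional over $K$, and the functor $\underline{\mathcal{D}ef}^{\,w}_{C\to(S\supset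 D\ni P)}$ has a semiuniversal formal deformation over some $R$ that is smooth (a formal power series ring over $K$ in finitely many variables) and isomorphic to the complete local ring at $0$ of the vector space $\mathcal{O}/I^{\mathrm{ea}}_{\log}(C)$ regarded as an affine space. (2) Let $x,y$ be formal coordinates on $S$ (so $\mathcal{O}=K[[x,y]]$) with $D=\mathbf{V}(y)$, suppose that $F=yf+x^w$ with $f\in\mathcal{O}$, and let $f_1,\dots,f_k\in\mathcal{O}$ be elements whose residue classes form a $K$-basis of $\mathcal{O}/I^{\mathrm{ea}}_{\log}(C)$. Then $$y\Bigl(f+\sum_{i=1}^k t_if_i\Bigr)+x^w$$ defines a semiuniversal formal deformation over $K[[t_1,\dots,t_k]]$: over each $R_n=K[[t_1,\dots,t_k]]/\langle t_1,\dots,t_k\rangle^{n+1}$ it is the class of the closed subscheme of $S_{R_n}$ defined by this equation, together with $D_{R_n}$ and $P_{R_n}$. -/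

import Mathlib

open IsLocalRing TensorProduct CategoryTheory

universe u

noncomputable section

namespace LogDeformation

variable (K : Type u) [Field K]

/-! ### Artinian and complete local algebras with residue field `K` -/

/-- An object of the category `𝒜_K`: a local artinian `K`-algebra with residue field `K`. -/
structure ArtAlg where
  carrier : Type u
  [commRing : CommRing carrier]
  [algebra : Algebra K carrier]
  [isLocalRing : IsLocalRing carrier]
  [isArtinianRing : IsArtinianRing carrier]
  residue_bijective : Function.Bijective (algebraMap K (ResidueField carrier))

instance : CoeSort (ArtAlg K) (Type u) := ⟨ArtAlg.carrier⟩

attribute [instance] ArtAlg.commRing ArtAlg.algebra ArtAlg.isLocalRing ArtAlg.isArtinianRing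

/-- An object of the category `𝒜̂_K`: a complete local noetherian `K`-algebra with residue
field `K`. -/
structure CompAlg where
  carrier : Type u
  [commRing : CommRing carrier]
  [algebra : Algebra K carrier]
  [isLocalRing : IsLocalRing carrier]
  [isNoetherianRing : IsNoetherianRing carrier]
  [isAdicComplete : IsAdicComplete (maximalIdeal carrier) carrier]
  residue_bijective : Function.Bijective (algebraMap K (ResidueField carrier))

instance : CoeSort (CompAlg K) (Type u) := ⟨CompAlg.carrier⟩

attribute [instance] CompAlg.commRing CompAlg.algebra CompAlg.isLocalRing
  CompAlg.isNoetherianRing CompAlg.isAdicComplete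

variable {K}

/-- Two `K`-algebra homomorphisms from a local ring to `K` agree. -/
theorem algHom_to_field_unique {A : Type*} [CommRing A] [Algebra K A] [IsLocalRing A]
    (f g : A →ₐ[K] K) : f = g := by
  have key : ∀ h : A →ₐ[K] K, RingHom.ker h = maximalIdeal A := fun h =>
    IsLocalRing.eq_maximalIdeal (RingHom.ker_isMaximal_of_surjective h
      (fun c => ⟨algebraMap K A c, by simp⟩))
  ext a
  have h1 : a - algebraMap K A (f a) ∈ RingHom.ker f := by simp [RingHom.mem_ker]
  rw [key f, ← key g, RingHom.mem_ker] at h1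
  have h2 : g a - f a = 0 := by simpa using h1
  exact (sub_eq_zero.mp h2).symm

/-- A local `K`-algebra with a `K`-algebra homomorphism to `K` has residue field `K`. -/
theorem residue_bijective_of_algHom {A : Type*} [CommRing A] [Algebra K A] [IsLocalRing A]
    (f : A →ₐ[K] K) : Function.Bijective (algebraMap K (ResidueField A)) := by
  refine ⟨(algebraMap K (ResidueField A)).injective, fun b => ?_⟩
  obtain ⟨a, rfl⟩ := IsLocalRing.residue_surjective b
  have hk : RingHom.ker f = maximalIdeal A :=
    IsLocalRing.eq_maximalIdeal (RingHom.ker_isMaximal_of_surjective f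
      (fun c => ⟨algebraMap K A c, by simp⟩))
  refine ⟨f a, ?_⟩
  have h1 : a - algebraMap K A (f a) ∈ maximalIdeal A := by
    rw [← hk]; simp [RingHom.mem_ker]
  rw [← IsLocalRing.residue_eq_zero_iff, map_sub, sub_eq_zero] at h1
  rw [h1]; rfl

/-- The residue map of a local `K`-algebra with residue field `K`, as a map to `K`. -/
def residueMap (A : Type*) [CommRing A] [Algebra K A] [IsLocalRing A]
    (h : Function.Bijective (algebraMap K (ResidueField A))) : A →ₐ[K] K :=
  ((AlgEquiv.ofBijective (Algebra.ofId K (ResidueField A)) h).symm : _ →ₐ[K] K).comp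
    (IsScalarTower.toAlgHom K A (ResidueField A))

/-- The residue map `A → K`. -/
def ArtAlg.res (A : ArtAlg K) : A →ₐ[K] K := residueMap A A.residue_bijective

/-- The residue map `R → K`. -/
def CompAlg.res (R : CompAlg K) : R →ₐ[K] K := residueMap R R.residue_bijective

theorem ker_algHom_to_field {A : Type*} [CommRing A] [Algebra K A] [IsLocalRing A]
    (f : A →ₐ[K] K) : RingHom.ker f = maximalIdeal A :=
  IsLocalRing.eq_maximalIdeal (RingHom.ker_isMaximal_of_surjective f
    (fun c => ⟨algebraMap K A c, by simp⟩))

/-- `K`-algebra homomorphisms between local `K`-algebras with residue field `K` are automatically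
local. -/
theorem isLocalHom_of_algHom {A B : Type*} [CommRing A] [Algebra K A] [IsLocalRing A]
    [CommRing B] [Algebra K B] [IsLocalRing B] (r : B →ₐ[K] K) (f : A →ₐ[K] B) :
    IsLocalHom f.toRingHom := by
  refine ⟨fun a ha => ?_⟩
  by_contra hn
  have h1 : a ∈ RingHom.ker (r.comp f) := by
    rw [ker_algHom_to_field]; exact hn
  have h2 : f a ∈ maximalIdeal B := by
    rw [← ker_algHom_to_field r]; exact h1
  exact h2 ha

/-- Morphisms of `𝒜_K` are the `K`-algebra homomorphisms; these are automatically local. -/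
instance : Category (ArtAlg K) where
  Hom A B := A →ₐ[K] B
  id A := AlgHom.id K A
  comp f g := g.comp f

/-- The `K`-algebra homomorphism underlying a morphism of `𝒜_K`. -/
def ArtAlg.Hom.hom {A B : ArtAlg K} (f : A ⟶ B) : A →ₐ[K] B := f

/-- A `K`-algebra homomorphism as a morphism of `𝒜_K`. -/
def ArtAlg.ofHom {A B : ArtAlg K} (f : A →ₐ[K] B) : A ⟶ B := f

/-- The ring `K[ε]` of dual numbers, as an object of `𝒜_K`. -/
def dualNumbers (K : Type u) [Field K] : ArtAlg K :=
  haveI : Module.Finite K (DualNumber K) := inferInstanceAs (Module.Finite K (K × K))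
  haveI : IsArtinianRing (DualNumber K) := IsArtinianRing.of_finite K (DualNumber K)
  { carrier := DualNumber K
    residue_bijective := residue_bijective_of_algHom (TrivSqZeroExt.fstHom K K K) }

/-- The artinian quotient `R/𝔪ⁿ⁺¹` of a complete local algebra, as an object of `𝒜_K`. -/
def CompAlg.quot (R : CompAlg K) (n : ℕ) : ArtAlg K :=
  haveI hne : maximalIdeal R ^ (n + 1) ≠ ⊤ := fun h =>
    (maximalIdeal.isMaximal (R : Type u)).ne_top
      (top_le_iff.mp (h ▸ Ideal.pow_le_self (Nat.succ_ne_zero n)))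
  haveI : Nontrivial (R ⧸ maximalIdeal R ^ (n + 1)) := Ideal.Quotient.nontrivial_iff.mpr hne
  haveI : IsLocalRing (R ⧸ maximalIdeal R ^ (n + 1)) :=
    IsLocalRing.of_surjective' _ Ideal.Quotient.mk_surjective
  haveI : IsArtinianRing (R ⧸ maximalIdeal R ^ (n + 1)) :=
    (isArtinianRing_iff_isNilpotent_maximalIdeal _).mpr
      ⟨n + 1, by
        rw [← IsLocalRing.map_maximalIdeal_of_surjective _
          (Ideal.Quotient.mk_surjective (I := maximalIdeal R ^ (n + 1))), ← Ideal.map_pow,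
          Ideal.zero_eq_bot, Ideal.map_quotient_self]⟩
  { carrier := R ⧸ maximalIdeal R ^ (n + 1)
    residue_bijective := residue_bijective_of_algHom
      (Ideal.Quotient.liftₐ _ R.res fun a ha => by
        have h := Ideal.pow_le_self (Nat.succ_ne_zero n) ha
        rw [← ker_algHom_to_field R.res] at h
        exact h) }

/-- The quotient map `R → R/𝔪ⁿ⁺¹`. -/
def CompAlg.toQuot (R : CompAlg K) (n : ℕ) : R →ₐ[K] R.quot n :=
  Ideal.Quotient.mkₐ K (maximalIdeal R ^ (n + 1))

/-- The transition map `R/𝔪ⁿ⁺² → R/𝔪ⁿ⁺¹`. -/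
def CompAlg.trans (R : CompAlg K) (n : ℕ) : R.quot (n + 1) ⟶ R.quot n :=
  ArtAlg.ofHom (Ideal.Quotient.factorₐ K (Ideal.pow_le_pow_right (Nat.le_succ (n + 1))))

/-! ### Formal elements, versality and semiuniversality for functors on `𝒜_K` -/

/-- An element of `F̂(R) = lim F(R/𝔪ⁿ⁺¹)`. -/
structure FormalElement (F : ArtAlg K ⥤ Type (u + 1)) (R : CompAlg K) where
  elt : ∀ n, F.obj (R.quot n)
  compat : ∀ n, F.map (R.trans n) (elt (n + 1)) = elt n

/-- A homomorphism from `R` to an artinian algebra factors through some `R/𝔪ⁿ⁺¹`. -/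
theorem exists_pow_le_ker {R : CompAlg K} {A : ArtAlg K} (v : R →ₐ[K] A) :
    ∃ n, ∀ a ∈ maximalIdeal R ^ (n + 1), v a = 0 := by
  obtain ⟨n, hn⟩ := (isArtinianRing_iff_isNilpotent_maximalIdeal A).mp inferInstance
  refine ⟨n, fun a ha => ?_⟩
  have hle : maximalIdeal R ≤ (maximalIdeal A).comap v.toRingHom := by
    intro r hr
    rw [← ker_algHom_to_field (A.res.comp v)] at hr
    rw [Ideal.mem_comap, ← ker_algHom_to_field A.res]
    exact hr
  have h2 : v a ∈ maximalIdeal A ^ (n + 1) :=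
    Ideal.le_comap_pow v.toRingHom (n + 1) (Ideal.pow_right_mono hle (n + 1) ha)
  rw [pow_succ, hn] at h2
  simpa using h2

/-- The map `R/𝔪ⁿ⁺¹ → A` induced by a homomorphism `R → A` that vanishes on `𝔪ⁿ⁺¹`. -/
def CompAlg.desc {R : CompAlg K} {A : ArtAlg K} (v : R →ₐ[K] A) (n : ℕ)
    (h : ∀ a ∈ maximalIdeal R ^ (n + 1), v a = 0) : R.quot n ⟶ A :=
  ArtAlg.ofHom (Ideal.Quotient.liftₐ (maximalIdeal R ^ (n + 1)) v h)

/-- The morphism of functors `h_R → F`, `h_R = Hom(R, -)`, associated with a formal element `ξ`. -/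
def FormalElement.toMap {F : ArtAlg K ⥤ Type (u + 1)} {R : CompAlg K} (ξ : FormalElement F R)
    (A : ArtAlg K) (v : R →ₐ[K] A) : F.obj A :=
  F.map (CompAlg.desc v (exists_pow_le_ker v).choose (exists_pow_le_ker v).choose_spec)
    (ξ.elt (exists_pow_le_ker v).choose)

/-- The value of the associated morphism does not depend on the chosen factorization. -/
theorem FormalElement.toMap_eq {F : ArtAlg K ⥤ Type (u + 1)} {R : CompAlg K}
    (ξ : FormalElement F R) (A : ArtAlg K) (v : R →ₐ[K] A) (n : ℕ)
    (h : ∀ a ∈ maximalIdeal R ^ (n + 1), v a = 0) :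
    ξ.toMap A v = F.map (CompAlg.desc v n h) (ξ.elt n) := by
  have step : ∀ n (h : ∀ a ∈ maximalIdeal R ^ (n + 1), v a = 0) (k : ℕ)
      (h' : ∀ a ∈ maximalIdeal R ^ (n + k + 1), v a = 0),
      F.map (CompAlg.desc v (n + k) h') (ξ.elt (n + k)) =
        F.map (CompAlg.desc v n h) (ξ.elt n) := by
    intro n h k
    induction k with
    | zero => intro h'; rfl
    | succ k ih =>
      intro h'
      have h'' : ∀ a ∈ maximalIdeal R ^ (n + k + 1), v a = 0 := fun a ha =>
        h a (Ideal.pow_le_pow_right (by omega) ha)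
      rw [← ih h'', ← ξ.compat (n + k)]
      have : CompAlg.desc v (n + (k + 1)) h' = R.trans (n + k) ≫ CompAlg.desc v (n + k) h'' := by
        apply AlgHom.ext
        intro a
        obtain ⟨a, rfl⟩ := Ideal.Quotient.mk_surjective a
        rfl
      rw [this, Functor.map_comp]
      rfl
  have gen : ∀ m (h' : ∀ a ∈ maximalIdeal R ^ (m + 1), v a = 0),
      F.map (CompAlg.desc v m h') (ξ.elt m) = F.map (CompAlg.desc v n h) (ξ.elt n) := by
    intro m h'
    rcases le_total n m with hnm | hnm
    · obtain ⟨k, rfl⟩ := Nat.exists_eq_add_of_le hnm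
      exact step n h k h'
    · obtain ⟨k, rfl⟩ := Nat.exists_eq_add_of_le hnm
      exact (step m h' k h).symm
  exact gen _ _

/-- A formal element is versal if `h_R → F` is smooth: for every surjection `p : A' → A` in `𝒜_K`
the map `h_R(A') → h_R(A) ×_{F(A)} F(A')` is surjective. -/
def FormalElement.IsVersal {F : ArtAlg K ⥤ Type (u + 1)} {R : CompAlg K}
    (ξ : FormalElement F R) : Prop :=
  ∀ (A' A : ArtAlg K) (p : A' ⟶ A), Function.Surjective (ArtAlg.Hom.hom p) →
    ∀ (v : R →ₐ[K] A) (a' : F.obj A'), F.map p a' = ξ.toMap A v →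
      ∃ v' : R →ₐ[K] A', (ArtAlg.Hom.hom p).comp v' = v ∧ ξ.toMap A' v' = a'

/-- A formal element is semiuniversal if it is versal and `h_R(K[ε]) → F(K[ε])` is bijective. -/
def FormalElement.IsSemiuniversal {F : ArtAlg K ⥤ Type (u + 1)} {R : CompAlg K}
    (ξ : FormalElement F R) : Prop :=
  ξ.IsVersal ∧ Function.Bijective (ξ.toMap (dualNumbers K))

/-- Smoothness of a formal deformation space: `R` is a formal power series ring over `K`. -/
def CompAlg.IsSmooth (R : CompAlg K) : Prop :=
  ∃ n : ℕ, Nonempty (R ≃ₐ[K] MvPowerSeries (Fin n) K)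

/-- The coordinate ring of the completion at `0` of a vector space `V` regarded as an affine space:
the completion of `Sym(V*)` at the ideal of the origin. -/
abbrev AffineSpaceCompletion (K : Type u) [Field K] (V : Type u) [AddCommGroup V] [Module K V] :
    Type u :=
  AdicCompletion
    (RingHom.ker (SymmetricAlgebra.algebraMapInv :
      SymmetricAlgebra K (Module.Dual K V) →ₐ[K] K))
    (SymmetricAlgebra K (Module.Dual K V))

/-! ### Deformations of `C → (S ⊃ D ∋ P)` -/

/-- `red : 𝒳 → X` exhibits `Spec 𝒳` as a flat deformation over `A` of `Spec X`: `𝒳` is flat over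
`A`, and `red` induces an isomorphism `𝒳/𝔪_A𝒳 ≅ X` of `K`-algebras. -/
structure IsFlatDeformation (A : ArtAlg K) {X 𝒳 : Type u} [CommRing X] [Algebra K X]
    [CommRing 𝒳] [Algebra A 𝒳] (red : 𝒳 →+* X) : Prop where
  flat : Module.Flat A 𝒳
  red_algebraMap : ∀ a : A, red (algebraMap A 𝒳 a) = algebraMap K X (A.res a)
  surjective : Function.Surjective red
  ker_eq : RingHom.ker red = (maximalIdeal A).map (algebraMap A 𝒳)

variable {O : Type u} [CommRing O] [Algebra K O] [IsLocalRing O]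

/-- A deformation over `A` of `C → (S ⊃ D ∋ P)`, where `S = Spec O`, `P` is the closed point, and
`D`, `C` are the closed subschemes with ideals `ID`, `IC`. All schemes are affine, being
infinitesimal thickenings of affine schemes, and are given by their rings. -/
structure LogDef (ID IC : Ideal O) (A : ArtAlg K) where
  /-- the ring of the deformation `𝒮` of `S` -/
  S : Type u
  [commRingS : CommRing S]
  [algebraS : Algebra A S]
  /-- restriction to the closed fibre -/
  redS : S →+* O
  isFlatDeformationS : IsFlatDeformation A redS
  /-- the ideal of `𝒟 ⊂ 𝒮` -/
  D : Ideal S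
  flat_D : Module.Flat A (S ⧸ D)
  D_zero : D.map redS = ID
  /-- the ideal of the section `𝒫 ⊂ 𝒟` -/
  P : Ideal S
  D_le_P : D ≤ P
  section_P : Function.Bijective (algebraMap A (S ⧸ P))
  P_zero : P.map redS = maximalIdeal O
  /-- the ring of the deformation `𝒞` of `C` -/
  C : Type u
  [commRingC : CommRing C]
  [algebraC : Algebra A C]
  /-- restriction to the closed fibre -/
  redC : C →+* O ⧸ IC
  isFlatDeformationC : IsFlatDeformation A redC
  /-- the morphism `𝒞 → 𝒮` -/
  ι : S →ₐ[A] C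
  ι_zero : ∀ s, redC (ι s) = Ideal.Quotient.mk IC (redS s)

attribute [instance] LogDef.commRingS LogDef.algebraS LogDef.commRingC LogDef.algebraC

namespace LogDef

variable {ID IC : Ideal O} {A : ArtAlg K}

/-- Isomorphism of deformations of `C → (S ⊃ D ∋ P)`. -/
def Iso (δ δ' : LogDef ID IC A) : Prop :=
  ∃ (β : δ.S ≃ₐ[A] δ'.S) (α : δ.C ≃ₐ[A] δ'.C),
    (∀ s, δ'.redS (β s) = δ.redS s) ∧ (∀ c, δ'.redC (α c) = δ.redC c) ∧
    (∀ s, δ'.ι (β s) = α (δ.ι s)) ∧ δ.D.map β = δ'.D ∧ δ.P.map β = δ'.P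

theorem Iso.refl (δ : LogDef ID IC A) : δ.Iso δ :=
  ⟨AlgEquiv.refl, AlgEquiv.refl, fun _ => rfl, fun _ => rfl, fun _ => rfl,
    Ideal.map_id _, Ideal.map_id _⟩

theorem Iso.symm {δ δ' : LogDef ID IC A} : δ.Iso δ' → δ'.Iso δ := by
  rintro ⟨β, α, h1, h2, h3, h4, h5⟩
  refine ⟨β.symm, α.symm, fun s => by rw [← h1]; simp, fun c => by rw [← h2]; simp, fun s => ?_,
    ?_, ?_⟩
  · rw [AlgEquiv.eq_symm_apply, ← h3]; simp
  · rw [← h4]; exact Ideal.map_of_equiv (I := δ.D) β.toRingEquiv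
  · rw [← h5]; exact Ideal.map_of_equiv (I := δ.P) β.toRingEquiv

theorem Iso.trans {δ δ' δ'' : LogDef ID IC A} : δ.Iso δ' → δ'.Iso δ'' → δ.Iso δ'' := by
  rintro ⟨β, α, h1, h2, h3, h4, h5⟩ ⟨β', α', h1', h2', h3', h4', h5'⟩
  refine ⟨β.trans β', α.trans α', fun s => by simp [h1, h1'], fun c => by simp [h2, h2'],
    fun s => by simp [h3, h3'], ?_, ?_⟩
  · rw [← h4', ← h4]
    exact (Ideal.map_map (I := δ.D) (β : δ.S →+* δ'.S) (β' : δ'.S →+* δ''.S)).symm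
  · rw [← h5', ← h5]
    exact (Ideal.map_map (I := δ.P) (β : δ.S →+* δ'.S) (β' : δ'.S →+* δ''.S)).symm

instance setoid (ID IC : Ideal O) (A : ArtAlg K) : Setoid (LogDef ID IC A) :=
  ⟨Iso, Iso.refl, Iso.symm, Iso.trans⟩

end LogDef

/-! ### Base change -/

section BaseChange

/-- The map `B ⊗_A 𝒳 → X` to the closed fibre induced by a map `𝒳 → X` to the closed fibre. -/
def redBaseChange {A : ArtAlg K} (B : ArtAlg K) [Algebra A B] [IsScalarTower K A B]
    {X 𝒳 : Type u} [CommRing X] [Algebra K X] [CommRing 𝒳] [Algebra A 𝒳] (red : 𝒳 →+* X)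
    (h : IsFlatDeformation A red) : B ⊗[A] 𝒳 →+* X :=
  letI : Algebra A X := ((algebraMap K X).comp A.res.toRingHom).toAlgebra
  (Algebra.TensorProduct.lift
    ({ (algebraMap K X).comp B.res.toRingHom with
        commutes' := fun a => congrArg (algebraMap K X) (DFunLike.congr_fun
          (algHom_to_field_unique (B.res.comp (IsScalarTower.toAlgHom K A B)) A.res) a) } :
      B →ₐ[A] X)
    ({ red with commutes' := h.red_algebraMap } : 𝒳 →ₐ[A] X)
    (fun _ _ => Commute.all _ _)).toRingHom

variable {A B : ArtAlg K} [Algebra A B] [IsScalarTower K A B]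

theorem redBaseChange_tmul {X 𝒳 : Type u} [CommRing X] [Algebra K X] [CommRing 𝒳] [Algebra A 𝒳]
    (red : 𝒳 →+* X) (h : IsFlatDeformation A red) (b : B) (x : 𝒳) :
    redBaseChange B red h (b ⊗ₜ x) = algebraMap K X (B.res b) * red x := by
  let _ : Algebra A X := ((algebraMap K X).comp A.res.toRingHom).toAlgebra
  exact Algebra.TensorProduct.lift_tmul _ _ _ b x

theorem IsFlatDeformation.baseChange {X 𝒳 : Type u} [CommRing X] [Algebra K X] [CommRing 𝒳]
    [Algebra A 𝒳] {red : 𝒳 →+* X} (h : IsFlatDeformation A red) :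
    IsFlatDeformation B (redBaseChange B red h) where
  flat := haveI := h.flat; inferInstance
  red_algebraMap b := by
    rw [Algebra.TensorProduct.algebraMap_apply, redBaseChange_tmul, map_one, mul_one]; rfl
  surjective x := by
    obtain ⟨s, rfl⟩ := h.surjective x
    exact ⟨1 ⊗ₜ s, by simp [redBaseChange_tmul]⟩
  ker_eq := by
    apply le_antisymm
    · have key : ∀ z : B ⊗[A] 𝒳, ∃ x : 𝒳,
          z - 1 ⊗ₜ x ∈ (maximalIdeal B).map (algebraMap B (B ⊗[A] 𝒳)) := by
        intro z
        induction z with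
        | zero => exact ⟨0, by simp⟩
        | add z z' hz hz' =>
          obtain ⟨x, hx⟩ := hz
          obtain ⟨x', hx'⟩ := hz'
          refine ⟨x + x', ?_⟩
          have := Ideal.add_mem _ hx hx'
          rwa [TensorProduct.tmul_add, add_sub_add_comm]
        | tmul b x =>
          refine ⟨algebraMap A 𝒳 (algebraMap K A (B.res b)) * x, ?_⟩
          have hb : b - algebraMap K B (B.res b) ∈ maximalIdeal B := by
            rw [← ker_algHom_to_field B.res]; simp [RingHom.mem_ker]
          have e : b ⊗ₜ x - 1 ⊗ₜ (algebraMap A 𝒳 (algebraMap K A (B.res b)) * x) =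
              (1 ⊗ₜ x : B ⊗[A] 𝒳) *
                algebraMap B (B ⊗[A] 𝒳) (b - algebraMap K B (B.res b)) := by
            rw [← Algebra.smul_def, TensorProduct.tmul_smul,
              Algebra.TensorProduct.algebraMap_apply, Algebra.TensorProduct.tmul_mul_tmul,
              TensorProduct.smul_tmul', ← TensorProduct.sub_tmul, IsScalarTower.algebraMap_apply K A B,
              Algebra.smul_def]
            simp
          rw [e]
          exact Ideal.mul_mem_left _ _ (Ideal.mem_map_of_mem _ hb)
      have hle : (maximalIdeal B).map (algebraMap B (B ⊗[A] 𝒳)) ≤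
          RingHom.ker (redBaseChange B red h) := by
        rw [Ideal.map_le_iff_le_comap]
        intro b hb
        rw [← ker_algHom_to_field B.res, RingHom.mem_ker] at hb
        rw [Ideal.mem_comap, RingHom.mem_ker, Algebra.TensorProduct.algebraMap_apply,
          redBaseChange_tmul]
        simp [hb]
      intro z hz
      obtain ⟨x, hx⟩ := key z
      have h1 := hle hx
      rw [RingHom.mem_ker, map_sub, RingHom.mem_ker.mp hz, redBaseChange_tmul, map_one, map_one,
        one_mul, zero_sub, neg_eq_zero] at h1
      rw [← RingHom.mem_ker, h.ker_eq] at h1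
      have h2 : (1 ⊗ₜ x : B ⊗[A] 𝒳) ∈ (maximalIdeal B).map (algebraMap B (B ⊗[A] 𝒳)) := by
        have h3 := Ideal.mem_map_of_mem
          (Algebra.TensorProduct.includeRight : 𝒳 →ₐ[A] B ⊗[A] 𝒳).toRingHom h1
        rw [Ideal.map_map] at h3
        have e : ((Algebra.TensorProduct.includeRight : 𝒳 →ₐ[A] B ⊗[A] 𝒳).toRingHom).comp
            (algebraMap A 𝒳) = (algebraMap B (B ⊗[A] 𝒳)).comp (algebraMap A B) := by
          ext a
          simp [Algebra.TensorProduct.algebraMap_apply, Algebra.TensorProduct.tmul_one_eq_one_tmul]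
        rw [e, ← Ideal.map_map] at h3
        refine Ideal.map_mono ?_ h3
        rw [Ideal.map_le_iff_le_comap]
        intro a ha
        rw [← ker_algHom_to_field (B.res.comp (IsScalarTower.toAlgHom K A B))] at ha
        rw [Ideal.mem_comap, ← ker_algHom_to_field B.res]
        exact ha
      have := Ideal.add_mem _ hx h2
      rwa [sub_add_cancel] at this
    · rw [Ideal.map_le_iff_le_comap]
      intro b hb
      rw [← ker_algHom_to_field B.res, RingHom.mem_ker] at hb
      rw [Ideal.mem_comap, RingHom.mem_ker, Algebra.TensorProduct.algebraMap_apply,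
        redBaseChange_tmul]
      simp [hb]

theorem map_redBaseChange {X 𝒳 : Type u} [CommRing X] [Algebra K X] [CommRing 𝒳]
    [Algebra A 𝒳] {red : 𝒳 →+* X} (h : IsFlatDeformation A red) (I : Ideal 𝒳) :
    (I.map (Algebra.TensorProduct.includeRight : 𝒳 →ₐ[A] B ⊗[A] 𝒳)).map
      (redBaseChange B red h) = I.map red := by
  have e : (redBaseChange B red h).comp
      (Algebra.TensorProduct.includeRight : 𝒳 →ₐ[A] B ⊗[A] 𝒳).toRingHom = red := by
    ext x
    simp [redBaseChange_tmul]
  conv_rhs => rw [← e]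
  exact Ideal.map_map (Algebra.TensorProduct.includeRight : 𝒳 →ₐ[A] B ⊗[A] 𝒳).toRingHom
    (redBaseChange B red h)

theorem tensor_ringHom_ext {R₁ R₂ X T : Type u} [CommRing R₁] [CommRing R₂] [Algebra R₁ R₂]
    [CommRing X] [Algebra R₁ X] [CommRing T] {f g : R₂ ⊗[R₁] X →+* T}
    (h : ∀ b x, f (b ⊗ₜ x) = g (b ⊗ₜ x)) : f = g := by
  refine RingHom.ext fun z => ?_
  induction z with
  | zero => simp
  | add z z' hz hz' => rw [map_add, map_add, hz, hz']
  | tmul b x => exact h b x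

theorem redBaseChange_congr {X 𝒳 𝒳' : Type u} [CommRing X] [Algebra K X] [CommRing 𝒳]
    [Algebra A 𝒳] [CommRing 𝒳'] [Algebra A 𝒳'] {red : 𝒳 →+* X} (h : IsFlatDeformation A red)
    {red' : 𝒳' →+* X} (h' : IsFlatDeformation A red') (β : 𝒳 ≃ₐ[A] 𝒳')
    (hβ : ∀ s, red' (β s) = red s) (z : B ⊗[A] 𝒳) :
    redBaseChange B red' h' (Algebra.TensorProduct.congr (AlgEquiv.refl : B ≃ₐ[B] B) β z) =
      redBaseChange B red h z := by
  refine RingHom.congr_fun (f := (redBaseChange B red' h').comp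
    (Algebra.TensorProduct.congr (AlgEquiv.refl : B ≃ₐ[B] B) β : B ⊗[A] 𝒳 →+* B ⊗[A] 𝒳'))
    (tensor_ringHom_ext fun b x => ?_) z
  rw [redBaseChange_tmul, ← hβ]
  exact redBaseChange_tmul red' h' b (β x)

theorem redBaseChange_lid {X 𝒳 : Type u} [CommRing X] [Algebra K X] [CommRing 𝒳]
    [Algebra A 𝒳] {red : 𝒳 →+* X} (h : IsFlatDeformation A red) (z : A ⊗[A] 𝒳) :
    red (Algebra.TensorProduct.lid A 𝒳 z) = redBaseChange A red h z := by
  refine RingHom.congr_fun (f := red.comp (Algebra.TensorProduct.lid A 𝒳 : A ⊗[A] 𝒳 →+* 𝒳))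
    (tensor_ringHom_ext fun b x => ?_) z
  rw [redBaseChange_tmul, ← h.red_algebraMap, ← map_mul, ← Algebra.smul_def]
  rfl

theorem redBaseChange_cancel {B' : ArtAlg K} [Algebra A B'] [IsScalarTower K A B']
    [Algebra B B'] [IsScalarTower K B B'] [IsScalarTower A B B']
    {X 𝒳 : Type u} [CommRing X] [Algebra K X] [CommRing 𝒳]
    [Algebra A 𝒳] {red : 𝒳 →+* X} (h : IsFlatDeformation A red) (z : B' ⊗[B] (B ⊗[A] 𝒳)) :
    redBaseChange B' red h (Algebra.TensorProduct.cancelBaseChange A B B' B' 𝒳 z) =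
      redBaseChange B' (redBaseChange B red h) h.baseChange z := by
  have hres : ∀ b : B, B'.res (algebraMap B B' b) = B.res b := fun b =>
    DFunLike.congr_fun
      (algHom_to_field_unique (B'.res.comp (IsScalarTower.toAlgHom K B B')) B.res) b
  refine RingHom.congr_fun (f := (redBaseChange B' red h).comp
    (Algebra.TensorProduct.cancelBaseChange A B B' B' 𝒳 : B' ⊗[B] (B ⊗[A] 𝒳) →+* B' ⊗[A] 𝒳))
    (tensor_ringHom_ext fun c z => ?_) z
  rw [redBaseChange_tmul]
  induction z with
  | zero => simp
  | add z z' hz hz' => rw [TensorProduct.tmul_add, map_add, hz, hz', map_add, mul_add]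
  | tmul b s =>
    rw [redBaseChange_tmul]
    refine Eq.trans (?_ : _ = redBaseChange B' red h ((b • c) ⊗ₜ s)) ?_
    · exact congrArg (redBaseChange B' red h) (Algebra.TensorProduct.cancelBaseChange_tmul A B B' B' 𝒳 c b s)
    · rw [redBaseChange_tmul, Algebra.smul_def, map_mul, map_mul, hres]
      ring

namespace LogDef

variable {ID IC : Ideal O}

/-- Base change of a deformation along `A → B`. -/
def baseChange (B : ArtAlg K) [Algebra A B] [IsScalarTower K A B] (δ : LogDef ID IC A) :
    LogDef ID IC B where
  S := B ⊗[A] δ.S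
  redS := redBaseChange B δ.redS δ.isFlatDeformationS
  isFlatDeformationS := δ.isFlatDeformationS.baseChange
  D := δ.D.map (Algebra.TensorProduct.includeRight : δ.S →ₐ[A] B ⊗[A] δ.S)
  flat_D :=
    haveI := δ.flat_D
    Module.Flat.of_linearEquiv
      (Algebra.TensorProduct.tensorQuotientEquiv (R := A) B δ.S B δ.D).symm.toLinearEquiv
  D_zero := (map_redBaseChange _ _).trans δ.D_zero
  P := δ.P.map (Algebra.TensorProduct.includeRight : δ.S →ₐ[A] B ⊗[A] δ.S)
  D_le_P := Ideal.map_mono δ.D_le_P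
  section_P := by
    let e : A ≃ₐ[A] δ.S ⧸ δ.P := AlgEquiv.ofBijective (Algebra.ofId A _) δ.section_P
    let e' : B ≃ₐ[B] (B ⊗[A] δ.S) ⧸
        δ.P.map (Algebra.TensorProduct.includeRight : δ.S →ₐ[A] B ⊗[A] δ.S) :=
      (Algebra.TensorProduct.rid A B B).symm.trans
        ((Algebra.TensorProduct.congr AlgEquiv.refl e).trans
          (Algebra.TensorProduct.tensorQuotientEquiv (R := A) B δ.S B δ.P))
    have : ⇑e' = algebraMap B _ := by
      ext b
      simpa using e'.commutes b
    rw [← this]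
    exact e'.bijective
  P_zero := (map_redBaseChange _ _).trans δ.P_zero
  C := B ⊗[A] δ.C
  redC := redBaseChange B δ.redC δ.isFlatDeformationC
  isFlatDeformationC := δ.isFlatDeformationC.baseChange
  ι := Algebra.TensorProduct.map (AlgHom.id B B) δ.ι
  ι_zero z := by
    induction z with
    | zero => simp
    | add z z' hz hz' => rw [map_add, map_add, hz, hz', map_add, map_add]
    | tmul b s =>
      rw [Algebra.TensorProduct.map_tmul, redBaseChange_tmul, redBaseChange_tmul, δ.ι_zero,
        map_mul]
      rfl

theorem Iso.baseChange {δ δ' : LogDef ID IC A} :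
    δ.Iso δ' → (δ.baseChange B).Iso (δ'.baseChange B) := by
  rintro ⟨β, α, h1, h2, h3, h4, h5⟩
  have hI : ∀ (I : Ideal δ.S) (I' : Ideal δ'.S), I.map β = I' →
      (I.map (Algebra.TensorProduct.includeRight : δ.S →ₐ[A] B ⊗[A] δ.S)).map
        (Algebra.TensorProduct.congr (AlgEquiv.refl : B ≃ₐ[B] B) β) =
      I'.map (Algebra.TensorProduct.includeRight : δ'.S →ₐ[A] B ⊗[A] δ'.S) := by
    rintro I _ rfl
    have e : (Algebra.TensorProduct.congr (AlgEquiv.refl : B ≃ₐ[B] B) β :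
          B ⊗[A] δ.S →+* B ⊗[A] δ'.S).comp
        (Algebra.TensorProduct.includeRight : δ.S →ₐ[A] B ⊗[A] δ.S).toRingHom =
        (Algebra.TensorProduct.includeRight : δ'.S →ₐ[A] B ⊗[A] δ'.S).toRingHom.comp
          (β : δ.S →+* δ'.S) := by
      ext s; simp
    have := congrArg (fun g => I.map g) e
    simp only [← Ideal.map_map] at this
    exact this
  refine ⟨Algebra.TensorProduct.congr AlgEquiv.refl β,
    Algebra.TensorProduct.congr AlgEquiv.refl α,
    redBaseChange_congr δ.isFlatDeformationS δ'.isFlatDeformationS β h1,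
    redBaseChange_congr δ.isFlatDeformationC δ'.isFlatDeformationC α h2, fun z => ?_,
    hI _ _ h4, hI _ _ h5⟩
  refine RingHom.congr_fun (f := (Algebra.TensorProduct.map (AlgHom.id B B) δ'.ι).toRingHom.comp
      (Algebra.TensorProduct.congr (AlgEquiv.refl : B ≃ₐ[B] B) β : B ⊗[A] δ.S →+* B ⊗[A] δ'.S))
    (g := (Algebra.TensorProduct.congr (AlgEquiv.refl : B ≃ₐ[B] B) α :
      B ⊗[A] δ.C →+* B ⊗[A] δ'.C).comp (Algebra.TensorProduct.map (AlgHom.id B B) δ.ι).toRingHom)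
    (tensor_ringHom_ext fun b s => ?_) z
  change b ⊗ₜ δ'.ι (β s) = b ⊗ₜ α (δ.ι s)
  rw [h3]

theorem iso_baseChange_id (δ : LogDef ID IC A) : (δ.baseChange A).Iso δ := by
  have hI : ∀ I : Ideal δ.S,
      (I.map (Algebra.TensorProduct.includeRight : δ.S →ₐ[A] A ⊗[A] δ.S)).map
        (Algebra.TensorProduct.lid A δ.S) = I := by
    intro I
    have e : (Algebra.TensorProduct.lid A δ.S : A ⊗[A] δ.S →+* δ.S).comp
        (Algebra.TensorProduct.includeRight : δ.S →ₐ[A] A ⊗[A] δ.S).toRingHom =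
        RingHom.id _ := by
      ext s; simp
    have := congrArg (fun g => I.map g) e
    simp only [← Ideal.map_map, Ideal.map_id] at this
    exact this
  refine ⟨Algebra.TensorProduct.lid A δ.S, Algebra.TensorProduct.lid A δ.C,
    redBaseChange_lid δ.isFlatDeformationS, redBaseChange_lid δ.isFlatDeformationC,
    fun z => ?_, hI _, hI _⟩
  refine RingHom.congr_fun
    (f := δ.ι.toRingHom.comp (Algebra.TensorProduct.lid A δ.S : A ⊗[A] δ.S →+* δ.S))
    (g := (Algebra.TensorProduct.lid A δ.C : A ⊗[A] δ.C →+* δ.C).comp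
      (Algebra.TensorProduct.map (AlgHom.id A A) δ.ι).toRingHom)
    (tensor_ringHom_ext fun b s => ?_) z
  change δ.ι (b • s) = b • δ.ι s
  rw [map_smul]

theorem iso_baseChange_comp {B' : ArtAlg K} [Algebra A B'] [IsScalarTower K A B']
    [Algebra B B'] [IsScalarTower K B B'] [IsScalarTower A B B'] (δ : LogDef ID IC A) :
    ((δ.baseChange B).baseChange B').Iso (δ.baseChange B') := by
  let βS : B' ⊗[B] (B ⊗[A] δ.S) ≃ₐ[B'] B' ⊗[A] δ.S :=
    Algebra.TensorProduct.cancelBaseChange A B B' B' δ.S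
  let βC : B' ⊗[B] (B ⊗[A] δ.C) ≃ₐ[B'] B' ⊗[A] δ.C :=
    Algebra.TensorProduct.cancelBaseChange A B B' B' δ.C
  have hI : ∀ I : Ideal δ.S,
      ((I.map (Algebra.TensorProduct.includeRight : δ.S →ₐ[A] B ⊗[A] δ.S)).map
        (Algebra.TensorProduct.includeRight : B ⊗[A] δ.S →ₐ[B] B' ⊗[B] (B ⊗[A] δ.S))).map βS =
      I.map (Algebra.TensorProduct.includeRight : δ.S →ₐ[A] B' ⊗[A] δ.S) := by
    intro I
    have e : ((βS : B' ⊗[B] (B ⊗[A] δ.S) →+* B' ⊗[A] δ.S).comp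
        (Algebra.TensorProduct.includeRight :
          B ⊗[A] δ.S →ₐ[B] B' ⊗[B] (B ⊗[A] δ.S)).toRingHom).comp
        (Algebra.TensorProduct.includeRight : δ.S →ₐ[A] B ⊗[A] δ.S).toRingHom =
        (Algebra.TensorProduct.includeRight : δ.S →ₐ[A] B' ⊗[A] δ.S).toRingHom := by
      ext s; simp [βS]
    have := congrArg (fun g => I.map g) e
    simp only [← Ideal.map_map] at this
    exact this
  refine ⟨βS, βC, redBaseChange_cancel δ.isFlatDeformationS,
    redBaseChange_cancel δ.isFlatDeformationC, fun z => ?_, hI _, hI _⟩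
  refine RingHom.congr_fun
    (f := (Algebra.TensorProduct.map (AlgHom.id B' B') δ.ι).toRingHom.comp
      (βS : B' ⊗[B] (B ⊗[A] δ.S) →+* B' ⊗[A] δ.S))
    (g := (βC : B' ⊗[B] (B ⊗[A] δ.C) →+* B' ⊗[A] δ.C).comp
      (Algebra.TensorProduct.map (AlgHom.id B' B')
        (Algebra.TensorProduct.map (AlgHom.id B B) δ.ι)).toRingHom)
    (tensor_ringHom_ext fun c z => ?_) z
  induction z with
  | zero => simp
  | add z z' hz hz' => rw [TensorProduct.tmul_add, map_add, map_add, hz, hz']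
  | tmul b s => rfl

/-- `𝒞|_𝒟 ⊇ m𝒫` as Cartier divisors on `𝒟`: in terms of ideals of `𝒮`,
`I_𝒞 + I_𝒟 ⊆ I_𝒫ᵐ + I_𝒟`. -/
def ContainsMultiple (m : ℕ) (δ : LogDef ID IC A) : Prop :=
  RingHom.ker δ.ι ⊔ δ.D ≤ δ.P ^ m ⊔ δ.D

theorem Iso.containsMultiple {m : ℕ} {δ δ' : LogDef ID IC A} :
    δ.Iso δ' → δ.ContainsMultiple m → δ'.ContainsMultiple m := by
  rintro ⟨β, α, -, -, h3, h4, h5⟩ h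
  have hk : RingHom.ker δ'.ι ≤ (RingHom.ker δ.ι).map β := by
    intro s hs
    have : β.symm s ∈ RingHom.ker δ.ι := by
      rw [RingHom.mem_ker] at hs ⊢
      apply α.injective
      rw [← h3, AlgEquiv.apply_symm_apply, hs, map_zero]
    simpa using Ideal.mem_map_of_mem β this
  refine sup_le (hk.trans ?_) le_sup_right
  refine (Ideal.map_mono (le_sup_left.trans h)).trans ?_
  rw [Ideal.map_sup, Ideal.map_pow, h4, h5]

theorem ι_surjective (δ : LogDef ID IC A) : Function.Surjective δ.ι := by
  have step : ∀ n : ℕ, ∀ c : δ.C,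
      ∃ s, c - δ.ι s ∈ ((maximalIdeal A) ^ n).map (algebraMap A δ.C) := by
    intro n
    induction n with
    | zero => intro c; exact ⟨0, by simp [Ideal.map_top]⟩
    | succ n ih =>
      have hm : ∀ c : δ.C, ∃ s, c - δ.ι s ∈ (maximalIdeal A).map (algebraMap A δ.C) := by
        intro c
        obtain ⟨o, ho⟩ := Ideal.Quotient.mk_surjective (δ.redC c)
        obtain ⟨s, rfl⟩ := δ.isFlatDeformationS.surjective o
        refine ⟨s, ?_⟩
        rw [← δ.isFlatDeformationC.ker_eq, RingHom.mem_ker, map_sub, δ.ι_zero, ho, sub_self]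
      have hn : ∀ c ∈ ((maximalIdeal A) ^ n).map (algebraMap A δ.C),
          ∃ s, c - δ.ι s ∈ ((maximalIdeal A) ^ (n + 1)).map (algebraMap A δ.C) := by
        intro c hc
        induction hc using Submodule.span_induction with
        | mem c hc =>
          obtain ⟨a, ha, rfl⟩ := hc
          exact ⟨algebraMap A δ.S a, by simp⟩
        | zero => exact ⟨0, by simp⟩
        | add c c' _ _ h h' =>
          obtain ⟨s, hs⟩ := h
          obtain ⟨s', hs'⟩ := h'
          refine ⟨s + s', ?_⟩
          have := Ideal.add_mem _ hs hs'
          rwa [map_add, add_sub_add_comm]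
        | smul r c hc h =>
          obtain ⟨s, hs⟩ := h
          obtain ⟨s', hs'⟩ := hm r
          refine ⟨s' * s, ?_⟩
          have e : r • c - δ.ι (s' * s) = (r - δ.ι s') * c + δ.ι s' * (c - δ.ι s) := by
            rw [map_mul, smul_eq_mul]; ring
          rw [e]
          refine Ideal.add_mem _ ?_ (Ideal.mul_mem_left _ _ hs)
          rw [pow_succ', Ideal.map_mul]
          exact Ideal.mul_mem_mul hs' hc
      intro c
      obtain ⟨s, hs⟩ := ih c
      obtain ⟨s', hs'⟩ := hn _ hs
      exact ⟨s + s', by rwa [map_add, ← sub_sub]⟩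
  obtain ⟨n, hn⟩ := (isArtinianRing_iff_isNilpotent_maximalIdeal A).mp inferInstance
  intro c
  obtain ⟨s, hs⟩ := step n c
  rw [hn, Ideal.zero_eq_bot, Ideal.map_bot, Ideal.mem_bot, sub_eq_zero] at hs
  exact ⟨s, hs.symm⟩

theorem ContainsMultiple.baseChange {m : ℕ} {δ : LogDef ID IC A} (h : δ.ContainsMultiple m) :
    (δ.baseChange B).ContainsMultiple m := by
  refine sup_le ?_ le_sup_right
  have hk : RingHom.ker (Algebra.TensorProduct.map (AlgHom.id B B) δ.ι) =
      (RingHom.ker δ.ι).map (Algebra.TensorProduct.includeRight : δ.S →ₐ[A] B ⊗[A] δ.S) :=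
    Algebra.TensorProduct.lTensor_ker (A := B) δ.ι δ.ι_surjective
  have h1 := Ideal.map_mono
    (f := (Algebra.TensorProduct.includeRight : δ.S →ₐ[A] B ⊗[A] δ.S)) (le_sup_left.trans h)
  rw [Ideal.map_sup, Ideal.map_pow, ← hk] at h1
  exact h1

/-- Base change along a morphism of `𝒜_K`. -/
def map {A B : ArtAlg K} (φ : A ⟶ B) (δ : LogDef ID IC A) : LogDef ID IC B :=
  letI : Algebra A B := (ArtAlg.Hom.hom φ).toRingHom.toAlgebra
  haveI : IsScalarTower K A B := IsScalarTower.of_algHom (ArtAlg.Hom.hom φ)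
  δ.baseChange B

theorem Iso.map {A B : ArtAlg K} (φ : A ⟶ B) {δ δ' : LogDef ID IC A} (h : δ.Iso δ') :
    (δ.map φ).Iso (δ'.map φ) := by
  let _ : Algebra A B := (ArtAlg.Hom.hom φ).toRingHom.toAlgebra
  have : IsScalarTower K A B := IsScalarTower.of_algHom (ArtAlg.Hom.hom φ)
  exact h.baseChange

theorem ContainsMultiple.map {m : ℕ} {A B : ArtAlg K} (φ : A ⟶ B) {δ : LogDef ID IC A}
    (h : δ.ContainsMultiple m) : (δ.map φ).ContainsMultiple m := by
  let _ : Algebra A B := (ArtAlg.Hom.hom φ).toRingHom.toAlgebra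
  have : IsScalarTower K A B := IsScalarTower.of_algHom (ArtAlg.Hom.hom φ)
  exact h.baseChange

theorem iso_map_id {A : ArtAlg K} (δ : LogDef ID IC A) : (δ.map (𝟙 A)).Iso δ :=
  iso_baseChange_id δ

theorem iso_map_comp {A B B' : ArtAlg K} (φ : A ⟶ B) (ψ : B ⟶ B') (δ : LogDef ID IC A) :
    ((δ.map φ).map ψ).Iso (δ.map (φ ≫ ψ)) := by
  let _ : Algebra A B := (ArtAlg.Hom.hom φ).toRingHom.toAlgebra
  let _ : Algebra B B' := (ArtAlg.Hom.hom ψ).toRingHom.toAlgebra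
  let _ : Algebra A B' := (ArtAlg.Hom.hom (φ ≫ ψ)).toRingHom.toAlgebra
  have : IsScalarTower K A B := IsScalarTower.of_algHom (ArtAlg.Hom.hom φ)
  have : IsScalarTower K B B' := IsScalarTower.of_algHom (ArtAlg.Hom.hom ψ)
  have : IsScalarTower K A B' := IsScalarTower.of_algHom (ArtAlg.Hom.hom (φ ≫ ψ))
  have : IsScalarTower A B B' := IsScalarTower.of_algebraMap_eq fun _ => rfl
  exact iso_baseChange_comp δ

end LogDef

end BaseChange

/-- The functor `Def_{C → (S ⊃ D ∋ P)} : 𝒜_K → Set` of isomorphism classes of deformations. -/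
def defFunctor (ID IC : Ideal O) : ArtAlg K ⥤ Type (u + 1) where
  obj A := Quotient (LogDef.setoid (K := K) ID IC A)
  map φ := TypeCat.ofHom (Quotient.map (LogDef.map φ) fun _ _ h => h.map φ)
  map_id A := by
    ext c
    induction c using Quotient.inductionOn with
    | h δ => exact Quotient.sound δ.iso_map_id
  map_comp φ ψ := by
    ext c
    induction c using Quotient.inductionOn with
    | h δ => exact (Quotient.sound (LogDef.iso_map_comp φ ψ δ)).symm

/-- The subfunctor `Def^m_{C → (S ⊃ D ∋ P)}` of classes of deformations with `𝒞|_𝒟 ⊇ m𝒫`. For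
`m = C.D` it parametrizes deformations with constant intersection multiplicity. -/
def defFunctorMult (ID IC : Ideal O) (m : ℕ) : ArtAlg K ⥤ Type (u + 1) where
  obj A := {c : (defFunctor (K := K) ID IC).obj A //
    ∃ δ : LogDef ID IC A, δ.ContainsMultiple m ∧ Quotient.mk _ δ = c}
  map φ := TypeCat.ofHom fun c => ⟨(defFunctor ID IC).map φ c.1, by
    obtain ⟨_, δ, hδ, rfl⟩ := c
    exact ⟨δ.map φ, hδ.map φ, rfl⟩⟩
  map_id A := by
    ext c
    refine congrArg (fun g => g c.1) ((defFunctor (K := K) ID IC).map_id A)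
  map_comp φ ψ := by
    ext c
    refine congrArg (fun g => g c.1) ((defFunctor (K := K) ID IC).map_comp φ ψ)

/-! ### Families given by an equation -/

/-- The map `A ⊗ O → O` onto the closed fibre of the trivial deformation `S_A = Spec (A ⊗ O)`. -/
def trivialRed (A : ArtAlg K) (O : Type u) [CommRing O] [Algebra K O] : A ⊗[K] O →ₐ[K] O :=
  Algebra.TensorProduct.lift ((Algebra.ofId K O).comp A.res) (AlgHom.id K O)
    (fun _ _ => Commute.all _ _)

/-- The deformation `δ` is isomorphic to `(𝒞, S_A, D_A, P_A)` with `𝒞 ⊂ S_A` the closed subscheme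
`V(G)`, for `G` a function on `S_A = Spec (A ⊗ O)`. -/
def LogDef.IsGivenBy {ID IC : Ideal O} {A : ArtAlg K} (δ : LogDef ID IC A) (G : A ⊗[K] O) :
    Prop :=
  ∃ E : δ.S ≃ₐ[A] A ⊗[K] O,
    (∀ s, trivialRed A O (E s) = δ.redS s) ∧
    δ.D.map E = ID.map (Algebra.TensorProduct.includeRight : O →ₐ[K] A ⊗[K] O) ∧
    δ.P.map E = (maximalIdeal O).map (Algebra.TensorProduct.includeRight : O →ₐ[K] A ⊗[K] O) ∧
    Function.Surjective δ.ι ∧ (RingHom.ker δ.ι).map E = Ideal.span {G}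

/-! ### Formal smooth surface pairs and the logarithmic equianalytic ideal -/

/-- `Spec O` is a formal smooth surface. -/
def IsFormalSmoothSurface (K : Type u) [Field K] (O : Type u) [CommRing O] [Algebra K O] : Prop :=
  Nonempty (O ≃ₐ[K] MvPowerSeries (Fin 2) K)

/-- `Spec O` is a formal smooth curve. -/
def IsFormalSmoothCurve (K : Type u) [Field K] (O : Type u) [CommRing O] [Algebra K O] : Prop :=
  Nonempty (O ≃ₐ[K] PowerSeries K)

/-- The intersection multiplicity `C.D = dim_K O/(I_C + I_D)`. -/
def intersectionMultiplicity (K : Type u) [Field K] {O : Type u} [CommRing O] [Algebra K O]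
    (ID IC : Ideal O) : ℕ :=
  Module.finrank K (O ⧸ (IC ⊔ ID))

variable (K) in
/-- The ideal `T_{S ⊃ D ∋ P} F + ⟨F⟩`, where `T_{S ⊃ D ∋ P}` is the module of derivations of `O`
preserving `D` and `P`. -/
def relEquianalyticIdeal (ID : Ideal O) (F : O) : Ideal O :=
  Ideal.span {g | ∃ θ : Derivation K O O, (∀ a ∈ ID, θ a ∈ ID) ∧
    (∀ a ∈ maximalIdeal O, θ a ∈ maximalIdeal O) ∧ g = θ F} ⊔ Ideal.span {F}

variable (K) in
/-- The logarithmic equianalytic ideal `I^ea_log(C) = (T_{S ⊃ D ∋ P} F + ⟨F⟩) : I_D` of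
`C = V(F)`. -/
def logEquianalyticIdeal (ID : Ideal O) (F : O) : Ideal O :=
  Submodule.colon (relEquianalyticIdeal K ID F) (ID : Set O)

end LogDeformation

end

/-!
The functor `Def^w` is controlled by a single equation. Choose coordinates `x, y` on `S` with
`D = V(y)`; after multiplication by a unit, `F = y f + x ^ w` (`exists_normal_equation`).

*Reduction to equations.* A formal power series ring is formally smooth and `A` is artinian, so
every deformation of `S` over `A` is `A ⊗ O`. Lifting the coordinates `x`, `y` to elements of the
ideals of `𝒫` and `𝒟` makes the whole pair `(𝒟, 𝒫)` trivial (`exists_trivialization`), and the ideal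
of `𝒞` is generated by one lift `G` of `F`, by flatness (`LogDef.exists_isGivenBy`). Conversely,
every lift of `F` defines a flat deformation (`exists_isGivenBy`). The condition `𝒞|_𝒟 ⊇ w𝒫` says
`G ∈ ⟨x ^ w, y⟩`, and multiplication by a unit brings such a `G` into the form `y g + x ^ w`
(`exists_normal_form`); this can be done compatibly with a given normal form over a quotient of `A`.

*Versality.* Suppose that `g` agrees with a member `f + ∑ vᵢ fᵢ` of the linear family modulo an
ideal `I` of `A`. Since the `fᵢ` span `O / I^ea_log(C)`, `y (g - f - ∑ vᵢ fᵢ)` is the sum of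
`∑ nᵢ y fᵢ`, a multiple of `F` and some `θ F`, where `θ` preserves `D` and `P` and all coefficients
lie in `I`. The automorphism `exp (-θ)`, which exists in characteristic zero, and a unit remove the
last two terms up to an error in `𝔪_A I`; flatness puts the error into the ideal of `y` and `x ^ w`,
with coefficients in `𝔪_A I`. Repeating this with `𝔪_A ^ n I` moves the deformation into the linear
family without changing its parameters modulo `I` (`exists_linearFamily`). With `I` the
kernel of a surjection `A' → A` this is the lifting property that defines smoothness of
`Hom(R, -) → Def^w`; with `I = 𝔪_A` it is surjectivity.

*Injectivity on `K[ε]`.* An isomorphism between two members of the linear family over the dual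
numbers is an automorphism `1 + ε θ` of `K[ε] ⊗ O` with `θ` preserving `D` and `P`. Comparing
coefficients of `ε` puts the difference of the two sections in `I^ea_log(C)`, and the `fᵢ` are
independent modulo this ideal (`eq_of_isGivenBy_linearFamily_dualNumbers`).

*Finite codimension.* A prime `p ≠ 𝔪` containing `T F + ⟨F⟩` does not contain `y`, as otherwise
it would contain `x ^ w`; hence it contains `θ F` for all derivations `θ` of `O`, since `y θ`
preserves `D` and `P`. It is minimal over `⟨F⟩`, because `O` has dimension two. As
`O / ⟨F⟩` is reduced, every `g ∈ p` satisfies `s g ∈ ⟨F⟩` for some `s ∉ p`, which forces `θ g ∈ p`.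
In characteristic zero an ideal stable under all derivations of a power series ring is trivial
(`IsFormalSmoothSurface.eq_bot_of_derivation_mem`), a contradiction.
-/


namespace LogDeformation

/-! ### Nilpotent ideals, flatness and completeness -/

section NilpotentIdeals

variable {A : Type*} [CommRing A] {X Y : Type*} [AddCommGroup X] [Module A X] [AddCommGroup Y]
  [Module A Y]

/-- Nakayama's lemma for a nilpotent ideal, without finiteness assumptions. -/
theorem le_of_le_sup_smul_of_isNilpotent {m : Ideal A} (hm : IsNilpotent m) {N N' : Submodule A X}
    (h : N ≤ N' ⊔ m • N) : N ≤ N' := by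
  have key : ∀ k : ℕ, N ≤ N' ⊔ m ^ k • N := by
    intro k
    induction k with
    | zero => simp
    | succ k ih =>
      refine ih.trans (sup_le le_sup_left ?_)
      calc m ^ k • N ≤ m ^ k • (N' ⊔ m • N) := Submodule.smul_mono le_rfl h
        _ = m ^ k • N' ⊔ m ^ (k + 1) • N := by rw [Submodule.smul_sup, pow_succ, mul_smul]
        _ ≤ _ := sup_le_sup_right Submodule.smul_le_right _
  obtain ⟨n, hn⟩ := hm
  simpa [hn] using key n

/-- Flatness of `X / N` makes the map `N / m N → X / m X` injective. -/
theorem inf_smul_top_le_of_flat_quotient (m : Ideal A) (N : Submodule A X)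
    [Module.Flat A (X ⧸ N)] : m • ⊤ ⊓ N ≤ m • N := by
  rintro z ⟨hz, hzN⟩
  have hz' : z ∈ m • Submodule.span A (Set.range (id : X → X)) := by simpa using hz
  rw [Submodule.mem_ideal_smul_span_iff_exists_sum] at hz'
  obtain ⟨a, ha, hsum⟩ := hz'
  rw [Finsupp.sum, ← Finset.sum_coe_sort] at hsum
  have h0 : ∑ i : a.support, a i • (Submodule.Quotient.mk (i : X) : X ⧸ N) = 0 := by
    rw [← (Submodule.Quotient.mk_eq_zero N).mpr hzN, ← hsum, ← Submodule.mkQ_apply, map_sum]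
    simp
  obtain ⟨κ, c, y, hy, hc⟩ := Module.Flat.isTrivialRelation_of_sum_smul_eq_zero h0
  choose y' hy' using fun j => Submodule.Quotient.mk_surjective N (y j)
  have hn : ∀ i : a.support, (i : X) - ∑ j, c i j • y' j ∈ N := by
    intro i
    rw [← Submodule.Quotient.mk_eq_zero, ← Submodule.mkQ_apply, map_sub, map_sum, sub_eq_zero]
    simpa [hy'] using hy i
  have : z = ∑ i : a.support, a i • ((i : X) - ∑ j, c i j • y' j) := by
    simp only [smul_sub, Finset.sum_sub_distrib, Finset.smul_sum, smul_smul]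
    rw [Finset.sum_comm (s := Finset.univ (α := a.support))]
    simp only [← Finset.sum_smul, hc]
    simpa using hsum.symm
  rw [this]
  exact Submodule.sum_mem _ fun i _ => Submodule.smul_mem_smul (ha i) (hn i)

/-- A linear map to a flat module that is bijective modulo a nilpotent ideal is bijective. -/
theorem bijective_of_bijective_mod_nilpotent {m : Ideal A} (hm : IsNilpotent m) (f : X →ₗ[A] Y)
    [Module.Flat A Y] (hsurj : ∀ y, ∃ x, y - f x ∈ m • (⊤ : Submodule A Y))
    (hinj : ∀ x, f x ∈ m • (⊤ : Submodule A Y) → x ∈ m • (⊤ : Submodule A X)) :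
    Function.Bijective f := by
  have hs : Function.Surjective f := by
    rw [← LinearMap.range_eq_top, eq_top_iff]
    refine le_of_le_sup_smul_of_isNilpotent hm fun y _ => ?_
    obtain ⟨x, hx⟩ := hsurj y
    rw [← add_sub_cancel (f x) y]
    exact Submodule.add_mem_sup (LinearMap.mem_range_self f x) hx
  refine ⟨?_, hs⟩
  rw [← LinearMap.ker_eq_bot, eq_bot_iff]
  have hflat : Module.Flat A (X ⧸ LinearMap.ker f) :=
    Module.Flat.of_linearEquiv (f.quotKerEquivOfSurjective hs)
  refine le_of_le_sup_smul_of_isNilpotent hm fun x hx => ?_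
  rw [bot_sup_eq]
  refine inf_smul_top_le_of_flat_quotient m _ ⟨hinj x ?_, hx⟩
  rw [LinearMap.mem_ker.mp hx]
  exact zero_mem _

end NilpotentIdeals

section Completeness

variable {S Q : Type*} [CommRing S] [CommRing Q]

/-- A ring is noetherian if it is so modulo a finitely generated nilpotent ideal. -/
theorem isNoetherianRing_of_nilpotent_ker [IsNoetherianRing Q] (π : S →+* Q)
    (hπ : Function.Surjective π) (hnil : IsNilpotent (RingHom.ker π)) (hfg : (RingHom.ker π).FG) :
    IsNoetherianRing S := by
  refine IsNoetherianRing.of_prime fun p hp => ?_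
  have hle : RingHom.ker π ≤ p := by
    obtain ⟨n, hn⟩ := hnil
    exact hp.le_of_pow_le (n := n) (by rw [hn]; exact bot_le)
  obtain ⟨s, hs⟩ := (isNoetherianRing_iff_ideal_fg Q).mp inferInstance (p.map π)
  choose g hg using hπ
  obtain ⟨t, ht⟩ := hfg
  classical
  have hp' : p = Ideal.span ((s.image g : Finset S) : Set S) ⊔ RingHom.ker π := by
    have h1 := congrArg (Ideal.comap π) hs
    rw [Ideal.comap_map_of_surjective' π (fun q => ⟨g q, hg q⟩), sup_eq_left.mpr hle] at h1
    rw [← h1, ← Ideal.comap_map_of_surjective' π (fun q => ⟨g q, hg q⟩), Ideal.map_span]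
    congr 2
    ext q
    simp [hg]
  refine ⟨s.image g ∪ t, ?_⟩
  rw [hp', ← ht, Finset.coe_union]
  exact Ideal.span_union _ _

/-- If a noetherian ring is complete modulo a nilpotent ideal `ker π ≤ M`, then it is `M`-adically
precomplete. -/
theorem isPrecomplete_of_nilpotent_ker [IsNoetherianRing S] (π : S →+* Q)
    (hπ : Function.Surjective π) (hnil : IsNilpotent (RingHom.ker π)) (M : Ideal S)
    [IsPrecomplete (M.map π) Q] : IsPrecomplete M S := by
  set N := RingHom.ker π
  -- Sequences in `N ^ k` converge, by descending induction on `k`.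
  have key : ∀ j k : ℕ, N ^ (k + j) = ⊥ → ∀ (f : ℕ → S) (c : ℕ), (∀ n, f n ∈ N ^ k) →
      (∀ n, f (n + 1) - f n ∈ M ^ (n - c)) → ∃ L c', ∀ n, f n - L ∈ M ^ (n - c') := by
    intro j
    induction j with
    | zero =>
      intro k hk f c hf _
      refine ⟨0, 0, fun n => ?_⟩
      have := hf n
      rw [add_zero] at hk
      rw [hk, Ideal.mem_bot] at this
      simp [this]
    | succ j ih =>
      intro k hk f c hf hcau
      obtain ⟨c0, hc0⟩ := Ideal.exists_pow_inf_eq_pow_smul M (N ^ k)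
      have hAR : ∀ n, M ^ n ⊓ N ^ k ≤ M ^ (n - c0) * N ^ k := by
        intro n
        rcases le_total c0 n with h | h
        · have := hc0 n h
          simp only [smul_eq_mul, Ideal.mul_top] at this
          rw [this]
          exact Ideal.mul_mono_right inf_le_right
        · rw [Nat.sub_eq_zero_of_le h, pow_zero, one_mul]
          exact inf_le_right
      obtain ⟨r, g, hg⟩ := Submodule.fg_iff_exists_fin_generating_family.mp
        ((isNoetherianRing_iff_ideal_fg S).mp inferInstance (N ^ k))
      have hgN : ∀ i, g i ∈ N ^ k := fun i => by
        rw [← hg]; exact Submodule.subset_span ⟨i, rfl⟩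
      have hdec : ∀ n, ∃ u : Fin r → S, (∀ i, u i ∈ M ^ (n - c - c0)) ∧
          f (n + 1) - f n = ∑ i, u i * g i := by
        intro n
        have h1 := hAR (n - c) ⟨hcau n, sub_mem (hf (n + 1)) (hf n)⟩
        rw [← hg, ← smul_eq_mul, Submodule.mem_ideal_smul_span_iff_exists_sum] at h1
        obtain ⟨a, ha, hs⟩ := h1
        refine ⟨a, ha, ?_⟩
        rw [← hs, Finsupp.sum_fintype _ _ (by simp)]
        rfl
      choose u hu hfu using hdec
      have htel : ∀ n, f n = f 0 + ∑ i, (∑ l ∈ Finset.range n, u l i) * g i := by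
        intro n
        induction n with
        | zero => simp
        | succ n ihn =>
          simp only [Finset.sum_range_succ, add_mul, Finset.sum_add_distrib]
          rw [← hfu n, ← add_assoc, ← ihn]
          ring
      have hlim : ∀ i, ∃ l : S, ∀ n,
          π (∑ j ∈ Finset.range (n + (c + c0)), u j i) - π l ∈ (M.map π) ^ n := by
        intro i
        obtain ⟨q, hq⟩ := IsPrecomplete.prec (I := M.map π) (M := Q) inferInstance
          (f := fun n => π (∑ j ∈ Finset.range (n + (c + c0)), u j i)) (by
            intro m n hmn
            rw [SModEq.comm, SModEq.sub_mem, smul_eq_mul, Ideal.mul_top, ← map_sub,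
              ← Finset.sum_Ico_eq_sub _ (by omega), ← Ideal.map_pow]
            refine Ideal.mem_map_of_mem _ (Ideal.sum_mem _ fun j hj => ?_)
            rw [Finset.mem_Ico] at hj
            exact Ideal.pow_le_pow_right (by omega) (hu j i))
        obtain ⟨l, rfl⟩ := hπ q
        refine ⟨l, fun n => ?_⟩
        have := hq n
        rwa [SModEq.sub_mem, smul_eq_mul, Ideal.mul_top] at this
      choose l hl using hlim
      have hsplit : ∀ n i, ∃ a ∈ M ^ n, ∃ b ∈ N,
          (∑ j ∈ Finset.range (n + (c + c0)), u j i) - l i = a + b := by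
        intro n i
        have h1 := hl i n
        rw [← map_sub, ← Ideal.map_pow, Ideal.mem_map_iff_of_surjective π hπ] at h1
        obtain ⟨a, ha, hab⟩ := h1
        refine ⟨a, ha, _, ?_, (add_sub_cancel a _).symm⟩
        rw [RingHom.mem_ker, map_sub, hab, sub_self]
      choose a ha b hb hab using hsplit
      set L1 := f 0 + ∑ i, l i * g i
      have hf1 : ∀ n, f (n + (c + c0)) - L1 = ∑ i, a n i * g i + ∑ i, b n i * g i := by
        intro n
        rw [htel, ← Finset.sum_add_distrib]
        simp only [← add_mul, ← hab, sub_mul, Finset.sum_sub_distrib, L1]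
        ring
      have haM : ∀ n, ∑ i, a n i * g i ∈ M ^ n := fun n =>
        Ideal.sum_mem _ fun i _ => Ideal.mul_mem_right _ _ (ha n i)
      obtain ⟨L2, c2, hL2⟩ := ih (k + 1) (by rw [← hk]; congr 1; omega)
        (fun n => ∑ i, b n i * g i) 0
        (fun n => Ideal.sum_mem _ fun i _ => by
          rw [pow_succ']; exact Ideal.mul_mem_mul (hb n i) (hgN i))
        (fun n => by
          have e : ∑ i, b (n + 1) i * g i - ∑ i, b n i * g i =
              (f (n + (c + c0) + 1) - f (n + (c + c0))) - ∑ i, a (n + 1) i * g i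
                + ∑ i, a n i * g i := by
            have h1 := hf1 n
            have h2 := hf1 (n + 1)
            rw [show n + 1 + (c + c0) = n + (c + c0) + 1 by ring] at h2
            linear_combination h1 - h2
          rw [e, Nat.sub_zero]
          refine add_mem (sub_mem ?_ ?_) (haM n)
          · exact Ideal.pow_le_pow_right (by omega) (hcau _)
          · exact Ideal.pow_le_pow_right (by omega) (haM (n + 1)))
      refine ⟨L1 + L2, c + c0 + c2, fun n => ?_⟩
      rcases le_total (c + c0) n with h | h
      · obtain ⟨n, rfl⟩ := Nat.exists_eq_add_of_le' h
        have e : f (n + (c + c0)) - (L1 + L2) =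
            ∑ i, a n i * g i + (∑ i, b n i * g i - L2) := by
          linear_combination hf1 n
        rw [e]
        refine add_mem ?_ ?_
        · exact Ideal.pow_le_pow_right (by omega) (haM n)
        · exact Ideal.pow_le_pow_right (by omega) (hL2 n)
      · rw [Nat.sub_eq_zero_of_le (by omega), pow_zero, Ideal.one_eq_top]
        exact Submodule.mem_top
  refine ⟨fun f hf => ?_⟩
  obtain ⟨e, he⟩ := hnil
  obtain ⟨L, c, hL⟩ := key e 0 (by simpa using he) f 0 (by simp) (fun n => by
    have := (hf (Nat.le_succ n)).symm
    rwa [SModEq.sub_mem, smul_eq_mul, Ideal.mul_top] at this)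
  refine ⟨L, fun n => ?_⟩
  rw [SModEq.sub_mem, smul_eq_mul, Ideal.mul_top]
  have h1 := hf (Nat.le_add_right n c)
  rw [SModEq.sub_mem, smul_eq_mul, Ideal.mul_top] at h1
  have h2 := hL (n + c)
  rw [Nat.add_sub_cancel] at h2
  have := add_mem h1 h2
  rwa [sub_add_sub_cancel] at this

end Completeness

/-! ### Power series rings -/

section PowerSeries

variable {K : Type*} [Field K] {σ : Type*} [Finite σ]

theorem sub_truncTotal_mem_pow (n : ℕ) (p : MvPowerSeries σ K) :
    p - (p.truncTotal n : MvPolynomial σ K) ∈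
      Ideal.span (Set.range (MvPowerSeries.X : σ → MvPowerSeries σ K)) ^ n := by
  set I := MvPolynomial.idealOfVars σ K
  set q : MvPowerSeries σ K := p - (p.truncTotal n : MvPolynomial σ K)
  have h1 : MvPowerSeries.toAdicCompletionAlgEquiv σ K q ∈
      (I ^ n • ⊤ : Submodule (MvPolynomial σ K) (AdicCompletion I (MvPolynomial σ K))) := by
    rw [AdicCompletion.pow_smul_top_eq_ker_eval (MvPolynomial.idealOfVars_fg σ K),
      LinearMap.mem_ker, map_sub, map_sub, MvPowerSeries.toAdicCompletionAlgEquiv_apply,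
      MvPowerSeries.toAdicCompletionAlgEquiv_apply, MvPowerSeries.toAdicCompletion_coe,
      AdicCompletion.eval_of, AdicCompletion.eval_apply,
      MvPowerSeries.toAdicCompletion_apply_eq_mk_truncTotal, sub_eq_zero]
    rfl
  have h2 := Submodule.mem_map_of_mem
    (f := (MvPowerSeries.toAdicCompletionAlgEquiv σ K).symm.toLinearMap) h1
  rw [Submodule.map_smul''] at h2
  have h3 : q ∈ (I ^ n • ⊤ : Submodule (MvPolynomial σ K) (MvPowerSeries σ K)) := by
    refine Submodule.smul_mono le_rfl le_top (?_ : q ∈ I ^ n •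
      (⊤ : Submodule (MvPolynomial σ K) (AdicCompletion I (MvPolynomial σ K))).map
        (MvPowerSeries.toAdicCompletionAlgEquiv σ K).symm.toLinearMap)
    rwa [show (MvPowerSeries.toAdicCompletionAlgEquiv σ K).symm.toLinearMap
      (MvPowerSeries.toAdicCompletionAlgEquiv σ K q) = q from
      (MvPowerSeries.toAdicCompletionAlgEquiv σ K).symm_apply_apply q] at h2
  have hX : algebraMap (MvPolynomial σ K) (MvPowerSeries σ K) ∘ MvPolynomial.X =
      MvPowerSeries.X := by
    funext i
    exact MvPolynomial.coe_X i
  rw [Ideal.smul_top_eq_map, Submodule.restrictScalars_mem, Ideal.map_pow, Ideal.map_span,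
    ← Set.range_comp, hX] at h3
  exact h3

theorem maximalIdeal_mvPowerSeries :
    maximalIdeal (MvPowerSeries σ K) = Ideal.span (Set.range MvPowerSeries.X) := by
  apply le_antisymm
  · intro p hp
    have hc : MvPowerSeries.constantCoeff p = 0 := by
      by_contra h
      exact hp (MvPowerSeries.isUnit_iff_constantCoeff.mpr (isUnit_iff_ne_zero.mpr h))
    have h := sub_truncTotal_mem_pow 1 p
    have ht : p.truncTotal 1 = 0 := by
      ext d
      rw [MvPowerSeries.coeff_truncTotal_eq_ite]
      split_ifs with hd
      · have : d = 0 := (Finsupp.degree_eq_zero_iff d).mp (by omega)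
        rw [this]
        simpa using hc
      · simp
    simpa [ht] using h
  · rw [Ideal.span_le]
    rintro _ ⟨i, rfl⟩ h
    have := MvPowerSeries.isUnit_constantCoeff _ h
    simp at this

instance isAdicComplete_mvPowerSeries :
    IsAdicComplete (maximalIdeal (MvPowerSeries σ K)) (MvPowerSeries σ K) := by
  rw [maximalIdeal_mvPowerSeries]
  infer_instance

/-- A homomorphism from a power series ring to an adically separated algebra is determined by the
images of the variables; continuity is automatic. -/
theorem mvPowerSeries_hom_ext {B : Type*} [CommRing B] [Algebra K B] (I : Ideal B)
    [IsHausdorff I B] {φ ψ : MvPowerSeries σ K →ₐ[K] B}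
    (h : ∀ i, φ (MvPowerSeries.X i) = ψ (MvPowerSeries.X i))
    (hI : ∀ i, φ (MvPowerSeries.X i) ∈ I) : φ = ψ := by
  have hpoly : ∀ q : MvPolynomial σ K, φ q = ψ q := by
    intro q
    have : φ.comp (MvPolynomial.coeToMvPowerSeries.algHom K) =
        ψ.comp (MvPolynomial.coeToMvPowerSeries.algHom K) := by
      ext i
      simp [h]
    simpa using DFunLike.congr_fun this q
  have hmem : ∀ θ : MvPowerSeries σ K →ₐ[K] B, (∀ i, θ (MvPowerSeries.X i) ∈ I) →
      ∀ n, ∀ p ∈ Ideal.span (Set.range (MvPowerSeries.X : σ → MvPowerSeries σ K)) ^ n,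
        θ p ∈ I ^ n := by
    intro θ hθ n p hp
    have hle : Ideal.span (Set.range (MvPowerSeries.X : σ → MvPowerSeries σ K)) ≤
        I.comap θ := by
      rw [Ideal.span_le]
      rintro _ ⟨i, rfl⟩
      exact hθ i
    exact Ideal.le_comap_pow θ n (Ideal.pow_right_mono hle n hp)
  refine AlgHom.ext fun p => (IsHausdorff.eq_iff_smodEq (I := I)).mpr fun n => ?_
  rw [SModEq.sub_mem, smul_eq_mul, Ideal.mul_top]
  have e : φ p - ψ p = φ (p - (p.truncTotal n : MvPolynomial σ K)) -
      ψ (p - (p.truncTotal n : MvPolynomial σ K)) := by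
    rw [map_sub, map_sub, hpoly]
    ring
  rw [e]
  exact sub_mem (hmem φ hI n _ (sub_truncTotal_mem_pow n p))
    (hmem ψ (fun i => h i ▸ hI i) n _ (sub_truncTotal_mem_pow n p))

/-- Evaluation of power series at elements of `I` in an `I`-adically complete algebra. -/
theorem exists_mvPowerSeries_hom {B : Type*} [CommRing B] [Algebra K B] (I : Ideal B)
    [IsAdicComplete I B] (b : σ → B) (hb : ∀ i, b i ∈ I) :
    ∃ φ : MvPowerSeries σ K →ₐ[K] B, ∀ i, φ (MvPowerSeries.X i) = b i := by
  have hle : MvPolynomial.idealOfVars σ K ≤ I.comap (MvPolynomial.aeval (R := K) b) := by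
    rw [Ideal.span_le]
    rintro _ ⟨i, rfl⟩
    simpa using hb i
  let g : ∀ n, (MvPolynomial σ K ⧸ MvPolynomial.idealOfVars σ K ^ n) →ₐ[K] B ⧸ I ^ n := fun n =>
    Ideal.quotientMapₐ (I ^ n) (MvPolynomial.aeval (R := K) b)
      ((Ideal.pow_right_mono hle n).trans (Ideal.le_comap_pow _ n))
  let f : ∀ n, MvPowerSeries σ K →ₐ[K] B ⧸ I ^ n := fun n =>
    (g n).comp ((MvPowerSeries.truncTotalAlgHom σ K n).restrictScalars K)
  have hf : ∀ {m n : ℕ} (hle : m ≤ n),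
      (Ideal.Quotient.factorₐ K (Ideal.pow_le_pow_right hle)).comp (f n) = f m := by
    intro m n hmn
    ext p
    change Ideal.Quotient.mk (I ^ m) (MvPolynomial.aeval b (p.truncTotal n)) =
      Ideal.Quotient.mk (I ^ m) (MvPolynomial.aeval b (p.truncTotal m))
    rw [Ideal.Quotient.eq, ← map_sub]
    exact ((Ideal.pow_right_mono hle m).trans (Ideal.le_comap_pow _ m))
      (MvPowerSeries.truncTotal_sub_truncTotal_mem_pow_idealOfVars hmn le_rfl p)
  refine ⟨IsAdicComplete.liftAlgHom I f hf, fun i => ?_⟩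
  refine (IsHausdorff.eq_iff_smodEq (I := I)).mpr fun n => ?_
  rw [SModEq.sub_mem, smul_eq_mul, Ideal.mul_top, ← Ideal.Quotient.eq]
  refine (IsAdicComplete.mk_liftAlgHom I f hf n _).trans ?_
  change Ideal.Quotient.mk (I ^ n) (MvPolynomial.aeval b ((MvPowerSeries.X i).truncTotal n)) = _
  rw [Ideal.Quotient.eq]
  have h1 : (MvPowerSeries.X i : MvPowerSeries σ K).truncTotal n - MvPolynomial.X i ∈
      MvPolynomial.idealOfVars σ K ^ n := by
    rw [MvPolynomial.mem_pow_idealOfVars_iff']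
    intro d hd
    rw [MvPolynomial.coeff_sub, MvPowerSeries.coeff_truncTotal _ hd, ← MvPolynomial.coe_X,
      MvPolynomial.coeff_coe, sub_self]
  have := ((Ideal.pow_right_mono hle n).trans (Ideal.le_comap_pow _ n)) h1
  simpa using this

/-- A surjective endomorphism of a noetherian ring is injective. -/
theorem injective_of_surjective_ringHom {B : Type*} [CommRing B] [IsNoetherianRing B]
    (φ : B →+* B) (h : Function.Surjective φ) : Function.Injective φ := by
  let c : ℕ →o Ideal B :=
    ⟨fun n => RingHom.ker (φ ^ n), monotone_nat_of_le_succ fun n b hb => by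
      rw [RingHom.mem_ker] at hb ⊢
      rw [pow_succ', RingHom.mul_def, RingHom.comp_apply, hb, map_zero]⟩
  obtain ⟨n, hn⟩ := monotone_stabilizes_iff_noetherian.mpr ‹IsNoetherianRing B› c
  rw [injective_iff_map_eq_zero]
  intro b hb
  have hsn : Function.Surjective (φ ^ n) := by
    rw [RingHom.coe_pow]
    exact h.iterate n
  obtain ⟨b, rfl⟩ := hsn b
  have : b ∈ c (n + 1) := by
    change b ∈ RingHom.ker (φ ^ (n + 1))
    rw [RingHom.mem_ker, pow_succ', RingHom.mul_def, RingHom.comp_apply, hb]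
  rw [← hn (n + 1) (Nat.le_succ n)] at this
  exact this

end PowerSeries

/-- Generators `x`, `y` of the maximal ideal of a formal smooth surface are formal coordinates. -/
theorem exists_coordinates {K O : Type u} [Field K] [CommRing O] [IsLocalRing O] [Algebra K O]
    (hS : IsFormalSmoothSurface K O) {x y : O} (hm : maximalIdeal O = Ideal.span {x, y}) :
    ∃ e : MvPowerSeries (Fin 2) K ≃ₐ[K] O, e (MvPowerSeries.X 0) = x ∧
      e (MvPowerSeries.X 1) = y := by
  obtain ⟨e₀⟩ := hS
  let B := MvPowerSeries (Fin 2) K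
  have hmap : (maximalIdeal O).map e₀ = maximalIdeal B :=
    IsLocalRing.map_maximalIdeal_of_surjective (e₀ : O →+* B) e₀.surjective
  have hB : maximalIdeal B = Ideal.span {e₀ x, e₀ y} := by
    rw [← hmap, hm, Ideal.map_span, Set.image_pair]
  obtain ⟨φ, hφ⟩ := exists_mvPowerSeries_hom (K := K) (maximalIdeal B) ![e₀ x, e₀ y] (by
    intro i
    rw [hB]
    fin_cases i
    · exact Ideal.subset_span (by simp)
    · exact Ideal.subset_span (by simp))
  have hφm : (maximalIdeal B).map (φ : B →+* B) = maximalIdeal B := by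
    conv_lhs => rw [maximalIdeal_mvPowerSeries]
    rw [Ideal.map_span, ← Set.range_comp, hB]
    congr 1
    ext b
    simp [hφ, eq_comm]
  have hsurj : Function.Surjective φ := by
    have : IsHausdorff ((maximalIdeal B).map (φ : B →+* B)) B := by rw [hφm]; infer_instance
    refine surjective_of_mk_map_comp_surjective (I := maximalIdeal B) (φ : B →+* B) ?_
    rw [hφm]
    intro b
    obtain ⟨b, rfl⟩ := Ideal.Quotient.mk_surjective b
    refine ⟨algebraMap K B (MvPowerSeries.constantCoeff b), ?_⟩
    simp only [RingHom.comp_apply, RingHom.coe_coe, AlgHom.commutes]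
    rw [Ideal.Quotient.eq]
    rw [← ker_algHom_to_field
      ({ (MvPowerSeries.constantCoeff : B →+* K) with commutes' := fun _ => by simp; rfl } :
        B →ₐ[K] K), RingHom.mem_ker, map_sub, sub_eq_zero]
    change MvPowerSeries.constantCoeff _ = _
    simp
    rfl
  have hbij : Function.Bijective φ :=
    ⟨injective_of_surjective_ringHom (φ : B →+* B) hsurj, hsurj⟩
  refine ⟨(AlgEquiv.ofBijective φ hbij).trans e₀.symm, ?_, ?_⟩
  · simp [hφ]
  · simp [hφ]

/-! ### Triviality of the deformations of the ambient pair -/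

section Surface

variable {K O : Type u} [Field K] [CommRing O] [Algebra K O]

theorem IsFormalSmoothSurface.isNoetherianRing (hS : IsFormalSmoothSurface K O) :
    IsNoetherianRing O := by
  obtain ⟨e⟩ := hS
  exact isNoetherianRing_of_ringEquiv _ e.symm.toRingEquiv

theorem IsFormalSmoothSurface.isDomain (hS : IsFormalSmoothSurface K O) : IsDomain O := by
  obtain ⟨e⟩ := hS
  have : IsDomain (MvPowerSeries (Fin 2) K) := NoZeroDivisors.to_isDomain _
  exact e.toMulEquiv.isDomain (MvPowerSeries (Fin 2) K)

theorem IsFormalSmoothSurface.isAdicComplete [IsLocalRing O] (hS : IsFormalSmoothSurface K O) :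
    IsAdicComplete (maximalIdeal O) O := by
  obtain ⟨e⟩ := hS
  have h : (maximalIdeal (MvPowerSeries (Fin 2) K)).map e.symm.toRingEquiv = maximalIdeal O :=
    IsLocalRing.map_maximalIdeal_of_surjective
      (e.symm.toRingEquiv : MvPowerSeries (Fin 2) K →+* O) e.symm.surjective
  rw [← h]
  exact (IsAdicComplete.congr_ringEquiv _ e.symm.toRingEquiv).mpr inferInstance

end Surface

theorem ArtAlg.isNilpotent_maximalIdeal {K : Type u} [Field K] (A : ArtAlg K) :
    IsNilpotent (maximalIdeal A) :=
  (isArtinianRing_iff_isNilpotent_maximalIdeal A).mp inferInstance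

theorem ArtAlg.mem_maximalIdeal_iff {K : Type u} [Field K] (A : ArtAlg K) (a : A) :
    a ∈ maximalIdeal A ↔ A.res a = 0 := by
  rw [← ker_algHom_to_field A.res, RingHom.mem_ker]

theorem ArtAlg.res_comp {K : Type u} [Field K] {A B : ArtAlg K} (f : A →ₐ[K] B) (a : A) :
    B.res (f a) = A.res a :=
  DFunLike.congr_fun (algHom_to_field_unique (B.res.comp f) A.res) a

theorem isLocalHom_of_isNilpotent_ker {S Q : Type*} [CommRing S] [CommRing Q] (π : S →+* Q)
    (hπ : Function.Surjective π) (hnil : IsNilpotent (RingHom.ker π)) : IsLocalHom π := by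
  refine ⟨fun s hs => ?_⟩
  obtain ⟨q, hq⟩ := hs.exists_right_inv
  obtain ⟨t, rfl⟩ := hπ q
  have h1 : s * t - 1 ∈ RingHom.ker π := by
    rw [RingHom.mem_ker, map_sub, map_mul, hq, map_one, sub_self]
  have h2 : IsNilpotent (s * t - 1) := by
    obtain ⟨n, hn⟩ := hnil
    refine ⟨n, ?_⟩
    have := Ideal.pow_mem_pow h1 n
    rwa [hn] at this
  have h3 := h2.isUnit_add_one
  rw [sub_add_cancel] at h3
  exact isUnit_of_mul_isUnit_left h3

section FlatDeformation

variable {K O : Type u} [Field K] [CommRing O] [Algebra K O] {A : ArtAlg K}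

section

variable {𝒮 : Type u} [CommRing 𝒮] [Algebra A 𝒮] {red : 𝒮 →+* O}

theorem IsFlatDeformation.mem_smul_top_iff (h : IsFlatDeformation A red) (s : 𝒮) :
    s ∈ (maximalIdeal A • ⊤ : Submodule A 𝒮) ↔ red s = 0 := by
  rw [Ideal.smul_top_eq_map, Submodule.restrictScalars_mem, ← h.ker_eq, RingHom.mem_ker]

theorem IsFlatDeformation.isNilpotent_ker (h : IsFlatDeformation A red) :
    IsNilpotent (RingHom.ker red) := by
  obtain ⟨n, hn⟩ := A.isNilpotent_maximalIdeal
  exact ⟨n, by rw [h.ker_eq, ← Ideal.map_pow, hn, Ideal.zero_eq_bot, Ideal.map_bot]; rfl⟩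

theorem IsFlatDeformation.isLocalHom (h : IsFlatDeformation A red) : IsLocalHom red :=
  isLocalHom_of_isNilpotent_ker red h.surjective h.isNilpotent_ker

/-- An infinitesimal deformation of a complete noetherian local ring is complete. -/
theorem IsFlatDeformation.isAdicComplete [IsLocalRing O] [IsNoetherianRing O]
    [IsAdicComplete (maximalIdeal O) O] (h : IsFlatDeformation A red) :
    IsAdicComplete ((maximalIdeal O).comap red) 𝒮 := by
  have : IsNoetherianRing 𝒮 := isNoetherianRing_of_nilpotent_ker red h.surjective
    h.isNilpotent_ker (by
      rw [h.ker_eq]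
      exact Ideal.FG.map ((isNoetherianRing_iff_ideal_fg A).mp inferInstance _) _)
  have := h.isLocalHom
  have : IsLocalRing 𝒮 := RingHom.domain_isLocalRing red
  have : IsHausdorff ((maximalIdeal O).comap red) 𝒮 :=
    IsHausdorff.of_isLocalRing _ _ (Ideal.IsPrime.ne_top inferInstance)
  have : IsPrecomplete (((maximalIdeal O).comap red).map red) O := by
    rw [Ideal.map_comap_of_surjective red h.surjective]
    infer_instance
  have := isPrecomplete_of_nilpotent_ker red h.surjective h.isNilpotent_ker
    ((maximalIdeal O).comap red)
  exact {}

/-- Generators of the restriction to the closed fibre of a flat closed subscheme lift to generators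
of its ideal. -/
theorem IsFlatDeformation.eq_span (h : IsFlatDeformation A red) (D : Ideal 𝒮)
    [hD : Module.Flat A (𝒮 ⧸ D)] (s : Set 𝒮) (hs : s ⊆ D)
    (hred : D.map red = Ideal.span (red '' s)) :
    D = Ideal.span s := by
  refine le_antisymm ?_ (Ideal.span_le.mpr hs)
  have : Module.Flat A (𝒮 ⧸ D.restrictScalars A) := hD
  refine le_of_le_sup_smul_of_isNilpotent A.isNilpotent_maximalIdeal
    (N := D.restrictScalars A) (N' := (Ideal.span s).restrictScalars A) fun d hd => ?_
  have h1 : red d ∈ (Ideal.span s).map red := by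
    rw [Ideal.map_span, ← hred]
    exact Ideal.mem_map_of_mem _ hd
  rw [Ideal.mem_map_iff_of_surjective red h.surjective] at h1
  obtain ⟨t, ht, htd⟩ := h1
  rw [← add_sub_cancel t d]
  refine Submodule.add_mem_sup ht (inf_smul_top_le_of_flat_quotient _ _ ⟨?_, ?_⟩)
  · exact (h.mem_smul_top_iff _).mpr (by rw [map_sub, htd, sub_self])
  · exact sub_mem hd (Ideal.span_le.mpr hs ht)

end

theorem trivialRed_tmul (a : A) (o : O) :
    trivialRed A O (a ⊗ₜ o) = algebraMap K O (A.res a) * o := by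
  simp [trivialRed, Algebra.ofId_apply]

/-- The trivial deformation. -/
theorem isFlatDeformation_trivialRed :
    IsFlatDeformation A (trivialRed A O : A ⊗[K] O →+* O) where
  flat := inferInstance
  red_algebraMap a := by
    rw [Algebra.TensorProduct.algebraMap_apply]
    simp [trivialRed_tmul]
  surjective o := ⟨1 ⊗ₜ o, by simp [trivialRed_tmul]⟩
  ker_eq := by
    apply le_antisymm
    · have key : ∀ z : A ⊗[K] O, z - 1 ⊗ₜ trivialRed A O z ∈
          (maximalIdeal A).map (algebraMap A (A ⊗[K] O)) := by
        intro z
        induction z with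
        | zero => simp
        | add z z' hz hz' =>
          rw [map_add, TensorProduct.tmul_add, add_sub_add_comm]
          exact add_mem hz hz'
        | tmul a o =>
          have e : a ⊗ₜ[K] o - 1 ⊗ₜ trivialRed A O (a ⊗ₜ o) =
              (1 ⊗ₜ o : A ⊗[K] O) * algebraMap A (A ⊗[K] O) (a - algebraMap K A (A.res a)) := by
            rw [trivialRed_tmul, ← Algebra.smul_def, TensorProduct.tmul_smul,
              TensorProduct.smul_tmul', Algebra.TensorProduct.algebraMap_apply,
              Algebra.TensorProduct.tmul_mul_tmul, ← TensorProduct.sub_tmul,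
              Algebra.algebraMap_eq_smul_one (A := (A : Type u)) (A.res a)]
            simp
          rw [e]
          refine Ideal.mul_mem_left _ _ (Ideal.mem_map_of_mem _ ?_)
          rw [A.mem_maximalIdeal_iff]
          simp
      intro z hz
      have hz' : trivialRed A O z = 0 := hz
      have := key z
      rwa [hz', TensorProduct.tmul_zero, sub_zero] at this
    · rw [Ideal.map_le_iff_le_comap]
      intro a ha
      rw [A.mem_maximalIdeal_iff] at ha
      rw [Ideal.mem_comap, RingHom.mem_ker, Algebra.TensorProduct.algebraMap_apply]
      simp [trivialRed_tmul, ha]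

theorem isUnit_of_isUnit_trivialRed {z : A ⊗[K] O} (h : IsUnit (trivialRed A O z)) : IsUnit z :=
  (isFlatDeformation_trivialRed (A := A) (O := O)).isLocalHom.map_nonunit z h

/-- The map `A ⊗ O → B ⊗ O` induced by `A → B`. -/
noncomputable abbrev tensorMap (O : Type u) [CommRing O] [Algebra K O] {A B : ArtAlg K}
    (φ : A →ₐ[K] B) : A ⊗[K] O →ₐ[K] B ⊗[K] O :=
  Algebra.TensorProduct.map φ (AlgHom.id K O)

theorem trivialRed_tensorMap {B : ArtAlg K} (φ : A →ₐ[K] B) (z : A ⊗[K] O) :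
    trivialRed B O (tensorMap O φ z) = trivialRed A O z := by
  induction z with
  | zero => simp
  | add z z' hz hz' => rw [map_add, map_add, map_add, hz, hz']
  | tmul a o => simp [trivialRed_tmul, ArtAlg.res_comp]

variable [IsLocalRing O] (hS : IsFormalSmoothSurface K O) {x y : O}
  (hm : maximalIdeal O = Ideal.span {x, y})

include hS hm in
/-- Homomorphisms from `A ⊗ K[[x, y]]` to a separated ring are determined by their restriction to
`A` and by the images of the coordinates. -/
theorem tensor_hom_ext {T : Type u} [CommRing T] (I : Ideal T) [IsHausdorff I T]
    {θ θ' : A ⊗[K] O →+* T} (hA : ∀ a : A, θ (a ⊗ₜ 1) = θ' (a ⊗ₜ 1))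
    (hx : θ (1 ⊗ₜ x) = θ' (1 ⊗ₜ x)) (hy : θ (1 ⊗ₜ y) = θ' (1 ⊗ₜ y))
    (hxI : θ (1 ⊗ₜ x) ∈ I) (hyI : θ (1 ⊗ₜ y) ∈ I) : θ = θ' := by
  obtain ⟨e, he0, he1⟩ := exists_coordinates hS hm
  let _ : Algebra K T := (θ.comp (algebraMap K (A ⊗[K] O))).toAlgebra
  have hK : ∀ c : K, θ (1 ⊗ₜ algebraMap K O c) = algebraMap K T c := fun c =>
    congrArg θ (Algebra.TensorProduct.algebraMap_apply' (A := A) (B := O) c).symm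
  have hK' : ∀ c : K, θ' (1 ⊗ₜ algebraMap K O c) = algebraMap K T c := by
    intro c
    rw [← hK, Algebra.algebraMap_eq_smul_one, TensorProduct.tmul_smul, TensorProduct.smul_tmul', hA]
  let φ : O →ₐ[K] T :=
    { θ.comp (Algebra.TensorProduct.includeRight : O →ₐ[K] A ⊗[K] O).toRingHom with
      commutes' := hK }
  let φ' : O →ₐ[K] T :=
    { θ'.comp (Algebra.TensorProduct.includeRight : O →ₐ[K] A ⊗[K] O).toRingHom with
      commutes' := hK' }
  have h1 : ∀ o, φ o = θ (1 ⊗ₜ o) := fun _ => rfl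
  have h2 : ∀ o, φ' o = θ' (1 ⊗ₜ o) := fun _ => rfl
  have hφ : φ.comp (e : MvPowerSeries (Fin 2) K →ₐ[K] O) =
      φ'.comp (e : MvPowerSeries (Fin 2) K →ₐ[K] O) := by
    refine mvPowerSeries_hom_ext I (fun i => ?_) (fun i => ?_)
    · fin_cases i
      · simpa [he0, h1, h2] using hx
      · simpa [he1, h1, h2] using hy
    · fin_cases i
      · simpa [he0, h1] using hxI
      · simpa [he1, h1] using hyI
  refine RingHom.ext fun z => ?_
  induction z with
  | zero => simp
  | add z z' hz hz' => rw [map_add, map_add, hz, hz']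
  | tmul a o =>
    have h3 : θ (1 ⊗ₜ o) = θ' (1 ⊗ₜ o) := by
      have := DFunLike.congr_fun hφ (e.symm o)
      simpa [h1, h2] using this
    rw [show a ⊗ₜ[K] o = a ⊗ₜ 1 * 1 ⊗ₜ o by simp, map_mul, map_mul, hA, h3]

include hS hm in
/-- Deformations of a formal smooth surface are trivial: lifts of coordinates are coordinates. -/
theorem exists_trivialization {𝒮 : Type u} [CommRing 𝒮] [Algebra A 𝒮] {red : 𝒮 →+* O}
    (h : IsFlatDeformation A red) {sx sy : 𝒮} (hx : red sx = x) (hy : red sy = y) :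
    ∃ E : A ⊗[K] O ≃ₐ[A] 𝒮, E (1 ⊗ₜ x) = sx ∧ E (1 ⊗ₜ y) = sy ∧
      ∀ z, red (E z) = trivialRed A O z := by
  obtain ⟨e, he0, he1⟩ := exists_coordinates hS hm
  have := hS.isNoetherianRing
  have := hS.isAdicComplete
  have hcomp := h.isAdicComplete
  let _ : Algebra K 𝒮 := Algebra.compHom 𝒮 (algebraMap K A)
  have : IsScalarTower K A 𝒮 := IsScalarTower.of_algebraMap_eq fun _ => rfl
  have hxm : x ∈ maximalIdeal O := hm ▸ Ideal.subset_span (by simp)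
  have hym : y ∈ maximalIdeal O := hm ▸ Ideal.subset_span (by simp)
  obtain ⟨φ, hφ⟩ := exists_mvPowerSeries_hom (K := K) ((maximalIdeal O).comap red) ![sx, sy] (by
    intro i
    fin_cases i
    · simpa [hx] using hxm
    · simpa [hy] using hym)
  have hredK : ∀ c : K, red (algebraMap K 𝒮 c) = algebraMap K O c := fun c =>
    (h.red_algebraMap _).trans (by simp)
  let redK : 𝒮 →ₐ[K] O := { red with commutes' := hredK }
  have hredK' : ∀ s, redK s = red s := fun _ => rfl
  have hred : ∀ o, red (φ (e.symm o)) = o := by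
    have h1 : (redK.comp φ) = (e : MvPowerSeries (Fin 2) K →ₐ[K] O) := by
      refine mvPowerSeries_hom_ext (maximalIdeal O) (fun i => ?_) (fun i => ?_)
      · fin_cases i
        · simpa [hφ, he0, hredK'] using hx
        · simpa [hφ, he1, hredK'] using hy
      · fin_cases i
        · simpa [hφ, hredK', hx] using hxm
        · simpa [hφ, hredK', hy] using hym
    intro o
    have := DFunLike.congr_fun h1 (e.symm o)
    simpa [hredK'] using this
  let E₀ : A ⊗[K] O →ₐ[A] 𝒮 := Algebra.TensorProduct.lift (Algebra.ofId A 𝒮)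
    (φ.comp (e.symm : O →ₐ[K] MvPowerSeries (Fin 2) K)) (fun _ _ => Commute.all _ _)
  have hE₀ : ∀ z, red (E₀ z) = trivialRed A O z := by
    intro z
    refine RingHom.congr_fun (f := red.comp (E₀ : A ⊗[K] O →+* 𝒮))
      (g := (trivialRed A O : A ⊗[K] O →+* O)) (tensor_ringHom_ext fun a o => ?_) z
    simp only [RingHom.comp_apply, RingHom.coe_coe, E₀, Algebra.TensorProduct.lift_tmul, map_mul,
      trivialRed_tmul, Algebra.ofId_apply, h.red_algebraMap]
    congr 1
    exact hred o
  have hbij : Function.Bijective E₀ := by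
    have := h.flat
    refine bijective_of_bijective_mod_nilpotent A.isNilpotent_maximalIdeal E₀.toLinearMap
      (fun s => ⟨1 ⊗ₜ red s, ?_⟩) (fun z hz => ?_)
    · rw [h.mem_smul_top_iff, map_sub, AlgHom.toLinearMap_apply, hE₀]
      simp [trivialRed_tmul]
    · rw [h.mem_smul_top_iff, AlgHom.toLinearMap_apply, hE₀] at hz
      exact (isFlatDeformation_trivialRed.mem_smul_top_iff z).mpr hz
  refine ⟨AlgEquiv.ofBijective E₀ hbij, ?_, ?_, hE₀⟩
  · have : e.symm x = MvPowerSeries.X 0 := by rw [← he0]; simp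
    simp [E₀, this, hφ]
  · have : e.symm y = MvPowerSeries.X 1 := by rw [← he1]; simp
    simp [E₀, this, hφ]

end FlatDeformation

/-! ### Deformations given by an equation -/

section GivenBy

variable {K O : Type u} [Field K] [CommRing O] [Algebra K O] [IsLocalRing O] {ID IC : Ideal O}
  {A : ArtAlg K}

/-- The morphism `𝒞 → 𝒮` is a closed immersion, by Nakayama's lemma, so that its image is flat. -/
theorem LogDef.flat_quotient_ker (δ : LogDef ID IC A) :
    Module.Flat A (δ.S ⧸ RingHom.ker δ.ι) := by
  have := δ.isFlatDeformationC.flat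
  exact Module.Flat.of_linearEquiv
    (Ideal.quotientKerAlgEquivOfSurjective δ.ι_surjective).toLinearEquiv

theorem LogDef.map_ker_ι (δ : LogDef ID IC A) : (RingHom.ker δ.ι).map δ.redS = IC := by
  apply le_antisymm
  · rw [Ideal.map_le_iff_le_comap]
    intro s hs
    rw [Ideal.mem_comap, ← Ideal.Quotient.eq_zero_iff_mem, ← δ.ι_zero, RingHom.mem_ker.mp hs,
      map_zero]
  · intro o ho
    obtain ⟨s, rfl⟩ := δ.isFlatDeformationS.surjective o
    have h1 : δ.ι s ∈ RingHom.ker δ.redC := by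
      rw [RingHom.mem_ker, δ.ι_zero, Ideal.Quotient.eq_zero_iff_mem]
      exact ho
    have h2 : algebraMap A δ.C = (δ.ι : δ.S →+* δ.C).comp (algebraMap A δ.S) := by
      ext a
      simp
    rw [δ.isFlatDeformationC.ker_eq, h2, ← Ideal.map_map, ← δ.isFlatDeformationS.ker_eq,
      Ideal.mem_map_iff_of_surjective (δ.ι : δ.S →+* δ.C) δ.ι_surjective] at h1
    obtain ⟨t, ht, hts⟩ := h1
    have h3 : s - t ∈ RingHom.ker δ.ι := by
      rw [RingHom.mem_ker, map_sub, sub_eq_zero]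
      exact hts.symm
    have := Ideal.mem_map_of_mem δ.redS h3
    rwa [map_sub, RingHom.mem_ker.mp ht, sub_zero] at this

theorem map_span_algEquiv {R S T : Type*} [CommRing R] [CommRing S] [CommRing T]
    [Algebra R S] [Algebra R T] (E : S ≃ₐ[R] T) (s : Set S) :
    (Ideal.span s).map E = Ideal.span (E '' s) :=
  Ideal.map_span _ _

/-- Lifts of `x`, `y` and `F` to elements of the ideals of `𝒫`, `𝒟` and `𝒞` trivialize the
deformation of the pair and give an equation of `𝒞`. -/
theorem LogDef.exists_isGivenBy_of_lifts (hS : IsFormalSmoothSurface K O) {x y F : O}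
    (hm : maximalIdeal O = Ideal.span {x, y}) (hID : ID = Ideal.span {y})
    (hIC : IC = Ideal.span {F}) (δ : LogDef ID IC A) {sx sy sG : δ.S} (hxP : sx ∈ δ.P)
    (hyD : sy ∈ δ.D) (hG : δ.ι sG = 0) (hx : δ.redS sx = x) (hy : δ.redS sy = y)
    (hF : δ.redS sG = F) :
    ∃ E : A ⊗[K] O ≃ₐ[A] δ.S, E (1 ⊗ₜ x) = sx ∧ E (1 ⊗ₜ y) = sy ∧
      (∀ z, δ.redS (E z) = trivialRed A O z) ∧ δ.IsGivenBy (E.symm sG) := by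
  obtain ⟨E, hEx, hEy, hE⟩ := exists_trivialization hS hm δ.isFlatDeformationS hx hy
  have hEx' : E.symm sx = 1 ⊗ₜ x := by rw [← hEx, AlgEquiv.symm_apply_apply]
  have hEy' : E.symm sy = 1 ⊗ₜ y := by rw [← hEy, AlgEquiv.symm_apply_apply]
  have hD : δ.D = Ideal.span {sy} := by
    have := δ.flat_D
    refine δ.isFlatDeformationS.eq_span _ _ (by simpa using hyD) ?_
    rw [Set.image_singleton, hy]
    exact δ.D_zero.trans hID
  have hP : δ.P = Ideal.span {sx, sy} := by
    have : Module.Flat A (δ.S ⧸ δ.P) := Module.Flat.of_linearEquiv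
      (AlgEquiv.ofBijective (Algebra.ofId A (δ.S ⧸ δ.P)) δ.section_P).symm.toLinearEquiv
    refine δ.isFlatDeformationS.eq_span _ _ ?_ ?_
    · rintro s (rfl | rfl)
      · exact hxP
      · exact δ.D_le_P hyD
    · rw [δ.P_zero, hm, Set.image_pair, hx, hy]
  have hJ : RingHom.ker δ.ι = Ideal.span {sG} := by
    have := δ.flat_quotient_ker
    refine δ.isFlatDeformationS.eq_span _ _ (by simpa using hG) ?_
    rw [Set.image_singleton, hF]
    exact δ.map_ker_ι.trans hIC
  refine ⟨E, hEx, hEy, hE, E.symm, fun s => ?_, ?_, ?_, δ.ι_surjective, ?_⟩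
  · rw [← hE, AlgEquiv.apply_symm_apply]
  · refine Eq.trans ?_ (congrArg _ hID.symm)
    rw [hD, map_span_algEquiv, Ideal.map_span, Set.image_singleton,
      Set.image_singleton, hEy']
    rfl
  · rw [hP, hm, map_span_algEquiv, Ideal.map_span, Set.image_pair, Set.image_pair, hEx',
      hEy']
    rfl
  · rw [hJ, map_span_algEquiv, Set.image_singleton]

/-- Two equations related by an automorphism of the trivial deformation of the pair define
isomorphic deformations. -/
theorem LogDef.IsGivenBy.congr {δ : LogDef ID IC A} {G G' : A ⊗[K] O} (h : δ.IsGivenBy G)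
    (γ : A ⊗[K] O ≃ₐ[A] A ⊗[K] O) (hγ : ∀ z, trivialRed A O (γ z) = trivialRed A O z)
    (hD : (ID.map (Algebra.TensorProduct.includeRight : O →ₐ[K] A ⊗[K] O)).map γ =
      ID.map (Algebra.TensorProduct.includeRight : O →ₐ[K] A ⊗[K] O))
    (hP : ((maximalIdeal O).map (Algebra.TensorProduct.includeRight : O →ₐ[K] A ⊗[K] O)).map γ =
      (maximalIdeal O).map (Algebra.TensorProduct.includeRight : O →ₐ[K] A ⊗[K] O))
    (hG : Ideal.span {γ G} = Ideal.span {G'}) : δ.IsGivenBy G' := by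
  obtain ⟨E, h1, h2, h3, h4, h5⟩ := h
  have hmap : ∀ I : Ideal δ.S, I.map (E.trans γ) = (I.map E).map γ := fun I =>
    (Ideal.map_map (I := I) (E : δ.S →+* A ⊗[K] O) (γ : A ⊗[K] O →+* A ⊗[K] O)).symm
  refine ⟨E.trans γ, fun s => ?_, ?_, ?_, h4, ?_⟩
  · rw [← h1, AlgEquiv.trans_apply, hγ]
  · rw [hmap, h2, hD]
  · rw [hmap, h3, hP]
  · rw [hmap, h5, map_span_algEquiv, Set.image_singleton, hG]

theorem LogDef.IsGivenBy.span_congr {δ : LogDef ID IC A} {G G' : A ⊗[K] O} (h : δ.IsGivenBy G)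
    (hG : Ideal.span {G} = Ideal.span {G'}) : δ.IsGivenBy G' := by
  obtain ⟨E, h1, h2, h3, h4, h5⟩ := h
  exact ⟨E, h1, h2, h3, h4, by rw [h5, hG]⟩

theorem LogDef.IsGivenBy.of_iso {δ δ' : LogDef ID IC A} {G : A ⊗[K] O} (h : δ.IsGivenBy G)
    (hδ : δ.Iso δ') : δ'.IsGivenBy G := by
  obtain ⟨E, h1, h2, h3, h4, h5⟩ := h
  obtain ⟨β, α, k1, -, k3, k4, k5⟩ := hδ.symm
  have hmap : ∀ I : Ideal δ'.S, I.map (β.trans E) = (I.map β).map E := fun I =>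
    (Ideal.map_map (I := I) (β : δ'.S →+* δ.S) (E : δ.S →+* A ⊗[K] O)).symm
  have hker : (RingHom.ker δ'.ι).map β = RingHom.ker δ.ι := by
    ext s
    rw [Ideal.mem_map_iff_of_surjective β β.surjective]
    constructor
    · rintro ⟨t, ht, rfl⟩
      rw [RingHom.mem_ker] at ht ⊢
      rw [k3, ht, map_zero]
    · intro hs
      refine ⟨β.symm s, ?_, β.apply_symm_apply s⟩
      rw [RingHom.mem_ker] at hs ⊢
      apply α.injective
      rw [← k3, AlgEquiv.apply_symm_apply, hs, map_zero]
  refine ⟨β.trans E, fun s => ?_, ?_, ?_, δ'.ι_surjective, ?_⟩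
  · rw [AlgEquiv.trans_apply, h1, k1]
  · rw [hmap, k4, h2]
  · rw [hmap, k5, h3]
  · rw [hmap, hker, h5]

/-- An equation determines the deformation up to isomorphism: since `𝒞 → 𝒮` is a closed immersion,
the isomorphism of the ambient pairs induces the isomorphism of the curves. -/
theorem LogDef.iso_of_isGivenBy {δ δ' : LogDef ID IC A} {G : A ⊗[K] O} (h : δ.IsGivenBy G)
    (h' : δ'.IsGivenBy G) : δ.Iso δ' := by
  obtain ⟨E, h1, h2, h3, h4, h5⟩ := h
  obtain ⟨E', h1', h2', h3', h4', h5'⟩ := h'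
  have hmap : ∀ I : Ideal δ.S, ∀ I' : Ideal δ'.S, I.map E = I'.map E' →
      I.map (E.trans E'.symm) = I' := by
    intro I I' hI
    have e1 : I.map (E.trans E'.symm) = (I.map E).map E'.symm :=
      (Ideal.map_map (I := I) (E : δ.S →+* A ⊗[K] O) (E'.symm : A ⊗[K] O →+* δ'.S)).symm
    rw [e1, hI]
    exact Ideal.map_of_equiv (I := I') E'.toRingEquiv
  have hJ := hmap _ _ (h5.trans h5'.symm)
  let α : δ.C ≃ₐ[A] δ'.C := (Ideal.quotientKerAlgEquivOfSurjective h4).symm.trans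
    ((Ideal.quotientEquivAlg (RingHom.ker δ.ι) (RingHom.ker δ'.ι) (E.trans E'.symm) hJ.symm).trans
      (Ideal.quotientKerAlgEquivOfSurjective h4'))
  have hα : ∀ s, α (δ.ι s) = δ'.ι (E'.symm (E s)) := by
    intro s
    have : (Ideal.quotientKerAlgEquivOfSurjective h4).symm (δ.ι s) = Ideal.Quotient.mk _ s := by
      rw [AlgEquiv.symm_apply_eq]
      rfl
    simp only [α, AlgEquiv.trans_apply, this]
    rfl
  have hred : ∀ s, δ'.redS (E'.symm (E s)) = δ.redS s := by
    intro s
    rw [← h1', AlgEquiv.apply_symm_apply, h1]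
  refine ⟨E.trans E'.symm, α, hred, fun c => ?_, fun s => (hα s).symm, hmap _ _ (h2.trans h2'.symm),
    hmap _ _ (h3.trans h3'.symm)⟩
  obtain ⟨s, rfl⟩ := h4 c
  rw [hα, δ'.ι_zero, hred, δ.ι_zero]

theorem LogDef.IsGivenBy.baseChange {B : ArtAlg K} [Algebra A B] [IsScalarTower K A B]
    {δ : LogDef ID IC A} {G : A ⊗[K] O} (h : δ.IsGivenBy G) :
    (δ.baseChange B).IsGivenBy (tensorMap O (IsScalarTower.toAlgHom K A B) G) := by
  obtain ⟨E, h1, h2, h3, h4, h5⟩ := h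
  let τ := tensorMap O (IsScalarTower.toAlgHom K A B)
  let EB : B ⊗[A] δ.S ≃ₐ[B] B ⊗[K] O :=
    (Algebra.TensorProduct.congr (AlgEquiv.refl : B ≃ₐ[B] B) E).trans
      (Algebra.TensorProduct.cancelBaseChange K A B B O)
  have hcancel : ∀ (b : B) (z : A ⊗[K] O),
      Algebra.TensorProduct.cancelBaseChange K A B B O (b ⊗ₜ z) = (b ⊗ₜ 1) * τ z := by
    intro b z
    induction z with
    | zero => simp
    | add z z' hz hz' => rw [TensorProduct.tmul_add, map_add, hz, hz', map_add, mul_add]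
    | tmul a o =>
      rw [Algebra.TensorProduct.cancelBaseChange_tmul]
      simp [τ, Algebra.smul_def, mul_comm]
  have hEB : ∀ (b : B) (s : δ.S), EB (b ⊗ₜ s) = (b ⊗ₜ 1) * τ (E s) := fun b s => hcancel b (E s)
  have hmap : ∀ (I : Ideal δ.S),
      (I.map (Algebra.TensorProduct.includeRight : δ.S →ₐ[A] B ⊗[A] δ.S)).map EB =
        (I.map E).map τ := by
    intro I
    have e : (EB : B ⊗[A] δ.S →+* B ⊗[K] O).comp
        (Algebra.TensorProduct.includeRight : δ.S →ₐ[A] B ⊗[A] δ.S).toRingHom =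
        (τ : A ⊗[K] O →+* B ⊗[K] O).comp (E : δ.S →+* A ⊗[K] O) := by
      ext s
      simpa [← Algebra.TensorProduct.one_def] using hEB 1 s
    have := congrArg (fun g => I.map g) e
    simp only [← Ideal.map_map] at this
    exact this
  have hmap' : ∀ (I : Ideal O),
      (I.map (Algebra.TensorProduct.includeRight : O →ₐ[K] A ⊗[K] O)).map τ =
        I.map (Algebra.TensorProduct.includeRight : O →ₐ[K] B ⊗[K] O) := by
    intro I
    have e : (τ : A ⊗[K] O →+* B ⊗[K] O).comp
        (Algebra.TensorProduct.includeRight : O →ₐ[K] A ⊗[K] O).toRingHom =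
        (Algebra.TensorProduct.includeRight : O →ₐ[K] B ⊗[K] O).toRingHom := by
      ext o
      simp [τ]
    have := congrArg (fun g => I.map g) e
    simp only [← Ideal.map_map] at this
    exact this
  refine ⟨EB, fun z => ?_, ?_, ?_, (δ.baseChange B).ι_surjective, ?_⟩
  · refine RingHom.congr_fun
      (f := (trivialRed B O : B ⊗[K] O →+* O).comp (EB : B ⊗[A] δ.S →+* B ⊗[K] O))
      (g := redBaseChange B δ.redS δ.isFlatDeformationS) (tensor_ringHom_ext fun b s => ?_) z
    rw [redBaseChange_tmul, ← h1, ← trivialRed_tensorMap (IsScalarTower.toAlgHom K A B)]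
    refine (congrArg (trivialRed B O) (hEB b s)).trans ?_
    rw [map_mul, trivialRed_tmul, mul_one]
  · exact (hmap _).trans (by rw [h2, hmap'])
  · exact (hmap _).trans (by rw [h3, hmap'])
  · have hk : RingHom.ker (δ.baseChange B).ι =
        (RingHom.ker δ.ι).map (Algebra.TensorProduct.includeRight : δ.S →ₐ[A] B ⊗[A] δ.S) :=
      Algebra.TensorProduct.lTensor_ker (A := B) δ.ι δ.ι_surjective
    rw [hk]
    refine (hmap _).trans ?_
    rw [h5, Ideal.map_span, Set.image_singleton]

theorem LogDef.IsGivenBy.map {B : ArtAlg K} (φ : A ⟶ B) {δ : LogDef ID IC A} {G : A ⊗[K] O}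
    (h : δ.IsGivenBy G) : (δ.map φ).IsGivenBy (tensorMap O (ArtAlg.Hom.hom φ) G) := by
  let _ : Algebra A B := (ArtAlg.Hom.hom φ).toRingHom.toAlgebra
  have : IsScalarTower K A B := IsScalarTower.of_algHom (ArtAlg.Hom.hom φ)
  exact h.baseChange

end GivenBy

/-! ### Existence of deformations with a given equation -/

section Existence

variable {K O : Type u} [Field K] [CommRing O] [Algebra K O]

/-- The hypersurface defined by a lift `G` of a nonzerodivisor is flat: `A ⊗ O` is the direct sum of
`G (A ⊗ O)` and of `A ⊗ W` for any complement `W` of `F O` in `O`. -/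
theorem flat_quotient_span_singleton [IsDomain O] {A : ArtAlg K} {F : O} (hF : F ≠ 0)
    {G : A ⊗[K] O} (hG : trivialRed A O G = F) :
    Module.Flat A ((A ⊗[K] O) ⧸ Ideal.span {G}) := by
  have htriv := isFlatDeformation_trivialRed (A := A) (O := O)
  obtain ⟨W, hW⟩ := Submodule.exists_isCompl ((Ideal.span {F}).restrictScalars K)
  obtain ⟨r, hr⟩ := W.subtype.exists_leftInverse_of_injective (by simp)
  let incl : A ⊗[K] W →ₗ[A] A ⊗[K] O := W.subtype.baseChange A
  let retr : A ⊗[K] O →ₗ[A] A ⊗[K] W := r.baseChange A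
  have hretr : ∀ w, retr (incl w) = w := by
    intro w
    change (r.baseChange A ∘ₗ W.subtype.baseChange A) w = w
    rw [← LinearMap.baseChange_comp, hr, LinearMap.baseChange_id]
    rfl
  have hinclW : ∀ w, trivialRed A O (incl w) ∈ W := by
    intro w
    induction w with
    | zero => simp
    | add w w' hw hw' => rw [map_add, map_add]; exact add_mem hw hw'
    | tmul a w =>
      simp only [incl, LinearMap.baseChange_tmul, trivialRed_tmul, ← Algebra.smul_def]
      exact W.smul_mem _ w.2
  let Φ : (A ⊗[K] O) × (A ⊗[K] W) →ₗ[A] A ⊗[K] O :=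
    (LinearMap.mulLeft A G).coprod incl
  have hΦ : ∀ z w, Φ (z, w) = G * z + incl w := fun z w => by simp [Φ]
  have hbij : Function.Bijective Φ := by
    refine bijective_of_bijective_mod_nilpotent A.isNilpotent_maximalIdeal Φ (fun z => ?_) ?_
    · have hz : trivialRed A O z ∈ (Ideal.span {F}).restrictScalars K ⊔ W := by
        rw [hW.sup_eq_top]; trivial
      obtain ⟨p, hp, q, hq, hpq⟩ := Submodule.mem_sup.mp hz
      obtain ⟨c, rfl⟩ := Ideal.mem_span_singleton'.mp hp
      refine ⟨(1 ⊗ₜ c, 1 ⊗ₜ ⟨q, hq⟩), (htriv.mem_smul_top_iff _).mpr ?_⟩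
      simp [hΦ, incl, trivialRed_tmul, hG, ← hpq, mul_comm]
    · rintro ⟨z, w⟩ hzw
      rw [htriv.mem_smul_top_iff, hΦ] at hzw
      change trivialRed A O (G * z + incl w) = 0 at hzw
      rw [map_add, map_mul, hG] at hzw
      have hw0 : trivialRed A O (incl w) = 0 := by
        refine (Submodule.disjoint_def.mp hW.disjoint) _ ?_ (hinclW w)
        rw [Submodule.restrictScalars_mem, Ideal.mem_span_singleton]
        exact ⟨-trivialRed A O z, by linear_combination hzw⟩
      rw [hw0, add_zero] at hzw
      have hz0 := (mul_eq_zero.mp hzw).resolve_left hF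
      have h1 : z ∈ (maximalIdeal A • ⊤ : Submodule A (A ⊗[K] O)) :=
        (htriv.mem_smul_top_iff _).mpr hz0
      have h2 : w ∈ (maximalIdeal A • ⊤ : Submodule A (A ⊗[K] W)) := by
        have h3 := Submodule.mem_map_of_mem (f := retr)
          ((htriv.mem_smul_top_iff (incl w)).mpr hw0)
        rw [hretr, Submodule.map_smul''] at h3
        exact Submodule.smul_mono le_rfl le_top h3
      have h4 := Submodule.mem_map_of_mem (f := LinearMap.inl A (A ⊗[K] O) (A ⊗[K] W)) h1
      have h5 := Submodule.mem_map_of_mem (f := LinearMap.inr A (A ⊗[K] O) (A ⊗[K] W)) h2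
      rw [Submodule.map_smul''] at h4 h5
      have := add_mem (Submodule.smul_mono le_rfl le_top h4)
        (Submodule.smul_mono le_rfl le_top h5)
      simpa using this
  let q : A ⊗[K] W →ₗ[A] (A ⊗[K] O) ⧸ Ideal.span {G} :=
    (Ideal.Quotient.mkₐ A (Ideal.span {G})).toLinearMap ∘ₗ incl
  have hq : Function.Bijective q := by
    constructor
    · rw [injective_iff_map_eq_zero]
      intro w hw
      have hw' : incl w ∈ Ideal.span {G} := Ideal.Quotient.eq_zero_iff_mem.mp hw
      obtain ⟨z, hz⟩ := Ideal.mem_span_singleton.mp hw'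
      have : Φ (-z, w) = Φ (0, 0) := by
        rw [hΦ, hΦ, hz]
        simp
      exact (Prod.mk.inj (hbij.1 this)).2
    · intro c
      obtain ⟨c, rfl⟩ := Ideal.Quotient.mk_surjective c
      obtain ⟨⟨z, w⟩, hzw⟩ := hbij.2 c
      refine ⟨w, ?_⟩
      change Ideal.Quotient.mk _ (incl w) = _
      rw [Ideal.Quotient.eq, ← hzw, hΦ, Ideal.mem_span_singleton]
      exact ⟨-z, by ring⟩
  exact Module.Flat.of_linearEquiv (LinearEquiv.ofBijective q hq).symm

variable [IsLocalRing O]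

theorem IsFormalSmoothSurface.residue_bijective (hS : IsFormalSmoothSurface K O) :
    Function.Bijective (algebraMap K (ResidueField O)) := by
  obtain ⟨e⟩ := hS
  refine residue_bijective_of_algHom (AlgHom.comp
    ({ (MvPowerSeries.constantCoeff : MvPowerSeries (Fin 2) K →+* K) with
        commutes' := fun c => ?_ } : MvPowerSeries (Fin 2) K →ₐ[K] K)
    (e : O →ₐ[K] MvPowerSeries (Fin 2) K))
  exact MvPowerSeries.constantCoeff_C c

/-- Every lift of `F` is an equation of a deformation, with trivial ambient pair. -/
theorem exists_isGivenBy (hS : IsFormalSmoothSurface K O) {ID IC : Ideal O}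
    (hID : ID ≤ maximalIdeal O) {F : O} (hIC : IC = Ideal.span {F}) (hF : F ≠ 0) {A : ArtAlg K}
    {G : A ⊗[K] O} (hG : trivialRed A O G = F) : ∃ δ : LogDef ID IC A, δ.IsGivenBy G := by
  subst hIC
  have := hS.isDomain
  have hflat := flat_quotient_span_singleton hF hG
  have htriv := isFlatDeformation_trivialRed (A := A) (O := O)
  have hmapred : ∀ I : Ideal O,
      (I.map (Algebra.TensorProduct.includeRight : O →ₐ[K] A ⊗[K] O)).map
        (trivialRed A O : A ⊗[K] O →+* O) = I := by
    intro I
    have e : (trivialRed A O : A ⊗[K] O →+* O).comp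
        (Algebra.TensorProduct.includeRight : O →ₐ[K] A ⊗[K] O).toRingHom = RingHom.id O := by
      ext o
      simp [trivialRed_tmul]
    have := congrArg (fun g => I.map g) e
    simp only [← Ideal.map_map, Ideal.map_id] at this
    exact this
  have hspan : (Ideal.span {G}).map (trivialRed A O : A ⊗[K] O →+* O) = Ideal.span {F} := by
    rw [Ideal.map_span, Set.image_singleton]
    exact congrArg _ (congrArg _ hG)
  let redC : (A ⊗[K] O) ⧸ Ideal.span {G} →+* O ⧸ Ideal.span {F} :=
    Ideal.quotientMap (Ideal.span {F}) (trivialRed A O : A ⊗[K] O →+* O)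
      (by rw [← Ideal.map_le_iff_le_comap, hspan])
  have hredC : ∀ z, redC (Ideal.Quotient.mk _ z) = Ideal.Quotient.mk _ (trivialRed A O z) :=
    fun z => rfl
  refine ⟨{
    S := A ⊗[K] O
    redS := (trivialRed A O : A ⊗[K] O →+* O)
    isFlatDeformationS := htriv
    D := ID.map (Algebra.TensorProduct.includeRight : O →ₐ[K] A ⊗[K] O)
    flat_D := Module.Flat.of_linearEquiv
      (Algebra.TensorProduct.tensorQuotientEquiv (R := K) A O A ID).symm.toLinearEquiv
    D_zero := hmapred ID
    P := (maximalIdeal O).map (Algebra.TensorProduct.includeRight : O →ₐ[K] A ⊗[K] O)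
    D_le_P := Ideal.map_mono hID
    section_P := ?_
    P_zero := hmapred _
    C := (A ⊗[K] O) ⧸ Ideal.span {G}
    redC := redC
    isFlatDeformationC := ⟨hflat, fun a => ?_, ?_, ?_⟩
    ι := Ideal.Quotient.mkₐ A (Ideal.span {G})
    ι_zero := hredC }, ?_⟩
  · let e : K ≃ₐ[K] O ⧸ maximalIdeal O :=
      AlgEquiv.ofBijective (Algebra.ofId K _) hS.residue_bijective
    let e' : A ≃ₐ[A] (A ⊗[K] O) ⧸
        (maximalIdeal O).map (Algebra.TensorProduct.includeRight : O →ₐ[K] A ⊗[K] O) :=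
      (Algebra.TensorProduct.rid K A A).symm.trans
        ((Algebra.TensorProduct.congr AlgEquiv.refl e).trans
          (Algebra.TensorProduct.tensorQuotientEquiv (R := K) A O A (maximalIdeal O)))
    have : ⇑e' = algebraMap A _ := by
      ext a
      simpa using e'.commutes a
    rw [← this]
    exact e'.bijective
  · refine (hredC _).trans ?_
    exact congrArg _ (htriv.red_algebraMap a)
  · intro c
    obtain ⟨o, rfl⟩ := Ideal.Quotient.mk_surjective c
    obtain ⟨z, rfl⟩ := htriv.surjective o
    exact ⟨Ideal.Quotient.mk _ z, hredC z⟩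
  · apply le_antisymm
    · intro c hc
      obtain ⟨z, rfl⟩ := Ideal.Quotient.mk_surjective c
      rw [RingHom.mem_ker, hredC, Ideal.Quotient.eq_zero_iff_mem, ← hspan,
        Ideal.mem_map_iff_of_surjective _ htriv.surjective] at hc
      obtain ⟨t, ht, htz⟩ := hc
      have h1 : z - t ∈ RingHom.ker (trivialRed A O : A ⊗[K] O →+* O) := by
        rw [RingHom.mem_ker, map_sub, htz]
        exact sub_self _
      rw [htriv.ker_eq] at h1
      have h2 := Ideal.mem_map_of_mem (Ideal.Quotient.mk (Ideal.span {G})) h1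
      rw [Ideal.map_map, map_sub, Ideal.Quotient.eq_zero_iff_mem.mpr ht, sub_zero] at h2
      exact h2
    · rw [Ideal.map_le_iff_le_comap]
      intro a ha
      rw [Ideal.mem_comap, RingHom.mem_ker]
      refine (hredC _).trans ?_
      rw [show trivialRed A O (algebraMap A (A ⊗[K] O) a) = algebraMap K O (A.res a) from
        htriv.red_algebraMap a, (A.mem_maximalIdeal_iff a).mp ha, map_zero, map_zero]
  · refine ⟨AlgEquiv.refl, fun s => rfl, Ideal.map_id _, Ideal.map_id _,
      Ideal.Quotient.mk_surjective, ?_⟩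
    exact (Ideal.map_id _).trans Ideal.mk_ker

end Existence

/-! ### Constant intersection multiplicity and the normal form of the equation -/

theorem sup_pow_le_pow_sup {R : Type*} [CommRing R] (I J : Ideal R) (n : ℕ) :
    (I ⊔ J) ^ n ≤ I ^ n ⊔ J := by
  induction n with
  | zero => simp
  | succ n ih =>
    calc (I ⊔ J) ^ (n + 1) = (I ⊔ J) ^ n * (I ⊔ J) := pow_succ _ _
      _ ≤ (I ^ n ⊔ J) * (I ⊔ J) := Ideal.mul_mono ih le_rfl
      _ = I ^ n * I ⊔ I ^ n * J ⊔ J * (I ⊔ J) := by rw [Ideal.sup_mul, Ideal.mul_sup]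
      _ ≤ I ^ (n + 1) ⊔ J := by
        rw [← pow_succ]
        exact sup_le (sup_le le_sup_left (le_sup_of_le_right Ideal.mul_le_right))
          (le_sup_of_le_right Ideal.mul_le_left)

section TensorDivisibility

variable {K O : Type u} [Field K] [CommRing O] [Algebra K O] {A : ArtAlg K}

theorem tensor_mul_left_injective [IsDomain O] {y : O} (hy : y ≠ 0) {u : A ⊗[K] O}
    (h : (1 ⊗ₜ y) * u = 0) : u = 0 := by
  have hinj := Module.Flat.lTensor_preserves_injective_linearMap (M := A) (LinearMap.mulLeft K y)
    (mul_right_injective₀ hy)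
  have he : ∀ u : A ⊗[K] O, (LinearMap.mulLeft K y).lTensor A u = (1 ⊗ₜ y) * u := by
    intro u
    induction u with
    | zero => simp
    | add u u' hu hu' => rw [map_add, hu, hu', mul_add]
    | tmul a o => simp
  exact (injective_iff_map_eq_zero _).mp hinj u (by rw [he, h])

/-- If `p` is a nonzerodivisor modulo `y` in `O`, then so it is in `A ⊗ O`. -/
theorem tensor_dvd_of_dvd_mul {y p : O} (hp : ∀ c, y ∣ p * c → y ∣ c) {u : A ⊗[K] O}
    (h : (1 ⊗ₜ y : A ⊗[K] O) ∣ (1 ⊗ₜ p) * u) : (1 ⊗ₜ y : A ⊗[K] O) ∣ u := by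
  let N : Submodule K O := (Ideal.span {y}).restrictScalars K
  have hN : ∀ c, c ∈ N ↔ y ∣ c := fun c => Ideal.mem_span_singleton
  have hle : N ≤ N.comap (LinearMap.mulLeft K p) := fun c hc => by
    rw [hN] at hc
    exact (hN _).mpr (hc.mul_left p)
  let μ : O ⧸ N →ₗ[K] O ⧸ N := N.mapQ N (LinearMap.mulLeft K p) hle
  have hμ : Function.Injective μ := by
    rw [injective_iff_map_eq_zero]
    intro c hc
    obtain ⟨c, rfl⟩ := N.mkQ_surjective c
    rw [Submodule.mkQ_apply, Submodule.mapQ_apply, Submodule.Quotient.mk_eq_zero, hN] at hc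
    rw [Submodule.mkQ_apply, Submodule.Quotient.mk_eq_zero, hN]
    exact hp c hc
  have hμA := Module.Flat.lTensor_preserves_injective_linearMap (M := A) μ hμ
  have hcomm : ∀ u : A ⊗[K] O,
      N.mkQ.lTensor A ((1 ⊗ₜ p) * u) = μ.lTensor A (N.mkQ.lTensor A u) := by
    intro u
    induction u with
    | zero => simp
    | add u u' hu hu' => rw [mul_add, map_add, hu, hu', map_add, map_add]
    | tmul a o => simp [μ]
  have hexact : Function.Exact (N.subtype.lTensor A) (N.mkQ.lTensor A) :=
    lTensor_exact A (LinearMap.exact_subtype_mkQ N) N.mkQ_surjective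
  have hrange : ∀ v : A ⊗[K] N, (1 ⊗ₜ y : A ⊗[K] O) ∣ N.subtype.lTensor A v := by
    intro v
    induction v with
    | zero => simp
    | add v v' hv hv' => rw [map_add]; exact dvd_add hv hv'
    | tmul a o =>
      obtain ⟨c, hc⟩ := (hN _).mp o.2
      exact ⟨a ⊗ₜ c, by simp [hc]⟩
  have hzero : ∀ u : A ⊗[K] O, (1 ⊗ₜ y : A ⊗[K] O) ∣ u → N.mkQ.lTensor A u = 0 := by
    rintro _ ⟨c, rfl⟩
    induction c with
    | zero => simp
    | add u u' hu hu' => rw [mul_add, map_add, hu, hu', add_zero]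
    | tmul a o =>
      have : N.mkQ (y * o) = 0 := by
        rw [Submodule.mkQ_apply, Submodule.Quotient.mk_eq_zero, hN]
        exact dvd_mul_right y o
      rw [Algebra.TensorProduct.tmul_mul_tmul, LinearMap.lTensor_tmul, this,
        TensorProduct.tmul_zero]
  have h1 : N.mkQ.lTensor A u = 0 :=
    (injective_iff_map_eq_zero _).mp hμA _ (by rw [← hcomm, hzero _ h])
  obtain ⟨v, rfl⟩ := (hexact u).mp h1
  exact hrange v

theorem map_includeRight_span (s : Set O) :
    (Ideal.span s).map (Algebra.TensorProduct.includeRight : O →ₐ[K] A ⊗[K] O) =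
      Ideal.span ((fun o => (1 ⊗ₜ o : A ⊗[K] O)) '' s) :=
  Ideal.map_span _ _

end TensorDivisibility

/-- A lift of an equation `y g + p`, `p` a nonzerodivisor modulo `y`, that lies in the ideal
`⟨p, y⟩` can be multiplied by a unit to take the form `y g' + p`, with `g'` a lift of `g`. -/
theorem exists_normal_form {R T : Type*} [CommRing R] [CommRing T] (π : R →+* T) [IsLocalHom π]
    (hπ : Function.Surjective π) {y p G : R} {g : T}
    (hy : ∀ c, π y * c = 0 → c = 0) (hp : ∀ c, π y ∣ π p * c → π y ∣ c)
    (hG : G ∈ Ideal.span {p} ⊔ Ideal.span {y}) (hg : π G = π y * g + π p) :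
    ∃ g', π g' = g ∧ Ideal.span {G} = Ideal.span {y * g' + p} := by
  obtain ⟨u, hu, v, hv, rfl⟩ := Submodule.mem_sup.mp hG
  obtain ⟨h, rfl⟩ := Ideal.mem_span_singleton.mp hu
  obtain ⟨a, rfl⟩ := Ideal.mem_span_singleton.mp hv
  rw [map_add, map_mul, map_mul] at hg
  -- Over `T`, the coefficient `h` of `p` becomes `1` modulo `y`: adding a multiple of `y` makes
  -- this an equality and the coefficient a unit, by whose inverse the equation is multiplied.
  obtain ⟨c, hc⟩ := hp (1 - π h) ⟨π a - g, by linear_combination -hg⟩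
  have ha : π a - π p * c - g = 0 := hy _ (by linear_combination hg + π p * hc)
  obtain ⟨c, rfl⟩ := hπ c
  have hunit : π (h + y * c) = 1 := by
    rw [map_add, map_mul]
    linear_combination -hc
  have hU : IsUnit (h + y * c) := isUnit_of_map_unit π _ (by rw [hunit]; exact isUnit_one)
  obtain ⟨k, hk⟩ := hU.exists_right_inv
  have hπk : π k = 1 := by
    have := congrArg π hk
    rwa [map_mul, hunit, one_mul, map_one] at this
  refine ⟨k * (a - p * c), ?_, ?_⟩
  · rw [map_mul, hπk, one_mul, map_sub, map_mul]
    linear_combination ha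
  · have hkU : IsUnit k := IsUnit.of_mul_eq_one _ (by rw [mul_comm]; exact hk)
    rw [← Ideal.span_singleton_mul_right_unit hkU]
    congr 2
    linear_combination p * hk

section Lifting

variable {K O : Type u} [Field K] [CommRing O] [Algebra K O] [IsLocalRing O] {ID IC : Ideal O}
  {x y F : O}

/-- `V(G)` contains `w𝒫` on `𝒟` if and only if `G` lies in `⟨x ^ w, y⟩`, the ideal of `w𝒫`. -/
theorem LogDef.IsGivenBy.containsMultiple_iff (hm : maximalIdeal O = Ideal.span {x, y})
    (hID : ID = Ideal.span {y}) {A : ArtAlg K} {δ : LogDef ID IC A} {G : A ⊗[K] O}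
    (h : δ.IsGivenBy G) (w : ℕ) :
    δ.ContainsMultiple w ↔ G ∈ Ideal.span {(1 ⊗ₜ (x ^ w) : A ⊗[K] O)} ⊔ Ideal.span {1 ⊗ₜ y} := by
  obtain ⟨E, h1, h2, h3, h4, h5⟩ := h
  have hmap : (δ.P ^ w ⊔ δ.D).map E =
      Ideal.span {(1 ⊗ₜ (x ^ w) : A ⊗[K] O)} ⊔ Ideal.span {1 ⊗ₜ y} := by
    have hD : δ.D.map E = Ideal.span {(1 ⊗ₜ y : A ⊗[K] O)} := by
      rw [h2, hID, map_includeRight_span, Set.image_singleton]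
    have hP : δ.P.map E = Ideal.span {(1 ⊗ₜ x : A ⊗[K] O)} ⊔ Ideal.span {1 ⊗ₜ y} := by
      rw [h3, hm, map_includeRight_span, Set.image_pair, Ideal.span_insert]
    rw [Ideal.map_sup, Ideal.map_pow, hD, hP]
    have hx : (1 ⊗ₜ (x ^ w) : A ⊗[K] O) = (1 ⊗ₜ x) ^ w := by
      rw [Algebra.TensorProduct.tmul_pow, one_pow]
    rw [hx, ← Ideal.span_singleton_pow]
    exact le_antisymm (sup_le (sup_pow_le_pow_sup _ _ _) le_sup_right)
      (sup_le_sup_right (Ideal.pow_right_mono le_sup_left w) _)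
  constructor
  · intro h
    have := Ideal.map_mono (f := E) (le_sup_left.trans h)
    rw [hmap, h5] at this
    exact this (Ideal.mem_span_singleton_self G)
  · intro hG
    refine sup_le (fun s hs => ?_) le_sup_right
    have h6 : E s ∈ (δ.P ^ w ⊔ δ.D).map E := by
      rw [hmap]
      have h7 : E s ∈ (RingHom.ker δ.ι).map E := Ideal.mem_map_of_mem E hs
      rw [h5] at h7
      exact (Ideal.span_singleton_le_iff_mem _).mpr hG h7
    obtain ⟨t, ht, hts⟩ := (Ideal.mem_map_iff_of_surjective E E.surjective).mp h6
    rwa [← E.injective hts]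

variable (hS : IsFormalSmoothSurface K O) (hm : maximalIdeal O = Ideal.span {x, y})
  (hID : ID = Ideal.span {y}) (hIC : IC = Ideal.span {F})

include hS hm hID hIC in
/-- Every deformation is given by a lift of `F` on the trivial deformation of the pair. -/
theorem LogDef.exists_isGivenBy (A : ArtAlg K) (δ : LogDef ID IC A) :
    ∃ G : A ⊗[K] O, trivialRed A O G = F ∧ δ.IsGivenBy G := by
  have hsurj := δ.isFlatDeformationS.surjective
  obtain ⟨sx, hsx, hx⟩ := (Ideal.mem_map_iff_of_surjective δ.redS hsurj).mp
    (show x ∈ δ.P.map δ.redS by rw [δ.P_zero, hm]; exact Ideal.subset_span (by simp))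
  obtain ⟨sy, hsy, hy⟩ := (Ideal.mem_map_iff_of_surjective δ.redS hsurj).mp
    (show y ∈ δ.D.map δ.redS from δ.D_zero.symm ▸ hID ▸ Ideal.mem_span_singleton_self y)
  obtain ⟨sG, hsG, hF⟩ := (Ideal.mem_map_iff_of_surjective δ.redS hsurj).mp
    (show F ∈ (RingHom.ker δ.ι).map δ.redS from
      δ.map_ker_ι.symm ▸ hIC ▸ Ideal.mem_span_singleton_self F)
  obtain ⟨E, -, -, hE, hgiven⟩ :=
    δ.exists_isGivenBy_of_lifts hS hm hID hIC hsx hsy hsG hx hy hF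
  exact ⟨_, by rw [← hE, AlgEquiv.apply_symm_apply, hF], hgiven⟩

include hS hm hID hIC in
/-- An equation of the restriction of a deformation along a surjection lifts to an equation of the
deformation. -/
theorem LogDef.exists_isGivenBy_lift {A' A : ArtAlg K} (p : A' ⟶ A)
    (hp : Function.Surjective (ArtAlg.Hom.hom p)) (δ : LogDef ID IC A') {G : A ⊗[K] O}
    (hG : (δ.map p).IsGivenBy G) (hGF : trivialRed A O G = F) :
    ∃ G' : A' ⊗[K] O, tensorMap O (ArtAlg.Hom.hom p) G' = G ∧ δ.IsGivenBy G' := by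
  let _ : Algebra A' A := (ArtAlg.Hom.hom p).toRingHom.toAlgebra
  have : IsScalarTower K A' A := IsScalarTower.of_algHom (ArtAlg.Hom.hom p)
  change (δ.baseChange A).IsGivenBy G at hG
  obtain ⟨E₀, h1, h2, h3, h4, h5⟩ := hG
  let E : A ⊗[A'] δ.S ≃ₐ[A] A ⊗[K] O := E₀
  let inc : δ.S →+* A ⊗[A'] δ.S :=
    (Algebra.TensorProduct.includeRight : δ.S →ₐ[A'] A ⊗[A'] δ.S).toRingHom
  let ρ : δ.S →+* A ⊗[K] O := RingHom.comp (E : A ⊗[A'] δ.S →+* A ⊗[K] O) inc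
  have hinc : Function.Surjective inc :=
    Algebra.TensorProduct.includeRight_surjective δ.S hp
  have hρ : Function.Surjective ρ := E.surjective.comp hinc
  have hred : ∀ s, trivialRed A O (ρ s) = δ.redS s := by
    intro s
    refine (h1 (inc s)).trans ?_
    refine (redBaseChange_tmul δ.redS δ.isFlatDeformationS 1 s).trans ?_
    rw [map_one, map_one, one_mul]
  have hmap : ∀ I : Ideal δ.S, I.map ρ = (I.map inc).map E := fun I =>
    (Ideal.map_map inc (E : A ⊗[A'] δ.S →+* A ⊗[K] O)).symm
  have hk : RingHom.ker (δ.baseChange A).ι = (RingHom.ker δ.ι).map inc :=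
    Algebra.TensorProduct.lTensor_ker (A := A) δ.ι δ.ι_surjective
  obtain ⟨sx, hsx, hx⟩ := (Ideal.mem_map_iff_of_surjective ρ hρ).mp
    (show (1 ⊗ₜ x : A ⊗[K] O) ∈ δ.P.map ρ by
      refine (hmap δ.P).symm ▸ (h3.symm ▸ Ideal.mem_map_of_mem _ ?_)
      rw [hm]
      exact Ideal.subset_span (by simp))
  obtain ⟨sy, hsy, hy⟩ := (Ideal.mem_map_iff_of_surjective ρ hρ).mp
    (show (1 ⊗ₜ y : A ⊗[K] O) ∈ δ.D.map ρ from
      (hmap δ.D).symm ▸ (h2.symm ▸ Ideal.mem_map_of_mem _ (hID ▸ Ideal.mem_span_singleton_self y)))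
  obtain ⟨sG, hsG, hsGG⟩ := (Ideal.mem_map_iff_of_surjective ρ hρ).mp
    (show G ∈ (RingHom.ker δ.ι).map ρ by
      rw [hmap, ← hk]
      exact h5.symm ▸ Ideal.mem_span_singleton_self G)
  have hone : ∀ o : O, trivialRed A O (1 ⊗ₜ o) = o := fun o => by simp [trivialRed_tmul]
  obtain ⟨E', hE'x, hE'y, hE', hgiven⟩ := δ.exists_isGivenBy_of_lifts hS hm hID hIC hsx hsy hsG
    (by rw [← hred, hx, hone]) (by rw [← hred, hy, hone]) (by rw [← hred, hsGG, hGF])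
  refine ⟨E'.symm sG, ?_, hgiven⟩
  have := hS.isNoetherianRing
  have := hS.isAdicComplete
  have hcomp := (isFlatDeformation_trivialRed (A := A) (O := O)).isAdicComplete
  have hext : ρ.comp (E' : A' ⊗[K] O →+* δ.S) =
      (tensorMap O (ArtAlg.Hom.hom p) : A' ⊗[K] O →+* A ⊗[K] O) := by
    refine tensor_hom_ext hS hm
      ((maximalIdeal O).comap (trivialRed A O : A ⊗[K] O →+* O)) (fun a => ?_) ?_ ?_ ?_ ?_
    · have e1 : E' (a ⊗ₜ 1) = algebraMap A' δ.S a := E'.commutes a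
      have e2 : inc (algebraMap A' δ.S a) = algebraMap A _ (ArtAlg.Hom.hom p a) :=
        (Algebra.TensorProduct.includeRight : δ.S →ₐ[A'] A ⊗[A'] δ.S).commutes a
      have e3 : E (algebraMap A _ (ArtAlg.Hom.hom p a)) =
        algebraMap A _ (ArtAlg.Hom.hom p a) := E.commutes _
      change E (inc (E' (a ⊗ₜ 1))) = _
      rw [e1, e2, e3]
      simp
    · change ρ (E' (1 ⊗ₜ x)) = _
      rw [hE'x, hx]
      simp
    · change ρ (E' (1 ⊗ₜ y)) = _
      rw [hE'y, hy]
      simp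
    · change trivialRed A O (ρ (E' (1 ⊗ₜ x))) ∈ maximalIdeal O
      rw [hE'x, hx, hone, hm]
      exact Ideal.subset_span (by simp)
    · change trivialRed A O (ρ (E' (1 ⊗ₜ y))) ∈ maximalIdeal O
      rw [hE'y, hy, hone, hm]
      exact Ideal.subset_span (by simp)
  have := RingHom.congr_fun hext (E'.symm sG)
  refine this.symm.trans ?_
  change ρ (E' (E'.symm sG)) = G
  rw [AlgEquiv.apply_symm_apply, hsGG]

end Lifting

/-! ### Exponentials of nilpotent derivations -/

section Exp

variable {A B : Type*} [CommRing A] [CommRing B] [Algebra A B] [Algebra ℚ A] [Module ℚ B]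
  [IsScalarTower ℚ A B]

/-- The exponential of a derivation with values in `J B`, `J` a nilpotent ideal of the base ring:
an automorphism that agrees with `1 + D` modulo `J²` and preserves every submodule preserved
by `D`. -/
theorem exists_exp_derivation {J : Ideal A} (hJ : IsNilpotent J) (D : Derivation A B B)
    (hD : ∀ b, D b ∈ (J • ⊤ : Submodule A B)) :
    ∃ β : B ≃ₐ[A] B, (∀ b, β b - b - D b ∈ ((J * J) • ⊤ : Submodule A B)) ∧
      ∀ N : Submodule A B, (∀ b ∈ N, D b ∈ N) → (∀ b ∈ N, β b ∈ N) ∧ ∀ b ∈ N, β.symm b ∈ N := by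
  let L : Module.End A B := D
  have hL : ∀ b, L b = D b := fun _ => rfl
  have hmap : ∀ (I : Ideal A), ∀ b ∈ (I • ⊤ : Submodule A B),
      L b ∈ ((I * J) • ⊤ : Submodule A B) := by
    intro I b hb
    have h1 := Submodule.mem_map_of_mem (f := L) hb
    rw [Submodule.map_smul''] at h1
    rw [mul_smul]
    refine Submodule.smul_mono le_rfl ?_ h1
    rintro _ ⟨b, -, rfl⟩
    exact hD b
  have hpow : ∀ n b, (L ^ n) b ∈ (J ^ n • ⊤ : Submodule A B) := by
    intro n
    induction n with
    | zero => intro b; simp [Ideal.map_top]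
    | succ n ih =>
      intro b
      rw [pow_succ' L, Module.End.mul_apply, pow_succ J]
      exact hmap _ _ (ih b)
  have hnil : IsNilpotent L := by
    obtain ⟨n, hn⟩ := hJ
    refine ⟨n, LinearMap.ext fun b => ?_⟩
    simpa [hn] using hpow n b
  have hexp : ∀ L' : Module.End A B, IsNilpotent L' → ∀ N : Submodule A B,
      (∀ b ∈ N, L' b ∈ N) → ∀ b ∈ N, IsNilpotent.exp L' b ∈ N := by
    intro L' hL' N hN b hb
    obtain ⟨n, hn⟩ := hL'
    have hN' : ∀ i : ℕ, (L' ^ i) b ∈ N := by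
      intro i
      induction i with
      | zero => simpa using hb
      | succ i ih =>
        rw [pow_succ', Module.End.mul_apply]
        exact hN _ ih
    rw [IsNilpotent.exp_eq_sum hn, LinearMap.sum_apply]
    exact Submodule.sum_mem _ fun i _ => N.smul_of_tower_mem _ (hN' i)
  have hmul : ∀ b b', IsNilpotent.exp L (b * b') = IsNilpotent.exp L b * IsNilpotent.exp L b' :=
    Module.End.exp_mul_of_derivation A B L (fun b b' => by
      rw [hL, hL, hL, D.leibniz, smul_eq_mul, smul_eq_mul, mul_comm b']) hnil
  let ε : B ≃ₗ[A] B := LinearEquiv.ofLinearMap (IsNilpotent.exp L) (IsNilpotent.exp (-L))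
    (IsNilpotent.exp_mul_exp_neg_self hnil) (IsNilpotent.exp_neg_mul_exp_self hnil)
  have hone : ε 1 = 1 := by
    have h1 : ∀ b, ε 1 * ε b = ε b := fun b => by
      have := hmul 1 b
      rw [one_mul] at this
      exact this.symm
    obtain ⟨b, hb⟩ := ε.surjective 1
    have := h1 b
    rwa [hb, mul_one] at this
  refine ⟨AlgEquiv.ofLinearEquiv ε hone hmul, fun b => ?_, fun N hN => ⟨hexp L hnil N hN, ?_⟩⟩
  · obtain ⟨n, hn⟩ := hnil
    change IsNilpotent.exp L b - b - D b ∈ _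
    have hn2 : L ^ (n + 1 + 1) = 0 := by rw [pow_add, pow_add, hn, zero_mul, zero_mul]
    rw [IsNilpotent.exp_eq_sum hn2, Finset.sum_range_succ', Finset.sum_range_succ']
    have e : ((∑ i ∈ Finset.range n, ((i + 1 + 1).factorial : ℚ)⁻¹ • L ^ (i + 1 + 1) +
          ((0 + 1).factorial : ℚ)⁻¹ • L ^ (0 + 1) + ((0).factorial : ℚ)⁻¹ • L ^ 0 :
          Module.End A B)) b - b - D b =
        ∑ i ∈ Finset.range n, ((i + 1 + 1).factorial : ℚ)⁻¹ • (L ^ (i + 1 + 1)) b := by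
      simp [hL]
    rw [e]
    refine Submodule.sum_mem _ fun i _ => Submodule.smul_of_tower_mem _ _ ?_
    rw [pow_succ', Module.End.mul_apply, pow_succ', Module.End.mul_apply]
    exact hmap _ _ (hD _)
  · exact hexp (-L) hnil.neg N fun b hb => by
      rw [LinearMap.neg_apply]
      exact N.neg_mem (hN b hb)

end Exp

/-- The base change of a derivation to `A ⊗ O`. -/
noncomputable def derivationBaseChange {K O : Type*} (A : Type*) [CommRing K] [CommRing O]
    [Algebra K O] [CommRing A] [Algebra K A] (θ : Derivation K O O) :
    Derivation A (A ⊗[K] O) (A ⊗[K] O) :=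
  Derivation.mk' ((θ : O →ₗ[K] O).baseChange A) fun z z' => by
    induction z with
    | zero => simp
    | add z₁ z₂ h₁ h₂ =>
      rw [add_mul, map_add, h₁, h₂, map_add, add_smul, smul_add]
      ring
    | tmul a o =>
      induction z' with
      | zero => simp
      | add z₁ z₂ h₁ h₂ =>
        rw [mul_add, map_add, h₁, h₂, map_add, add_smul, smul_add]
        ring
      | tmul a' o' =>
        simp only [Algebra.TensorProduct.tmul_mul_tmul, LinearMap.baseChange_tmul, smul_eq_mul,
          Derivation.coeFn_coe, Derivation.leibniz, TensorProduct.tmul_add]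
        rw [mul_comm a' a]

theorem derivationBaseChange_tmul {K O A : Type*} [CommRing K] [CommRing O] [Algebra K O]
    [CommRing A] [Algebra K A] (θ : Derivation K O O) (a : A) (o : O) :
    derivationBaseChange A θ (a ⊗ₜ o) = a ⊗ₜ θ o := rfl

/-! ### Elements of the relative equianalytic ideal -/

section Equianalytic

variable {K O : Type u} [Field K] [CommRing O] [Algebra K O] [IsLocalRing O]

/-- The derivations preserving `D` and `P` form an `O`-module, so that their values at `F` already
form an ideal. -/
theorem exists_derivation_of_mem_relEquianalyticIdeal {ID : Ideal O} {F g : O}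
    (hg : g ∈ relEquianalyticIdeal K ID F) :
    ∃ (θ : Derivation K O O) (r : O), (∀ a ∈ ID, θ a ∈ ID) ∧
      (∀ a ∈ maximalIdeal O, θ a ∈ maximalIdeal O) ∧ g = θ F + r * F := by
  obtain ⟨p, hp, q, hq, rfl⟩ := Submodule.mem_sup.mp hg
  obtain ⟨r, rfl⟩ := Ideal.mem_span_singleton'.mp hq
  suffices h : ∃ θ : Derivation K O O, (∀ a ∈ ID, θ a ∈ ID) ∧
      (∀ a ∈ maximalIdeal O, θ a ∈ maximalIdeal O) ∧ p = θ F by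
    obtain ⟨θ, h1, h2, rfl⟩ := h
    exact ⟨θ, r, h1, h2, rfl⟩
  clear hg
  induction hp using Submodule.span_induction with
  | mem p hp =>
    obtain ⟨θ, h1, h2, h3⟩ := hp
    exact ⟨θ, h1, h2, h3⟩
  | zero => exact ⟨0, by simp, by simp, by simp⟩
  | add p p' _ _ h h' =>
    obtain ⟨θ, h1, h2, rfl⟩ := h
    obtain ⟨θ', h1', h2', rfl⟩ := h'
    exact ⟨θ + θ', fun a ha => add_mem (h1 a ha) (h1' a ha),
      fun a ha => add_mem (h2 a ha) (h2' a ha), rfl⟩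
  | smul c p _ h =>
    obtain ⟨θ, h1, h2, rfl⟩ := h
    exact ⟨c • θ, fun a ha => Ideal.mul_mem_left _ _ (h1 a ha),
      fun a ha => Ideal.mul_mem_left _ _ (h2 a ha), rfl⟩

theorem mem_logEquianalyticIdeal_iff {ID : Ideal O} {y F e : O} (hID : ID = Ideal.span {y}) :
    e ∈ logEquianalyticIdeal K ID F ↔ y * e ∈ relEquianalyticIdeal K ID F := by
  rw [logEquianalyticIdeal, Submodule.mem_colon]
  constructor
  · intro h
    have := h y (by rw [hID]; exact Ideal.mem_span_singleton_self y)
    rwa [smul_eq_mul, mul_comm] at this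
  · intro h s hs
    rw [hID] at hs
    obtain ⟨c, rfl⟩ := Ideal.mem_span_singleton'.mp hs
    rw [smul_eq_mul, show e * (c * y) = c * (y * e) by ring]
    exact Ideal.mul_mem_left _ _ h

end Equianalytic

/-! ### Reduction of an equation to the linear family -/

section Reduction

variable {K O : Type u} [Field K] [CommRing O] [Algebra K O] {A : ArtAlg K}

theorem derivationBaseChange_mem {I : Ideal O} {θ : Derivation K O O} (h : ∀ a ∈ I, θ a ∈ I) :
    ∀ b ∈ I.map (Algebra.TensorProduct.includeRight : O →ₐ[K] A ⊗[K] O),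
      derivationBaseChange A θ b ∈
        I.map (Algebra.TensorProduct.includeRight : O →ₐ[K] A ⊗[K] O) := by
  intro b hb
  induction hb using Submodule.span_induction with
  | mem b hb =>
    obtain ⟨a, ha, rfl⟩ := hb
    exact Ideal.mem_map_of_mem (Algebra.TensorProduct.includeRight : O →ₐ[K] A ⊗[K] O) (h a ha)
  | zero => simp
  | add b b' _ _ hb hb' => rw [map_add]; exact add_mem hb hb'
  | smul c b hb' hb =>
    rw [smul_eq_mul, Derivation.leibniz]
    exact add_mem (Ideal.mul_mem_left _ _ hb) (Ideal.mul_mem_right _ _ hb')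

theorem derivation_mem_map {A B : Type*} [CommRing A] [CommRing B] [Algebra A B]
    (D : Derivation A B B) {I J : Ideal A} (hD : ∀ b, D b ∈ I.map (algebraMap A B)) :
    ∀ b ∈ J.map (algebraMap A B), D b ∈ (J * I).map (algebraMap A B) := by
  intro b hb
  rw [Ideal.map_mul]
  induction hb using Submodule.span_induction with
  | mem b hb =>
    obtain ⟨a, ha, rfl⟩ := hb
    simp
  | zero => simp
  | add b b' _ _ hb hb' => rw [map_add]; exact add_mem hb hb'
  | smul c b hb' hb =>
    rw [smul_eq_mul, Derivation.leibniz]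
    exact add_mem (Ideal.mul_mem_left _ _ hb) (Ideal.mul_mem_mul hb' (hD c))

/-- The coefficient `f + ∑ vᵢ fᵢ` of `y` in the linear family. -/
noncomputable def linearFamily {k : ℕ} (f : O) (fs : Fin k → O) (v : Fin k → A) : A ⊗[K] O :=
  1 ⊗ₜ f + ∑ i, v i ⊗ₜ fs i

theorem tensorMap_linearFamily {B : ArtAlg K} (φ : A →ₐ[K] B) {k : ℕ} (f : O) (fs : Fin k → O)
    (v : Fin k → A) :
    tensorMap O φ (linearFamily f fs v) = linearFamily f fs (fun i => φ (v i)) := by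
  simp [linearFamily]

theorem trivialRed_linearFamily {k : ℕ} (f : O) (fs : Fin k → O) {v : Fin k → A}
    (hv : ∀ i, v i ∈ maximalIdeal A) : trivialRed A O (linearFamily f fs v) = f := by
  simp [linearFamily, trivialRed_tmul, fun i => (A.mem_maximalIdeal_iff _).mp (hv i)]

theorem trivialRed_eq_zero_iff (z : A ⊗[K] O) :
    trivialRed A O z = 0 ↔ z ∈ (maximalIdeal A).map (algebraMap A (A ⊗[K] O)) := by
  rw [← (isFlatDeformation_trivialRed (A := A) (O := O)).ker_eq]
  rfl

/-- Flatness of `A ⊗ O/⟨p, y⟩`, in terms of elements. -/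
theorem exists_eq_of_mem_map_of_mem_span (I : Ideal A) {p y : O} {q : A ⊗[K] O}
    (hq : q ∈ I.map (algebraMap A (A ⊗[K] O)))
    (hq' : q ∈ Ideal.span {(1 ⊗ₜ p : A ⊗[K] O)} ⊔ Ideal.span {1 ⊗ₜ y}) :
    ∃ a ∈ I.map (algebraMap A (A ⊗[K] O)), ∃ b ∈ I.map (algebraMap A (A ⊗[K] O)),
      q = (1 ⊗ₜ y) * a + (1 ⊗ₜ p) * b := by
  have hN : Ideal.span {(1 ⊗ₜ p : A ⊗[K] O)} ⊔ Ideal.span {1 ⊗ₜ y} =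
      (Ideal.span {p, y}).map (Algebra.TensorProduct.includeRight : O →ₐ[K] A ⊗[K] O) := by
    rw [map_includeRight_span, Set.image_pair, Ideal.span_insert]
  rw [hN] at hq'
  set N := (Ideal.span {p, y}).map (Algebra.TensorProduct.includeRight : O →ₐ[K] A ⊗[K] O)
  have hflat : Module.Flat A ((A ⊗[K] O) ⧸ N.restrictScalars A) := Module.Flat.of_linearEquiv
    (Algebra.TensorProduct.tensorQuotientEquiv (R := K) A O A
      (Ideal.span {p, y})).symm.toLinearEquiv
  have h1 : q ∈ I • N.restrictScalars A := by
    refine inf_smul_top_le_of_flat_quotient I _ ⟨?_, hq'⟩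
    rw [Ideal.smul_top_eq_map]
    exact hq
  clear hq hq'
  induction h1 using Submodule.smul_induction_on' with
  | smul c hc n hn =>
    have hn' : n ∈ N := hn
    rw [← hN] at hn'
    obtain ⟨s, hs, t, ht, rfl⟩ := Submodule.mem_sup.mp hn'
    obtain ⟨s, rfl⟩ := Ideal.mem_span_singleton.mp hs
    obtain ⟨t, rfl⟩ := Ideal.mem_span_singleton.mp ht
    refine ⟨algebraMap A _ c * t, Ideal.mul_mem_right _ _ (Ideal.mem_map_of_mem _ hc),
      algebraMap A _ c * s, Ideal.mul_mem_right _ _ (Ideal.mem_map_of_mem _ hc), ?_⟩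
    rw [Algebra.smul_def]
    ring
  | add q _ q' _ h h' =>
    obtain ⟨a, ha, b, hb, rfl⟩ := h
    obtain ⟨a', ha', b', hb', rfl⟩ := h'
    exact ⟨a + a', add_mem ha ha', b + b', add_mem hb hb', by ring⟩

variable [IsLocalRing O] {ID IC : Ideal O} {x y F f : O} {w k : ℕ} {fs : Fin k → O}

/-- To first order, `y z` for `z ∈ I ⊗ O` is a combination of the `y fᵢ`, of the image of `F` under
a derivation preserving the pair, and of a multiple of `F`. -/
theorem exists_first_order_decomposition (hID : ID = Ideal.span {y})
    (hfs : ∀ o : O, ∃ c : Fin k → K, o - ∑ i, c i • fs i ∈ logEquianalyticIdeal K ID F)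
    (I : Ideal A) {z : A ⊗[K] O} (hz : z ∈ I.map (algebraMap A (A ⊗[K] O))) :
    ∃ (n : Fin k → A) (D : Derivation A (A ⊗[K] O) (A ⊗[K] O)) (r : A ⊗[K] O),
      (∀ i, n i ∈ I) ∧ (∀ b, D b ∈ I.map (algebraMap A (A ⊗[K] O))) ∧
      (∀ b ∈ ID.map (Algebra.TensorProduct.includeRight : O →ₐ[K] A ⊗[K] O),
        D b ∈ ID.map (Algebra.TensorProduct.includeRight : O →ₐ[K] A ⊗[K] O)) ∧
      (∀ b ∈ (maximalIdeal O).map (Algebra.TensorProduct.includeRight : O →ₐ[K] A ⊗[K] O),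
        D b ∈ (maximalIdeal O).map (Algebra.TensorProduct.includeRight : O →ₐ[K] A ⊗[K] O)) ∧
      r ∈ I.map (algebraMap A (A ⊗[K] O)) ∧
      (1 ⊗ₜ y) * z = (1 ⊗ₜ y) * ∑ i, n i ⊗ₜ fs i + D (1 ⊗ₜ F) + r * (1 ⊗ₜ F) := by
  have hsmul : ∀ c ∈ I, ∀ b : A ⊗[K] O, c • b ∈ I.map (algebraMap A (A ⊗[K] O)) := by
    intro c hc b
    rw [Algebra.smul_def]
    exact Ideal.mul_mem_right _ _ (Ideal.mem_map_of_mem _ hc)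
  have hz' : z ∈ (I • ⊤ : Submodule A (A ⊗[K] O)) := by
    rw [Ideal.smul_top_eq_map]
    exact hz
  clear hz
  induction hz' using Submodule.smul_induction_on' with
  | smul c hc z _ =>
    induction z with
    | zero => exact ⟨0, 0, 0, by simp, by simp, by simp, by simp, by simp, by simp⟩
    | add z z' h h' =>
      obtain ⟨n, D, r, h1, h2, h3, h4, h5, h6⟩ := h trivial
      obtain ⟨n', D', r', h1', h2', h3', h4', h5', h6'⟩ := h' trivial
      refine ⟨n + n', D + D', r + r', fun i => add_mem (h1 i) (h1' i),
        fun b => add_mem (h2 b) (h2' b), fun b hb => add_mem (h3 b hb) (h3' b hb),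
        fun b hb => add_mem (h4 b hb) (h4' b hb), add_mem h5 h5', ?_⟩
      rw [smul_add, mul_add, h6, h6']
      simp only [Pi.add_apply, TensorProduct.add_tmul, Finset.sum_add_distrib, Derivation.add_apply]
      ring
    | tmul a o =>
      obtain ⟨c', hc'⟩ := hfs o
      rw [mem_logEquianalyticIdeal_iff hID] at hc'
      obtain ⟨θ, r, hθ1, hθ2, hθ⟩ := exists_derivation_of_mem_relEquianalyticIdeal hc'
      refine ⟨fun i => c' i • (c * a), (c * a) • derivationBaseChange A θ, (c * a) • (1 ⊗ₜ r),
        fun i => ?_, fun b => hsmul _ (I.mul_mem_right _ hc) _, fun b hb => ?_, fun b hb => ?_,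
        hsmul _ (I.mul_mem_right _ hc) _, ?_⟩
      · show c' i • (c * a) ∈ I
        rw [Algebra.smul_def]
        exact I.mul_mem_left _ (I.mul_mem_right _ hc)
      · rw [Derivation.smul_apply]
        exact Submodule.smul_of_tower_mem _ _ (derivationBaseChange_mem hθ1 b hb)
      · rw [Derivation.smul_apply]
        exact Submodule.smul_of_tower_mem _ _ (derivationBaseChange_mem hθ2 b hb)
      · have e1 : ∑ i, (c' i • (c * a)) ⊗ₜ[K] fs i = (c * a) ⊗ₜ ∑ i, c' i • fs i := by
          rw [TensorProduct.tmul_sum]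
          exact Finset.sum_congr rfl fun i _ => TensorProduct.smul_tmul _ _ _
        have e2 : y * o = y * ∑ i, c' i • fs i + θ F + r * F := by
          rw [add_assoc, ← hθ]
          ring
        rw [e1, Derivation.smul_apply, derivationBaseChange_tmul, TensorProduct.smul_tmul',
          TensorProduct.smul_tmul', TensorProduct.smul_tmul',
          Algebra.TensorProduct.tmul_mul_tmul, Algebra.TensorProduct.tmul_mul_tmul,
          Algebra.TensorProduct.tmul_mul_tmul]
        simp only [smul_eq_mul, mul_one, one_mul]
        rw [e2, TensorProduct.tmul_add, TensorProduct.tmul_add]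
  | add z _ z' _ h h' =>
    obtain ⟨n, D, r, h1, h2, h3, h4, h5, h6⟩ := h
    obtain ⟨n', D', r', h1', h2', h3', h4', h5', h6'⟩ := h'
    refine ⟨n + n', D + D', r + r', fun i => add_mem (h1 i) (h1' i),
      fun b => add_mem (h2 b) (h2' b), fun b hb => add_mem (h3 b hb) (h3' b hb),
      fun b hb => add_mem (h4 b hb) (h4' b hb), add_mem h5 h5', ?_⟩
    rw [mul_add, h6, h6']
    simp only [Pi.add_apply, TensorProduct.add_tmul, Finset.sum_add_distrib, Derivation.add_apply]
    ring

variable [CharZero K]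

/-- One correction step: if the equation `y g + x ^ w` agrees with a member of the linear family
modulo `I`, then, after a change of the equation and of the parameters, it does so modulo
`𝔪_A I`. -/
theorem exists_reduction_step (hm : maximalIdeal O = Ideal.span {x, y})
    (hID : ID = Ideal.span {y}) (hF : F = y * f + x ^ w)
    (hfs : ∀ o : O, ∃ c : Fin k → K, o - ∑ i, c i • fs i ∈ logEquianalyticIdeal K ID F)
    {δ : LogDef ID IC A} {I : Ideal A} (hI : I ≤ maximalIdeal A) {v : Fin k → A}
    (hv : ∀ i, v i ∈ maximalIdeal A) {g : A ⊗[K] O}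
    (hδ : δ.IsGivenBy ((1 ⊗ₜ y) * g + 1 ⊗ₜ (x ^ w)))
    (hg : g - linearFamily f fs v ∈ I.map (algebraMap A (A ⊗[K] O))) :
    ∃ (v' : Fin k → A) (g' : A ⊗[K] O), (∀ i, v' i - v i ∈ I) ∧
      g' - linearFamily f fs v' ∈ (maximalIdeal A * I).map (algebraMap A (A ⊗[K] O)) ∧
      δ.IsGivenBy ((1 ⊗ₜ y) * g' + 1 ⊗ₜ (x ^ w)) := by
  let _ : Algebra ℚ A := Algebra.compHom A (algebraMap ℚ K)
  set e : Ideal A → Ideal (A ⊗[K] O) := fun J => J.map (algebraMap A (A ⊗[K] O)) with he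
  have hmono : ∀ {J J' : Ideal A}, J ≤ J' → e J ≤ e J' := fun h => Ideal.map_mono h
  have hemul : ∀ J J' : Ideal A, e (J * J') = e J * e J' := fun J J' => Ideal.map_mul _ J J'
  have hetop : ∀ (J : Ideal A) (b : A ⊗[K] O),
      b ∈ (J • ⊤ : Submodule A (A ⊗[K] O)) ↔ b ∈ e J := by
    intro J b
    rw [Ideal.smul_top_eq_map]
    rfl
  set m := maximalIdeal A
  -- The terms of second order in the correction lie in `I * I`, hence in `m * I`.
  have hII : I * I ≤ m * I := Ideal.mul_mono hI le_rfl
  have hnil : IsNilpotent I := by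
    obtain ⟨n, hn⟩ := A.isNilpotent_maximalIdeal
    refine ⟨n, ?_⟩
    rw [Ideal.zero_eq_bot, eq_bot_iff, ← Ideal.zero_eq_bot, ← hn]
    exact Ideal.pow_right_mono hI n
  set Y : A ⊗[K] O := 1 ⊗ₜ y
  set X : A ⊗[K] O := 1 ⊗ₜ (x ^ w)
  set G : A ⊗[K] O := Y * g + X
  obtain ⟨n, D, r, hn, hD, hD1, hD2, hr, hdec⟩ :=
    exists_first_order_decomposition hID hfs I hg
  have hrm : r ∈ e m := hmono hI hr
  -- The automorphism `exp (-D)` removes the part of the first order term that lies in `T F`.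
  obtain ⟨β, hβ, hβN⟩ := exists_exp_derivation hnil (-D) (fun b => (hetop I _).mpr (by
    rw [Derivation.neg_apply]
    exact neg_mem (hD b)))
  have hβ' : ∀ b, β b - b + D b ∈ e (m * I) := by
    intro b
    have := hmono hII ((hetop _ _).mp (hβ b))
    rwa [Derivation.neg_apply, sub_neg_eq_add] at this
  have hβred : ∀ z, trivialRed A O (β z) = trivialRed A O z := by
    intro z
    rw [← sub_eq_zero, ← map_sub, trivialRed_eq_zero_iff]
    have h1 : β z - z = (β z - z + D z) - D z := by ring
    rw [h1]
    exact sub_mem (hmono Ideal.mul_le_right (hβ' z) |> hmono hI) (hmono hI (hD z))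
  have hβI : ∀ N : Ideal (A ⊗[K] O), (∀ b ∈ N, D b ∈ N) → N.map β = N := by
    intro N hN
    obtain ⟨h1, h2⟩ := hβN (N.restrictScalars A) (fun b hb => by
      rw [Derivation.neg_apply]
      exact neg_mem (hN b hb))
    apply le_antisymm
    · rw [Ideal.map_le_iff_le_comap]
      exact fun b hb => h1 b hb
    · intro b hb
      rw [← β.apply_symm_apply b]
      exact Ideal.mem_map_of_mem β (h2 b hb)
  have hunit : IsUnit (1 - r) := by
    apply isUnit_of_isUnit_trivialRed
    rw [map_sub, map_one, (trivialRed_eq_zero_iff r).mpr hrm, sub_zero]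
    exact isUnit_one
  set G₁ : A ⊗[K] O := (1 - r) * β G
  have hδ₁ : δ.IsGivenBy G₁ := by
    refine hδ.congr β hβred (hβI _ hD1) (hβI _ hD2) ?_
    exact (Ideal.span_singleton_mul_left_unit hunit _).symm
  set v' : Fin k → A := fun i => v i + n i
  have hfam : linearFamily f fs v' = linearFamily f fs v + ∑ i, n i ⊗ₜ fs i := by
    simp only [linearFamily, v', TensorProduct.add_tmul, Finset.sum_add_distrib]
    ring
  have hGF : G - 1 ⊗ₜ F ∈ e m := by
    rw [← trivialRed_eq_zero_iff, map_sub, sub_eq_zero]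
    have h1 : trivialRed A O g = f := by
      rw [← trivialRed_linearFamily f fs hv, ← sub_eq_zero, ← map_sub, trivialRed_eq_zero_iff]
      exact hmono hI hg
    rw [map_add, map_mul, h1, trivialRed_tmul, trivialRed_tmul, trivialRed_tmul, hF]
    simp
  have hq : G₁ - (Y * linearFamily f fs v' + X) ∈ e (m * I) := by
    have h1 : G₁ - (Y * linearFamily f fs v' + X) = (1 - r) * (β G - G + D G)
        - D (G - 1 ⊗ₜ F) - r * (G - 1 ⊗ₜ F) + r * D G := by
      rw [map_sub, hfam]
      linear_combination hdec
    rw [h1]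
    refine add_mem (sub_mem (sub_mem (Ideal.mul_mem_left _ _ (hβ' G)) ?_) ?_) ?_
    · exact derivation_mem_map D hD _ hGF
    · rw [hemul, mul_comm (e m)]
      exact Ideal.mul_mem_mul hr hGF
    · refine hmono hII ?_
      rw [hemul]
      exact Ideal.mul_mem_mul hr (hD G)
  -- The error also lies in `⟨x ^ w, y⟩`, since constancy of the intersection multiplicity does not
  -- depend on the equation.
  have hq' : G₁ - (Y * linearFamily f fs v' + X) ∈ Ideal.span {X} ⊔ Ideal.span {Y} := by
    have hmem : ∀ g : A ⊗[K] O, Y * g + X ∈ Ideal.span {X} ⊔ Ideal.span {Y} := fun g =>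
      add_mem (Ideal.mem_sup_right (Ideal.mul_mem_right _ _ (Ideal.mem_span_singleton_self Y)))
        (Ideal.mem_sup_left (Ideal.mem_span_singleton_self X))
    refine sub_mem ?_ (hmem _)
    rw [← hδ₁.containsMultiple_iff hm hID, hδ.containsMultiple_iff hm hID]
    exact hmem g
  obtain ⟨a, ha, b, hb, hab⟩ := exists_eq_of_mem_map_of_mem_span (m * I) hq hq'
  have hbm : b ∈ e m := hmono Ideal.mul_le_left hb
  have hunit' : IsUnit (1 + b) := by
    apply isUnit_of_isUnit_trivialRed
    rw [map_add, map_one, (trivialRed_eq_zero_iff b).mpr hbm, add_zero]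
    exact isUnit_one
  obtain ⟨κ, hκ⟩ := hunit'.exists_right_inv
  have hκU : IsUnit κ := IsUnit.of_mul_eq_one _ (by rw [mul_comm]; exact hκ)
  refine ⟨v', κ * (linearFamily f fs v' + a), fun i => ?_, ?_, ?_⟩
  · simpa [v'] using hn i
  · have h1 : κ * (linearFamily f fs v' + a) - linearFamily f fs v' =
        κ * a - κ * linearFamily f fs v' * b := by
      linear_combination linearFamily f fs v' * hκ
    rw [h1]
    exact sub_mem (Ideal.mul_mem_left _ _ ha) (Ideal.mul_mem_left _ _ hb)
  · refine hδ₁.span_congr ?_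
    rw [← Ideal.span_singleton_mul_left_unit hκU]
    congr 2
    linear_combination κ * hab + X * hκ

/-- A deformation whose equation agrees with a member of the linear family modulo `I` is isomorphic
to a member of the linear family with the same parameters modulo `I`. The correction is made
successively modulo the ideals `𝔪ⁿ I`. -/
theorem exists_linearFamily (hm : maximalIdeal O = Ideal.span {x, y})
    (hID : ID = Ideal.span {y}) (hF : F = y * f + x ^ w)
    (hfs : ∀ o : O, ∃ c : Fin k → K, o - ∑ i, c i • fs i ∈ logEquianalyticIdeal K ID F)
    {δ : LogDef ID IC A} {I : Ideal A} (hI : I ≤ maximalIdeal A) {v : Fin k → A}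
    (hv : ∀ i, v i ∈ maximalIdeal A) {g : A ⊗[K] O}
    (hδ : δ.IsGivenBy ((1 ⊗ₜ y) * g + 1 ⊗ₜ (x ^ w)))
    (hg : g - linearFamily f fs v ∈ I.map (algebraMap A (A ⊗[K] O))) :
    ∃ v' : Fin k → A, (∀ i, v' i - v i ∈ I) ∧
      δ.IsGivenBy ((1 ⊗ₜ y) * linearFamily f fs v' + 1 ⊗ₜ (x ^ w)) := by
  have key : ∀ (n : ℕ) (J : Ideal A), maximalIdeal A ^ n * J = ⊥ → J ≤ maximalIdeal A →
      ∀ (v : Fin k → A) (g : A ⊗[K] O), (∀ i, v i ∈ maximalIdeal A) →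
      δ.IsGivenBy ((1 ⊗ₜ y) * g + 1 ⊗ₜ (x ^ w)) →
      g - linearFamily f fs v ∈ J.map (algebraMap A (A ⊗[K] O)) →
      ∃ v' : Fin k → A, (∀ i, v' i - v i ∈ J) ∧
        δ.IsGivenBy ((1 ⊗ₜ y) * linearFamily f fs v' + 1 ⊗ₜ (x ^ w)) := by
    intro n
    induction n with
    | zero =>
      intro J hJ _ v g _ hδ hg
      rw [pow_zero, one_mul] at hJ
      rw [hJ, Ideal.map_bot, Ideal.mem_bot, sub_eq_zero] at hg
      exact ⟨v, by simp, hg ▸ hδ⟩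
    | succ n ih =>
      intro J hJ hJm v g hv hδ hg
      obtain ⟨v₁, g₁, h1, h2, h3⟩ := exists_reduction_step hm hID hF hfs hJm hv hδ hg
      obtain ⟨v₂, h4, h5⟩ := ih (maximalIdeal A * J) (by rw [← mul_assoc, ← pow_succ, hJ])
        Ideal.mul_le_left v₁ g₁ (fun i => by
          have := add_mem (hJm (h1 i)) (hv i)
          rwa [sub_add_cancel] at this) h3 h2
      refine ⟨v₂, fun i => ?_, h5⟩
      have := add_mem (Ideal.mul_le_right (h4 i)) (h1 i)
      rwa [sub_add_sub_cancel] at this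
  obtain ⟨n, hn⟩ := A.isNilpotent_maximalIdeal
  exact key n I (by rw [hn, Ideal.zero_eq_bot, Ideal.bot_mul]) hI v g hv hδ hg

end Reduction

/-! ### First order deformations -/

section DualNumbers

variable {K O : Type u} [Field K] [CommRing O] [Algebra K O]

/-- The coefficient of `ε` in a dual number. -/
noncomputable def epsilonCoeff (K : Type u) [Field K] : dualNumbers K →ₗ[K] K :=
  (TrivSqZeroExt.sndHom K K : DualNumber K →ₗ[K] K)

theorem dualNumbers_res (a : DualNumber K) :
    (dualNumbers K).res a = TrivSqZeroExt.fst a :=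
  DFunLike.congr_fun (algHom_to_field_unique (dualNumbers K).res
    (TrivSqZeroExt.fstHom K K K : DualNumber K →ₐ[K] K)) a

theorem dualNumbers_ext {a b : dualNumbers K} (h : (dualNumbers K).res a = (dualNumbers K).res b)
    (h' : epsilonCoeff K a = epsilonCoeff K b) : a = b :=
  TrivSqZeroExt.ext ((dualNumbers_res a).symm.trans (h.trans (dualNumbers_res b))) h'

theorem epsilonCoeff_one : epsilonCoeff K 1 = 0 :=
  (TrivSqZeroExt.snd_one : TrivSqZeroExt.snd (1 : DualNumber K) = 0)

theorem epsilonCoeff_mul (a b : dualNumbers K) :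
    epsilonCoeff K (a * b) =
      (dualNumbers K).res a * epsilonCoeff K b + (dualNumbers K).res b * epsilonCoeff K a := by
  have h : ∀ a : dualNumbers K, (dualNumbers K).res a = TrivSqZeroExt.fst (R := K) (M := K) a :=
    dualNumbers_res
  rw [h, h, mul_comm (TrivSqZeroExt.fst b)]
  exact TrivSqZeroExt.snd_mul (R := K) (M := K) a b

/-- The `ε`-coefficient of a function on the trivial deformation over the dual numbers. -/
noncomputable def epsilonPart (O : Type u) [CommRing O] [Algebra K O] :
    dualNumbers K ⊗[K] O →ₗ[K] O :=
  (TensorProduct.lid K O).toLinearMap.comp ((epsilonCoeff K).rTensor O)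

theorem epsilonPart_tmul (a : dualNumbers K) (o : O) :
    epsilonPart O (a ⊗ₜ[K] o) = epsilonCoeff K a • o :=
  rfl

theorem epsilonPart_one_tmul (o : O) :
    epsilonPart O ((1 : dualNumbers K) ⊗ₜ[K] o) = 0 := by
  rw [epsilonPart_tmul, epsilonCoeff_one, zero_smul]

theorem trivialRed_one_tmul {A : ArtAlg K} (o : O) : trivialRed A O (1 ⊗ₜ[K] o) = o := by
  rw [trivialRed_tmul, map_one, map_one, one_mul]

/-- The `ε`-part is a derivation over the reduction to the closed fibre. -/
theorem epsilonPart_mul (z z' : dualNumbers K ⊗[K] O) :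
    epsilonPart O (z * z') =
      trivialRed (dualNumbers K) O z * epsilonPart O z' +
        epsilonPart O z * trivialRed (dualNumbers K) O z' := by
  induction z with
  | zero => simp
  | add z₁ z₂ h₁ h₂ => simp only [add_mul, map_add, h₁, h₂]; ring
  | tmul a o =>
    induction z' with
    | zero => simp
    | add z₁ z₂ h₁ h₂ => simp only [mul_add, map_add, h₁, h₂]; ring
    | tmul a' o' =>
      rw [Algebra.TensorProduct.tmul_mul_tmul, epsilonPart_tmul, epsilonPart_tmul, epsilonPart_tmul,
        trivialRed_tmul, trivialRed_tmul, epsilonCoeff_mul]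
      simp only [Algebra.smul_def, map_add, map_mul]
      ring

theorem epsilonPart_mem {I : Ideal O} {z : dualNumbers K ⊗[K] O}
    (hz : z ∈ I.map (Algebra.TensorProduct.includeRight : O →ₐ[K] dualNumbers K ⊗[K] O)) :
    epsilonPart O z ∈ I := by
  suffices h : epsilonPart O z ∈ I ∧ trivialRed (dualNumbers K) O z ∈ I from h.1
  induction hz using Submodule.span_induction with
  | mem b hb =>
    obtain ⟨a, ha, rfl⟩ := hb
    refine ⟨?_, ?_⟩
    · change epsilonPart O ((1 : dualNumbers K) ⊗ₜ[K] a) ∈ I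
      rw [epsilonPart_one_tmul]
      exact zero_mem I
    · change trivialRed (dualNumbers K) O ((1 : dualNumbers K) ⊗ₜ[K] a) ∈ I
      rw [trivialRed_one_tmul]
      exact ha
  | zero => simp
  | add b b' _ _ hb hb' =>
    rw [map_add, map_add]
    exact ⟨add_mem hb.1 hb'.1, add_mem hb.2 hb'.2⟩
  | smul c b _ hb =>
    rw [smul_eq_mul, epsilonPart_mul, map_mul]
    exact ⟨add_mem (Ideal.mul_mem_left _ _ hb.1) (Ideal.mul_mem_left _ _ hb.2),
      Ideal.mul_mem_left _ _ hb.2⟩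

/-- An automorphism of the trivial deformation over the dual numbers has the form
`1 + ε θ` with a derivation `θ`. -/
theorem exists_derivation_of_dualNumbers_algEquiv
    (β : dualNumbers K ⊗[K] O ≃ₐ[dualNumbers K] dualNumbers K ⊗[K] O)
    (hβ : ∀ z, trivialRed (dualNumbers K) O (β z) = trivialRed (dualNumbers K) O z) :
    ∃ θ : Derivation K O O, (∀ o, θ o = epsilonPart O (β (1 ⊗ₜ o))) ∧
      ∀ z, epsilonPart O (β z) = θ (trivialRed (dualNumbers K) O z) + epsilonPart O z := by
  have hred : ∀ o : O, trivialRed (dualNumbers K) O (β (1 ⊗ₜ o)) = o := fun o => by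
    rw [hβ, trivialRed_one_tmul]
  let L : O →ₗ[K] O := (epsilonPart O).comp
    ((β.toAlgHom.restrictScalars K).comp Algebra.TensorProduct.includeRight).toLinearMap
  have hL : ∀ o, L o = epsilonPart O (β (1 ⊗ₜ o)) := fun _ => rfl
  let θ : Derivation K O O := Derivation.mk' L fun a b => by
    have h : (1 : dualNumbers K) ⊗ₜ[K] (a * b) = (1 ⊗ₜ a) * (1 ⊗ₜ b) := by
      rw [Algebra.TensorProduct.tmul_mul_tmul, one_mul]
    rw [hL, hL, hL, h, map_mul, epsilonPart_mul, hred, hred, smul_eq_mul, smul_eq_mul]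
    ring
  refine ⟨θ, fun _ => rfl, fun z => ?_⟩
  induction z with
  | zero => simp
  | add z z' h h' => simp only [map_add, h, h']; ring
  | tmul a o =>
    have h : a ⊗ₜ[K] o = (a ⊗ₜ[K] (1 : O)) * (1 ⊗ₜ o) := by
      rw [Algebra.TensorProduct.tmul_mul_tmul, one_mul, mul_one]
    have h1 : β (a ⊗ₜ[K] (1 : O)) = a ⊗ₜ 1 := β.commutes a
    have h2 : θ o = epsilonPart O (β (1 ⊗ₜ o)) := rfl
    rw [h, map_mul, epsilonPart_mul, epsilonPart_mul, h1, hred, epsilonPart_one_tmul, map_mul,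
      trivialRed_one_tmul, trivialRed_tmul, ← h2]
    simp only [mul_one, ← Algebra.smul_def, Derivation.map_smul]
    simp

variable [IsLocalRing O] {ID IC : Ideal O} {x y F f : O} {w k : ℕ} {fs : Fin k → O}

/-- Distinct members of the linear family over the dual numbers are not isomorphic. -/
theorem eq_of_isGivenBy_linearFamily_dualNumbers [IsDomain O]
    (hID : ID = Ideal.span {y}) (hF : F = y * f + x ^ w) (hF0 : F ≠ 0)
    (hfs : ∀ c : Fin k → K, ∑ i, c i • fs i ∈ logEquianalyticIdeal K ID F → c = 0)
    {δ : LogDef ID IC (dualNumbers K)} {v v' : Fin k → dualNumbers K}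
    (hv : ∀ i, v i ∈ maximalIdeal (dualNumbers K))
    (hv' : ∀ i, v' i ∈ maximalIdeal (dualNumbers K))
    (h : δ.IsGivenBy ((1 ⊗ₜ y) * linearFamily f fs v + 1 ⊗ₜ (x ^ w)))
    (h' : δ.IsGivenBy ((1 ⊗ₜ y) * linearFamily f fs v' + 1 ⊗ₜ (x ^ w))) : v = v' := by
  obtain ⟨E, hE1, hE2, hE3, -, hE4⟩ := h
  obtain ⟨E', hE1', hE2', hE3', -, hE4'⟩ := h'
  set β := E.symm.trans E'
  have hβ : ∀ z, trivialRed (dualNumbers K) O (β z) = trivialRed (dualNumbers K) O z := fun z => by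
    rw [show β z = E' (E.symm z) from rfl, hE1', ← hE1, E.apply_symm_apply]
  have hmap : ∀ I : Ideal δ.S, ∀ b ∈ I.map E, β b ∈ I.map E' := by
    intro I b hb
    have hb' : b ∈ (I.map E' ).comap β := by
      refine (Ideal.map_le_iff_le_comap.mpr fun s hs => ?_ : I.map E ≤ _) hb
      rw [Ideal.mem_comap, Ideal.mem_comap, show β (E s) = E' s by simp [β]]
      exact Ideal.mem_map_of_mem E' hs
    exact hb'
  obtain ⟨θ, hθ, hθβ⟩ := exists_derivation_of_dualNumbers_algEquiv β hβ
  have hθmem : ∀ (I : Ideal O) (J : Ideal δ.S),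
      J.map E = I.map (Algebra.TensorProduct.includeRight : O →ₐ[K] dualNumbers K ⊗[K] O) →
      J.map E' = I.map (Algebra.TensorProduct.includeRight : O →ₐ[K] dualNumbers K ⊗[K] O) →
      ∀ a ∈ I, θ a ∈ I := by
    intro I J hJ hJ' a ha
    rw [hθ]
    apply epsilonPart_mem
    rw [← hJ']
    apply hmap
    rw [hJ]
    exact Ideal.mem_map_of_mem (Algebra.TensorProduct.includeRight : O →ₐ[K] _) ha
  obtain ⟨u, hu⟩ : ∃ u, β ((1 ⊗ₜ y) * linearFamily f fs v + 1 ⊗ₜ (x ^ w)) =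
      ((1 ⊗ₜ y) * linearFamily f fs v' + 1 ⊗ₜ (x ^ w)) * u := by
    rw [← dvd_def, ← Ideal.mem_span_singleton, ← hE4']
    apply hmap
    rw [hE4]
    exact Ideal.mem_span_singleton_self _
  have hredG : ∀ v : Fin k → dualNumbers K, (∀ i, v i ∈ maximalIdeal (dualNumbers K)) →
      trivialRed (dualNumbers K) O ((1 ⊗ₜ y) * linearFamily f fs v + 1 ⊗ₜ (x ^ w)) = F := by
    intro v hv
    rw [map_add, map_mul, trivialRed_linearFamily f fs hv, trivialRed_one_tmul,
      trivialRed_one_tmul, hF]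
  have hεG : ∀ v : Fin k → dualNumbers K,
      epsilonPart O ((1 ⊗ₜ y) * linearFamily f fs v + 1 ⊗ₜ (x ^ w)) =
        y * ∑ i, epsilonCoeff K (v i) • fs i := by
    intro v
    rw [map_add, epsilonPart_mul, epsilonPart_one_tmul, epsilonPart_one_tmul,
      trivialRed_one_tmul, linearFamily, map_add, epsilonPart_one_tmul, map_sum]
    simp only [epsilonPart_tmul]
    ring
  have hu1 : trivialRed (dualNumbers K) O u = 1 := by
    have := congrArg (trivialRed (dualNumbers K) O) hu
    rw [hβ, map_mul, hredG v hv, hredG v' hv'] at this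
    exact mul_left_cancel₀ hF0 (by rw [← this, mul_one])
  -- Comparison of the coefficients of `ε`.
  have hε := congrArg (epsilonPart O) hu
  rw [hθβ, epsilonPart_mul, hredG v hv, hredG v' hv', hεG, hεG, hu1] at hε
  have hmem : ∑ i, (epsilonCoeff K (v i) -
      epsilonCoeff K (v' i)) • fs i ∈ logEquianalyticIdeal K ID F := by
    rw [mem_logEquianalyticIdeal_iff hID]
    have h1 : y * ∑ i, (epsilonCoeff K (v i) -
        epsilonCoeff K (v' i)) • fs i =
        (-θ) F + epsilonPart O u * F := by
      simp only [sub_smul, Finset.sum_sub_distrib, Derivation.neg_apply]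
      linear_combination hε
    rw [h1]
    refine add_mem
      (Ideal.mem_sup_left (Ideal.subset_span ⟨-θ, fun a ha => ?_, fun a ha => ?_, rfl⟩))
      (Ideal.mem_sup_right (Ideal.mul_mem_left _ _ (Ideal.mem_span_singleton_self F)))
    · rw [Derivation.neg_apply]
      exact neg_mem (hθmem _ _ hE2 hE2' a ha)
    · rw [Derivation.neg_apply]
      exact neg_mem (hθmem _ _ hE3 hE3' a ha)
  have hc := hfs _ hmem
  funext i
  refine dualNumbers_ext ?_ (sub_eq_zero.mp (congrFun hc i))
  rw [((dualNumbers K).mem_maximalIdeal_iff _).mp (hv i),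
    ((dualNumbers K).mem_maximalIdeal_iff _).mp (hv' i)]

end DualNumbers

/-! ### Finite codimension of the logarithmic equianalytic ideal -/

section FiniteCodimension

/-- The localization of a reduced ring `R / I` at a minimal prime `p / I` is a field: its maximal
ideal vanishes. -/
theorem exists_mul_mem_of_isRadical {R : Type*} [CommRing R] {I p : Ideal R} [hp : p.IsPrime]
    (hI : I.IsRadical) (hmin : ∀ q : Ideal R, q.IsPrime → I ≤ q → q ≤ p → q = p) {g : R}
    (hg : g ∈ p) : ∃ s ∉ p, s * g ∈ I := by
  by_contra! hcon
  obtain ⟨q, hq, hIq, hdisj⟩ := Ideal.exists_le_prime_disjoint I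
    (p.primeCompl ⊔ Submonoid.powers g) (by
      rw [Set.disjoint_left]
      intro a ha ha'
      obtain ⟨s, hs, t, ⟨n, rfl⟩, rfl⟩ := Submonoid.mem_sup.mp ha'
      refine hcon s hs (hI ⟨n + 1, ?_⟩)
      have : (s * g) ^ (n + 1) = s ^ n * g * (s * g ^ n) := by ring
      rw [this]
      exact I.mul_mem_left _ ha)
  have hqp : q ≤ p := fun a ha => by
    by_contra hap
    exact Set.disjoint_left.mp hdisj ha
      (Submonoid.mem_sup_left (show a ∈ p.primeCompl from hap))
  have hgq : g ∈ q := (hmin q hq hIq hqp).symm ▸ hg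
  exact Set.disjoint_left.mp hdisj hgq
    (Submonoid.mem_sup_right (Submonoid.mem_powers g))

/-- In a noetherian local domain with maximal ideal generated by two elements, a prime ideal that
contains a nonzero element `F` and is not maximal is a minimal prime over `F`. -/
theorem eq_of_le_of_mem_of_maximalIdeal_eq_span_pair {O : Type*} [CommRing O] [IsDomain O]
    [IsLocalRing O] [IsNoetherianRing O] {x y : O} (hm : maximalIdeal O = Ideal.span {x, y})
    {p : Ideal O} [p.IsPrime] (hp : p ≠ maximalIdeal O) {F : O} (hF : F ≠ 0) (q : Ideal O)
    [q.IsPrime] (hFq : F ∈ q) (hqp : q ≤ p) : q = p := by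
  by_contra hne
  have h1 : (⊥ : Ideal O) < q := bot_lt_iff_ne_bot.mpr fun h => hF (by simpa [h] using hFq)
  have h2 : q < p := lt_of_le_of_ne hqp hne
  have h3 : p < maximalIdeal O := lt_of_le_of_ne (le_maximalIdeal Ideal.IsPrime.ne_top') hp
  -- A chain `⊥ < q < p < 𝔪` contradicts Krull's height theorem.
  have e1 := Ideal.height_strict_mono_of_isPrime h1
  have e2 := Ideal.height_strict_mono_of_isPrime h2
  have e3 := Ideal.height_strict_mono_of_isPrime h3
  have e4 : (maximalIdeal O).height ≤ 2 := by
    refine (Ideal.height_le_spanFinrank _ Ideal.IsPrime.ne_top').trans ?_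
    rw [hm]
    have hc : ({x, y} : Set O).ncard ≤ 2 :=
      (Set.ncard_insert_le x {y}).trans (by rw [Set.ncard_singleton])
    exact_mod_cast (Submodule.spanFinrank_span_le_ncard_of_finite (Set.toFinite _)).trans hc
  have f1 := Order.add_one_le_of_lt e1
  have f2 := Order.add_one_le_of_lt e2
  have f3 := Order.add_one_le_of_lt e3
  have : (3 : ℕ∞) ≤ 2 := calc
    (3 : ℕ∞) = 0 + 1 + 1 + 1 := by norm_num
    _ ≤ (⊥ : Ideal O).height + 1 + 1 + 1 := by gcongr; exact zero_le
    _ ≤ q.height + 1 + 1 := by gcongr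
    _ ≤ p.height + 1 := by gcongr
    _ ≤ _ := f3.trans e4
  exact absurd this (by norm_num)

variable {K O : Type u} [Field K] [CommRing O] [Algebra K O]

/-- In characteristic `0`, a proper ideal of the ring of a formal smooth surface that is stable
under all derivations is zero. -/
theorem IsFormalSmoothSurface.eq_bot_of_derivation_mem [CharZero K]
    (hS : IsFormalSmoothSurface K O) {p : Ideal O} (hp : p ≠ ⊤)
    (h : ∀ (θ : Derivation K O O), ∀ a ∈ p, θ a ∈ p) : p = ⊥ := by
  obtain ⟨e⟩ := hS
  let δ : Fin 2 → Derivation K O O := fun i => Derivation.mk'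
    (e.symm.toLinearMap ∘ₗ (MvPowerSeries.pderiv K i).toLinearMap ∘ₗ e.toLinearMap) fun a b => by
      simp
  have hδ : ∀ i a, e (δ i a) = MvPowerSeries.pderiv K i (e a) := fun i a =>
    e.apply_symm_apply _
  -- All coefficients of the elements of `p` vanish, by induction on the degree: up to a nonzero
  -- integer, each one is a coefficient of lower degree of a partial derivative.
  have key : ∀ (n : ℕ) (d : Fin 2 →₀ ℕ), d.degree = n → ∀ a ∈ p,
      MvPowerSeries.coeff d (e a) = 0 := by
    intro n
    induction n with
    | zero =>
      intro d hd a ha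
      rw [Finsupp.degree_eq_zero_iff] at hd
      subst hd
      by_contra hne
      have hu : IsUnit (e a) := MvPowerSeries.isUnit_iff_constantCoeff.mpr (Ne.isUnit hne)
      exact hp (p.eq_top_of_isUnit_mem ha ((MulEquiv.isUnit_map e).mp hu))
    | succ n ih =>
      intro d hd a ha
      obtain ⟨i, hi⟩ : ∃ i, d i ≠ 0 := by
        by_contra! hcon
        have : d = 0 := Finsupp.ext hcon
        simp [this] at hd
      obtain ⟨d', rfl⟩ : ∃ d', d = d' + Finsupp.single i 1 :=
        ⟨d - Finsupp.single i 1, (tsub_add_cancel_of_le (by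
          simpa using Nat.one_le_iff_ne_zero.mpr hi)).symm⟩
      have h1 := ih d' (by simpa [map_add] using hd) (δ i a) (h _ a ha)
      rw [hδ, MvPowerSeries.coeff_pderiv] at h1
      exact (mul_eq_zero.mp h1).resolve_right (Nat.cast_add_one_ne_zero _)
  rw [eq_bot_iff]
  intro a ha
  have : e a = 0 := MvPowerSeries.ext fun d => key _ d rfl a ha
  rw [Ideal.mem_bot]
  exact e.injective (by rw [this, map_zero])

variable [IsLocalRing O] {ID : Ideal O} {x y F f : O} {w : ℕ}

/-- The only prime ideal that can contain the relative equianalytic ideal of a reduced curve meeting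
`D` properly is that of `P`. -/
theorem eq_maximalIdeal_of_relEquianalyticIdeal_le [CharZero K] (hS : IsFormalSmoothSurface K O)
    (hm : maximalIdeal O = Ideal.span {x, y}) (hID : ID = Ideal.span {y})
    (hF : F = y * f + x ^ w) (hF0 : F ≠ 0) (hC : IsReduced (O ⧸ Ideal.span {F}))
    {p : Ideal O} [hp : p.IsPrime] (hle : relEquianalyticIdeal K ID F ≤ p) :
    p = maximalIdeal O := by
  have := hS.isDomain
  have := hS.isNoetherianRing
  have hFp : F ∈ p := hle (Ideal.mem_sup_right (Ideal.mem_span_singleton_self F))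
  have hym : y ∈ maximalIdeal O := hm ▸ Ideal.subset_span (by simp)
  have hθ : ∀ θ : Derivation K O O, y * θ F ∈ p := by
    intro θ
    refine hle (Ideal.mem_sup_left (Ideal.subset_span ⟨y • θ, fun a _ => ?_, fun a _ => ?_, ?_⟩))
    · rw [hID]
      exact Ideal.mul_mem_right _ _ (Ideal.mem_span_singleton_self y)
    · exact Ideal.mul_mem_right _ _ hym
    · rfl
  by_contra hne
  by_cases hy : y ∈ p
  · refine hne (le_antisymm (le_maximalIdeal hp.ne_top) ?_)
    have hx : x ^ w ∈ p := by
      have : x ^ w = F - y * f := by rw [hF]; ring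
      rw [this]
      exact sub_mem hFp (p.mul_mem_right _ hy)
    rw [hm, Ideal.span_le]
    rintro a (rfl | rfl)
    · exact hp.mem_of_pow_mem w hx
    · exact hy
  · have hθ' : ∀ θ : Derivation K O O, θ F ∈ p := fun θ => (hp.mem_or_mem (hθ θ)).resolve_left hy
    -- If `s a = c F` with `s ∉ p`, then `s θ(a) = c θ(F) + F θ(c) - a θ(s)` lies in `p`.
    have hrad : (Ideal.span {F}).IsRadical := (Ideal.isRadical_iff_quotient_reduced _).mpr hC
    have hstable : ∀ θ : Derivation K O O, ∀ a ∈ p, θ a ∈ p := by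
      intro θ a ha
      obtain ⟨s, hs, hsa⟩ := exists_mul_mem_of_isRadical hrad (fun q hq hFq hqp =>
        eq_of_le_of_mem_of_maximalIdeal_eq_span_pair hm hne hF0 q
          (hFq (Ideal.mem_span_singleton_self F)) hqp) ha
      obtain ⟨c, hc⟩ := Ideal.mem_span_singleton'.mp hsa
      have h1 := congrArg θ hc
      rw [Derivation.leibniz, Derivation.leibniz, smul_eq_mul, smul_eq_mul, smul_eq_mul,
        smul_eq_mul] at h1
      have h2 : s * θ a ∈ p := by
        have : s * θ a = c * θ F + F * θ c - a * θ s := by rw [h1]; ring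
        rw [this]
        exact sub_mem (add_mem (p.mul_mem_left _ (hθ' θ)) (p.mul_mem_right _ hFp))
          (p.mul_mem_right _ ha)
      exact (hp.mem_or_mem h2).resolve_left hs
    have := hS.eq_bot_of_derivation_mem hp.ne_top hstable
    rw [this] at hFp
    exact hF0 hFp

theorem IsFormalSmoothSurface.finite_quotient_of_pow_le (hS : IsFormalSmoothSurface K O)
    {I : Ideal O} {n : ℕ} (hI : maximalIdeal O ^ n ≤ I) : Module.Finite K (O ⧸ I) := by
  have := hS.isNoetherianRing
  obtain ⟨s, hs⟩ : (maximalIdeal O).FG := IsNoetherian.noetherian _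
  -- If `V` spans `O` modulo `𝔪 ^ n`, then `1` and the products of `V` with generators of `𝔪` span
  -- `O` modulo `𝔪 ^ (n + 1)`.
  have key : ∀ n : ℕ, ∃ V : Submodule K O, V.FG ∧
      ∀ o, ∃ v ∈ V, o - v ∈ maximalIdeal O ^ n := by
    intro n
    induction n with
    | zero => exact ⟨⊥, Submodule.fg_bot, fun o => ⟨0, zero_mem _, by simp⟩⟩
    | succ n ih =>
      obtain ⟨V, hV, h⟩ := ih
      refine ⟨Submodule.span K {1} ⊔ ⨆ a ∈ s, V.map (LinearMap.mulLeft K a), ?_, fun o => ?_⟩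
      · refine Submodule.FG.sup (Submodule.fg_span_singleton _) ?_
        exact Submodule.fg_biSup s _ fun a _ => hV.map _
      · have hmem : ∀ o ∈ maximalIdeal O, ∃ v ∈ ⨆ a ∈ s, V.map (LinearMap.mulLeft K a),
            o - v ∈ maximalIdeal O ^ (n + 1) := by
          intro o ho
          rw [← hs] at ho
          obtain ⟨c, rfl⟩ := Submodule.mem_span_finset'.mp ho
          choose u hu hu' using fun a => h (c a)
          refine ⟨∑ a : s, (a : O) * u a, sum_mem fun a _ => Submodule.mem_iSup_of_mem (a : O)
            (Submodule.mem_iSup_of_mem a.2 ⟨u a, hu a, rfl⟩), ?_⟩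
          rw [← Finset.sum_sub_distrib]
          refine sum_mem fun a _ => ?_
          have h1 : c a • (a : O) - a * u a = a * (c a - u a) := by rw [smul_eq_mul]; ring
          rw [h1, pow_succ']
          exact Ideal.mul_mem_mul (hs ▸ Ideal.subset_span a.2) (hu' a)
        obtain ⟨c, hc⟩ := hS.residue_bijective.2 (residue O o)
        have hco : o - c • 1 ∈ maximalIdeal O := by
          rw [← residue_eq_zero_iff, map_sub, sub_eq_zero, ← hc, Algebra.smul_def, mul_one]
          rfl
        obtain ⟨v, hv, hv'⟩ := hmem _ hco
        refine ⟨c • 1 + v, Submodule.add_mem_sup (Submodule.smul_mem _ _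
          (Submodule.mem_span_singleton_self _)) hv, ?_⟩
        rwa [← sub_sub]
  obtain ⟨V, hV, h⟩ := key n
  refine ⟨?_⟩
  have htop : V.map (Ideal.Quotient.mkₐ K I).toLinearMap = ⊤ := by
    rw [eq_top_iff]
    rintro o -
    obtain ⟨o, rfl⟩ := Ideal.Quotient.mk_surjective o
    obtain ⟨v, hv, hv'⟩ := h o
    exact ⟨v, hv, (Ideal.Quotient.eq.mpr (hI hv')).symm⟩
  rw [← htop]
  exact hV.map _

theorem finite_quotient_logEquianalyticIdeal [CharZero K] (hS : IsFormalSmoothSurface K O)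
    (hm : maximalIdeal O = Ideal.span {x, y}) (hID : ID = Ideal.span {y})
    (hF : F = y * f + x ^ w) (hF0 : F ≠ 0) (hC : IsReduced (O ⧸ Ideal.span {F})) :
    Module.Finite K (O ⧸ logEquianalyticIdeal K ID F) := by
  have := hS.isNoetherianRing
  have hrad : maximalIdeal O ≤ (relEquianalyticIdeal K ID F).radical := by
    rw [Ideal.radical_eq_sInf]
    refine le_sInf fun p ⟨hp, hp'⟩ => ?_
    exact (eq_maximalIdeal_of_relEquianalyticIdeal_le hS hm hID hF hF0 hC hp).ge
  obtain ⟨n, hn⟩ := Ideal.exists_pow_le_of_le_radical_of_fg hrad (IsNoetherian.noetherian _)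
  refine hS.finite_quotient_of_pow_le (hn.trans fun a ha => ?_)
  rw [mem_logEquianalyticIdeal_iff hID]
  exact Ideal.mul_mem_left _ _ ha

end FiniteCodimension

/-! ### Coordinates adapted to the pair -/

section Coordinates

variable {K O : Type u} [Field K] [CommRing O] [IsLocalRing O] [Algebra K O] {ID : Ideal O}

theorem IsFormalSmoothCurve.le_maximalIdeal (hD : IsFormalSmoothCurve K (O ⧸ ID)) :
    ID ≤ maximalIdeal O := by
  obtain ⟨e⟩ := hD
  have : Nontrivial (O ⧸ ID) := e.toEquiv.nontrivial
  exact IsLocalRing.le_maximalIdeal (Ideal.Quotient.nontrivial_iff.mp this)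

omit [IsLocalRing O] in
theorem IsFormalSmoothCurve.isPrime (hD : IsFormalSmoothCurve K (O ⧸ ID)) : ID.IsPrime := by
  obtain ⟨e⟩ := hD
  have : IsDomain (O ⧸ ID) := e.toMulEquiv.isDomain _
  exact (Ideal.Quotient.isDomain_iff_prime ID).mp this

theorem IsFormalSmoothCurve.ne_maximalIdeal (hD : IsFormalSmoothCurve K (O ⧸ ID)) :
    ID ≠ maximalIdeal O := by
  intro h
  obtain ⟨e⟩ := hD
  have hf : IsField (O ⧸ ID) := (Ideal.Quotient.maximal_ideal_iff_isField_quotient ID).mp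
    (h ▸ maximalIdeal.isMaximal O)
  obtain ⟨b, hb⟩ := hf.mul_inv_cancel (a := e.symm PowerSeries.X) (by simp [PowerSeries.X_ne_zero])
  have h1 := congrArg (fun z => PowerSeries.constantCoeff (e z)) hb
  simp at h1

theorem IsFormalSmoothSurface.ne_zero_of_maximalIdeal_eq (hS : IsFormalSmoothSurface K O) {x y : O}
    (hm : maximalIdeal O = Ideal.span {x, y}) : y ≠ 0 := by
  obtain ⟨e, -, rfl⟩ := exists_coordinates hS hm
  rw [Ne, map_eq_zero_iff e e.injective]
  intro h
  have := congrArg (MvPowerSeries.coeff (Finsupp.single 1 1)) h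
  simp [MvPowerSeries.coeff_X] at this

theorem IsFormalSmoothCurve.dvd_of_dvd_pow_mul (hD : IsFormalSmoothCurve K (O ⧸ ID)) {x y : O}
    (hm : maximalIdeal O = Ideal.span {x, y}) (hID : ID = Ideal.span {y}) (w : ℕ) (c : O)
    (h : y ∣ x ^ w * c) : y ∣ c := by
  have hp := hD.isPrime
  rw [← Ideal.mem_span_singleton, ← hID] at h ⊢
  refine (hp.mem_or_mem h).resolve_left fun hx => hD.ne_maximalIdeal ?_
  refine le_antisymm hD.le_maximalIdeal ?_
  rw [hm, Ideal.span_le]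
  rintro a (rfl | rfl)
  · exact hp.mem_of_pow_mem w hx
  · rw [hID]
    exact Ideal.mem_span_singleton_self _

/-- A formal smooth surface pair has coordinates `x, y` such that `y` generates the ideal of `D` and
`x` restricts to a given coordinate on `D`. -/
theorem exists_adapted_coordinates (hS : IsFormalSmoothSurface K O)
    (e : (O ⧸ ID) ≃ₐ[K] PowerSeries K) :
    ∃ x y : O, maximalIdeal O = Ideal.span {x, y} ∧ ID = Ideal.span {y} ∧
      e (Ideal.Quotient.mk ID x) = PowerSeries.X := by
  have hD : IsFormalSmoothCurve K (O ⧸ ID) := ⟨e⟩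
  have := hS.isNoetherianRing
  let π : O →+* PowerSeries K := (e : (O ⧸ ID) →+* PowerSeries K).comp (Ideal.Quotient.mk ID)
  have hπ : Function.Surjective π := e.surjective.comp Ideal.Quotient.mk_surjective
  have hker : ∀ a, π a = 0 ↔ a ∈ ID := fun a => by
    rw [← Ideal.Quotient.eq_zero_iff_mem]
    exact map_eq_zero_iff e e.injective
  have hloc : ∀ a, a ∈ maximalIdeal O ↔ PowerSeries.X ∣ π a := by
    intro a
    rw [PowerSeries.X_dvd_iff]
    constructor
    · intro ha
      by_contra hne
      obtain ⟨b, hb⟩ := (PowerSeries.isUnit_iff_constantCoeff.mpr (Ne.isUnit hne)).exists_right_inv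
      obtain ⟨b, rfl⟩ := hπ b
      have h1 : a * b - 1 ∈ ID := by rw [← hker, map_sub, map_mul, hb, map_one, sub_self]
      have h2 := sub_mem (Ideal.mul_mem_right b _ ha) (hD.le_maximalIdeal h1)
      rw [sub_sub_cancel] at h2
      exact (Ideal.ne_top_iff_one _).mp Ideal.IsPrime.ne_top' h2
    · intro ha hu
      have := (hu.map π).map (PowerSeries.constantCoeff (R := K))
      rw [ha] at this
      exact not_isUnit_zero this
  obtain ⟨x, hx⟩ := hπ PowerSeries.X
  have hxm : x ∈ maximalIdeal O := (hloc x).mpr hx.symm.dvd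
  -- Every element of the maximal ideal is a multiple of `x` modulo the ideal of `D`.
  have hdec : ∀ a ∈ maximalIdeal O, ∃ c, a - c * x ∈ ID := by
    intro a ha
    obtain ⟨c, hc⟩ := (hloc a).mp ha
    obtain ⟨c, rfl⟩ := hπ c
    refine ⟨c, ?_⟩
    rw [← hker, map_sub, map_mul, hx, hc, mul_comm, sub_self]
  have hpair : ∀ a b p q : O, maximalIdeal O = Ideal.span {a, b} → x = p * a + q * b → IsUnit p →
      ∃ y ∈ ID, maximalIdeal O = Ideal.span {x, y} := by
    intro a b p q hab hxpq hp
    have ham : a ∈ maximalIdeal O := hab ▸ Ideal.subset_span (by simp)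
    have hbm : b ∈ maximalIdeal O := hab ▸ Ideal.subset_span (by simp)
    obtain ⟨c, hc⟩ := hdec b hbm
    refine ⟨b - c * x, hc, le_antisymm ?_ ?_⟩
    · obtain ⟨p', hp'⟩ := hp.exists_left_inv
      have hb : b ∈ Ideal.span {x, b - c * x} := Ideal.mem_span_pair.mpr ⟨c, 1, by ring⟩
      have ha : a ∈ Ideal.span {x, b - c * x} := by
        have : a = p' * x - p' * q * b := by rw [hxpq]; linear_combination -a * hp'
        rw [this]
        exact sub_mem (Ideal.mul_mem_left _ _ (Ideal.subset_span (by simp)))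
          (Ideal.mul_mem_left _ _ hb)
      rw [hab, Ideal.span_le]
      rintro z (rfl | rfl)
      exacts [ha, hb]
    · rw [Ideal.span_le]
      rintro z (rfl | rfl)
      exacts [hxm, hD.le_maximalIdeal hc]
  obtain ⟨a, b, hab⟩ : ∃ a b : O, maximalIdeal O = Ideal.span {a, b} := by
    obtain ⟨e₀⟩ := hS
    refine ⟨e₀.symm (MvPowerSeries.X 0), e₀.symm (MvPowerSeries.X 1), ?_⟩
    rw [← IsLocalRing.map_maximalIdeal_of_surjective
      (e₀.symm : MvPowerSeries (Fin 2) K →+* O) e₀.symm.surjective, maximalIdeal_mvPowerSeries,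
      Ideal.map_span, ← Set.range_comp]
    congr 1
    ext z
    simp [eq_comm]
  obtain ⟨y, hy, hxy⟩ : ∃ y ∈ ID, maximalIdeal O = Ideal.span {x, y} := by
    obtain ⟨p, q, hpq⟩ := Ideal.mem_span_pair.mp (hab ▸ hxm)
    by_cases hp : IsUnit p
    · exact hpair a b p q hab hpq.symm hp
    by_cases hq : IsUnit q
    · exact hpair b a q p (by rw [hab, Set.pair_comm]) (by rw [← hpq, add_comm]) hq
    -- Otherwise `x` lies in the square of the maximal ideal, but its restriction to `D` does not.
    exfalso
    have hsq : PowerSeries.X * PowerSeries.X ∣ π x := by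
      rw [← hpq, map_add, map_mul, map_mul]
      exact dvd_add
        (mul_dvd_mul ((hloc p).mp hp) ((hloc a).mp (hab ▸ Ideal.subset_span (by simp))))
        (mul_dvd_mul ((hloc q).mp hq) ((hloc b).mp (hab ▸ Ideal.subset_span (by simp))))
    rw [hx, ← sq, PowerSeries.X_pow_dvd_iff] at hsq
    simpa [PowerSeries.coeff_X] using hsq 1 (by norm_num)
  refine ⟨x, y, hxy, le_antisymm ?_ ((Ideal.span_singleton_le_iff_mem _).mpr hy), hx⟩
  -- Nakayama's lemma: `ID ≤ ⟨y⟩ + 𝔪 ID`.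
  refine Submodule.le_of_le_smul_of_le_jacobson_bot (I := maximalIdeal O)
    (IsNoetherian.noetherian _) (IsLocalRing.maximalIdeal_le_jacobson _) fun o ho => ?_
  obtain ⟨c, d, hcd⟩ := Ideal.mem_span_pair.mp (hxy ▸ hD.le_maximalIdeal ho)
  have hc : c ∈ ID := by
    have h1 : c * x ∈ ID := by
      have : c * x = o - d * y := by rw [← hcd]; ring
      rw [this]
      exact sub_mem ho (Ideal.mul_mem_left _ _ hy)
    rw [← hker, map_mul, hx] at h1
    rw [← hker]
    exact (mul_eq_zero.mp h1).resolve_right PowerSeries.X_ne_zero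
  rw [← hcd, add_comm]
  refine Submodule.add_mem_sup (Ideal.mul_mem_left _ _ (Ideal.mem_span_singleton_self _)) ?_
  rw [mul_comm]
  exact Submodule.smul_mem_smul hxm hc

/-- A curve `V(F)` not containing `D` has, up to a unit, an equation `y f + x ^ w` in suitable
coordinates, where `w` is its intersection multiplicity with `D`. -/
theorem exists_normal_equation (hS : IsFormalSmoothSurface K O)
    (hD : IsFormalSmoothCurve K (O ⧸ ID)) {F : O} (hCD : ¬ Ideal.span {F} ≤ ID) :
    ∃ x y f u : O, maximalIdeal O = Ideal.span {x, y} ∧ ID = Ideal.span {y} ∧ IsUnit u ∧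
      u * F = y * f + x ^ intersectionMultiplicity K ID (Ideal.span {F}) := by
  obtain ⟨e⟩ := hD
  obtain ⟨x, y, hm, hID, hx⟩ := exists_adapted_coordinates hS e
  let π : O →ₐ[K] PowerSeries K := (e : (O ⧸ ID) →ₐ[K] PowerSeries K).comp (Ideal.Quotient.mkₐ K ID)
  have hπ : Function.Surjective π := e.surjective.comp Ideal.Quotient.mk_surjective
  have hker : ∀ a, π a = 0 ↔ a ∈ ID := fun a => by
    rw [← Ideal.Quotient.eq_zero_iff_mem]
    exact map_eq_zero_iff e e.injective
  have hF : π F ≠ 0 := fun h => hCD ((Ideal.span_singleton_le_iff_mem _).mpr ((hker F).mp h))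
  obtain ⟨n, v, hv⟩ := IsDiscreteValuationRing.eq_unit_mul_pow_irreducible hF
    PowerSeries.X_prime.irreducible
  obtain ⟨u, hu⟩ := hπ (v⁻¹ : (PowerSeries K)ˣ)
  have huF : π (u * F) = PowerSeries.X ^ n := by rw [map_mul, hu, hv, Units.inv_mul_cancel_left]
  have hunit : IsUnit u := by
    obtain ⟨u', hu'⟩ := hπ v
    have h1 : u * u' - 1 ∈ ID := by
      rw [← hker, map_sub, map_mul, hu, hu', Units.inv_mul, map_one, sub_self]
    have h2 : IsUnit (u * u') := by
      by_contra hn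
      have h3 := sub_mem ((mem_maximalIdeal _).mpr hn) (IsFormalSmoothCurve.le_maximalIdeal ⟨e⟩ h1)
      rw [sub_sub_cancel] at h3
      exact (Ideal.ne_top_iff_one _).mp Ideal.IsPrime.ne_top' h3
    exact isUnit_of_mul_isUnit_left h2
  have hn : intersectionMultiplicity K ID (Ideal.span {F}) = n := by
    let c : PowerSeries K →ₗ[K] (Fin n → K) := LinearMap.pi fun i => PowerSeries.coeff (i : ℕ)
    have hc : Function.Surjective c := fun g =>
      ⟨PowerSeries.mk fun i => if h : i < n then g ⟨i, h⟩ else 0, funext fun i => by simp [c]⟩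
    let L : O →ₗ[K] (Fin n → K) := c ∘ₗ π.toLinearMap
    have hL : Function.Surjective L := hc.comp hπ
    have hLker : LinearMap.ker L = (Ideal.span {F} ⊔ ID).restrictScalars K := by
      ext a
      rw [LinearMap.mem_ker, Submodule.restrictScalars_mem,
        ← Ideal.span_singleton_mul_left_unit hunit F]
      have h1 : L a = 0 ↔ PowerSeries.X ^ n ∣ π a := by
        rw [PowerSeries.X_pow_dvd_iff]
        exact ⟨fun h m hm => congrFun h ⟨m, hm⟩, fun h => funext fun i => h i i.2⟩
      rw [h1]
      constructor
      · rintro ⟨d, hd⟩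
        obtain ⟨d, rfl⟩ := hπ d
        have h2 : a - u * F * d ∈ ID := by rw [← hker, map_sub, map_mul, huF, hd, sub_self]
        have h3 : a = u * F * d + (a - u * F * d) := by ring
        rw [h3]
        exact Submodule.add_mem_sup (Ideal.mul_mem_right _ _ (Ideal.mem_span_singleton_self _)) h2
      · intro h
        obtain ⟨b, hb, d, hd, rfl⟩ := Submodule.mem_sup.mp h
        obtain ⟨b, rfl⟩ := Ideal.mem_span_singleton.mp hb
        rw [map_add, (hker d).mpr hd, add_zero, map_mul, huF]
        exact dvd_mul_right _ _
    have h2 := (L.quotKerEquivOfSurjective hL).finrank_eq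
    rw [hLker, Module.finrank_fin_fun] at h2
    exact h2
  have hmem : u * F - x ^ n ∈ ID := by
    have hπx : π x = PowerSeries.X := hx
    rw [← hker, map_sub, huF, map_pow, hπx, sub_self]
  rw [hID] at hmem
  obtain ⟨f, hf⟩ := Ideal.mem_span_singleton.mp hmem
  exact ⟨x, y, f, u, hm, hID, hunit, by rw [hn, ← hf]; ring⟩

theorem logEquianalyticIdeal_unit_mul {u : O} (hu : IsUnit u) (F : O) :
    logEquianalyticIdeal K ID (u * F) = logEquianalyticIdeal K ID F := by
  have key : ∀ u F : O, relEquianalyticIdeal K ID (u * F) ≤ relEquianalyticIdeal K ID F := by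
    intro u F
    have hF : F ∈ relEquianalyticIdeal K ID F :=
      Ideal.mem_sup_right (Ideal.mem_span_singleton_self F)
    refine sup_le (Ideal.span_le.mpr ?_) ((Ideal.span_singleton_le_iff_mem _).mpr
      (Ideal.mul_mem_left _ _ hF))
    rintro _ ⟨θ, h1, h2, rfl⟩
    rw [SetLike.mem_coe, Derivation.leibniz]
    exact add_mem (Ideal.mul_mem_left _ _ (Ideal.mem_sup_left (Ideal.subset_span ⟨θ, h1, h2, rfl⟩)))
      (Ideal.mul_mem_right _ _ hF)
  obtain ⟨v, hv⟩ := hu.exists_left_inv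
  have h : relEquianalyticIdeal K ID (u * F) = relEquianalyticIdeal K ID F := by
    refine le_antisymm (key u F) ?_
    have := key v (u * F)
    rwa [← mul_assoc, hv, one_mul] at this
  rw [logEquianalyticIdeal, logEquianalyticIdeal, h]

end Coordinates

/-! ### The completion of an affine space at the origin -/

section AffineSpace

variable {K S T : Type*} [CommRing K] [CommRing S] [CommRing T] [Algebra K S] [Algebra K T]
  {I : Ideal S} {J : Ideal T}

/-- The map from the completion to `T ⧸ J ^ n` induced by an algebra homomorphism `φ` with
`φ(I) ⊆ J`. -/
noncomputable def adicCompletionEvalMap (φ : S →ₐ[K] T) (h : I ≤ J.comap φ) (n : ℕ) :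
    AdicCompletion I S →ₐ[K] T ⧸ J ^ n :=
  (Ideal.quotientMapₐ (J ^ n) φ
    ((Ideal.pow_right_mono h n).trans (Ideal.le_comap_pow φ n))).comp
      ((AdicCompletion.evalₐ I n).restrictScalars K)

theorem factorₐ_comp_adicCompletionEvalMap (φ : S →ₐ[K] T) (h : I ≤ J.comap φ) {m n : ℕ}
    (hle : m ≤ n) :
    (Ideal.Quotient.factorₐ K (Ideal.pow_le_pow_right hle)).comp (adicCompletionEvalMap φ h n) =
      adicCompletionEvalMap φ h m := by
  ext a
  induction a using AdicCompletion.induction_on with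
  | _ a =>
    simp only [adicCompletionEvalMap, AlgHom.comp_apply, AlgHom.restrictScalars_apply,
      AdicCompletion.evalₐ_mk]
    exact congrArg (Ideal.quotientMapₐ (J ^ m) φ ((Ideal.pow_right_mono h m).trans
      (Ideal.le_comap_pow φ m))) (AdicCompletion.Ideal.mk_eq_mk I hle a)

/-- The map of completions induced by an algebra homomorphism `φ` with `φ(I) ⊆ J`. -/
noncomputable def adicCompletionMap (φ : S →ₐ[K] T) (h : I ≤ J.comap φ) :
    AdicCompletion I S →ₐ[K] AdicCompletion J T :=
  AdicCompletion.liftAlgHom J (adicCompletionEvalMap φ h) (factorₐ_comp_adicCompletionEvalMap φ h)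

theorem evalₐ_adicCompletionMap (φ : S →ₐ[K] T) (h : I ≤ J.comap φ) {n : ℕ}
    {a : AdicCompletion I S} {s : S}
    (hs : AdicCompletion.evalₐ I n a = Ideal.Quotient.mk _ s) :
    AdicCompletion.evalₐ J n (adicCompletionMap φ h a) = Ideal.Quotient.mk _ (φ s) := by
  refine (AdicCompletion.evalₐ_liftAlgHom J _ (factorₐ_comp_adicCompletionEvalMap φ h) n a).trans ?_
  rw [adicCompletionEvalMap, AlgHom.comp_apply, AlgHom.restrictScalars_apply, hs]
  rfl

/-- An algebra isomorphism carrying `I` to `J` induces an isomorphism of completions. -/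
noncomputable def adicCompletionCongr (φ : S ≃ₐ[K] T)
    (h : I ≤ J.comap φ) (h' : J ≤ I.comap φ.symm) :
    AdicCompletion I S ≃ₐ[K] AdicCompletion J T :=
  AlgEquiv.ofAlgHom (adicCompletionMap (φ : S →ₐ[K] T) h)
    (adicCompletionMap (φ.symm : T →ₐ[K] S) h')
    (AlgHom.ext fun a => AdicCompletion.ext_evalₐ fun n => by
      obtain ⟨s, hs⟩ := Ideal.Quotient.mk_surjective (AdicCompletion.evalₐ J n a)
      rw [AlgHom.comp_apply, evalₐ_adicCompletionMap _ h (evalₐ_adicCompletionMap _ h' hs.symm)]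
      simpa using hs)
    (AlgHom.ext fun a => AdicCompletion.ext_evalₐ fun n => by
      obtain ⟨s, hs⟩ := Ideal.Quotient.mk_surjective (AdicCompletion.evalₐ I n a)
      rw [AlgHom.comp_apply, evalₐ_adicCompletionMap _ h' (evalₐ_adicCompletionMap _ h hs.symm)]
      simpa using hs)

/-- A basis of `V` identifies `Sym(V*)` with a polynomial ring and the ideal of the origin with the
ideal of the variables. -/
theorem nonempty_affineSpaceCompletion_equiv {K V : Type u} [Field K] [AddCommGroup V] [Module K V]
    {k : ℕ} (b : Module.Basis (Fin k) K V) :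
    Nonempty (MvPowerSeries (Fin k) K ≃ₐ[K] AffineSpaceCompletion K V) := by
  let φ : MvPolynomial (Fin k) K ≃ₐ[K] SymmetricAlgebra K (Module.Dual K V) :=
    (SymmetricAlgebra.equivMvPolynomial b.dualBasis).symm
  have hφX : ∀ i, SymmetricAlgebra.algebraMapInv (φ (MvPolynomial.X i)) = 0 := fun i => by
    rw [SymmetricAlgebra.equivMvPolynomial_symm_X, SymmetricAlgebra.algebraMapInv_ι]
  have hcomp : (SymmetricAlgebra.algebraMapInv (M := Module.Dual K V)).comp
      (φ : MvPolynomial (Fin k) K →ₐ[K] _) = MvPolynomial.aeval 0 :=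
    MvPolynomial.algHom_ext fun i => by simpa using hφX i
  have hker : ∀ p : MvPolynomial (Fin k) K, φ p ∈ RingHom.ker (SymmetricAlgebra.algebraMapInv :
      SymmetricAlgebra K (Module.Dual K V) →ₐ[K] K) ↔ p ∈ MvPolynomial.idealOfVars (Fin k) K := by
    intro p
    have h1 : SymmetricAlgebra.algebraMapInv (φ p) = MvPolynomial.constantCoeff p := by
      have := DFunLike.congr_fun hcomp p
      rw [MvPolynomial.aeval_zero] at this
      exact this
    rw [RingHom.mem_ker, h1, ← pow_one (MvPolynomial.idealOfVars (Fin k) K),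
      MvPolynomial.mem_pow_idealOfVars_iff']
    constructor
    · intro h d hd
      rw [(Finsupp.degree_eq_zero_iff d).mp (by omega)]
      exact h
    · intro h
      exact h 0 (by simp)
  exact ⟨(MvPowerSeries.toAdicCompletionAlgEquiv (Fin k) K).restrictScalars K |>.trans
    (adicCompletionCongr φ (fun p hp => (hker p).mpr hp) (fun p hp => by
      rw [Ideal.mem_comap, ← hker]
      simpa using hp))⟩

end AffineSpace

/-! ### The linear family is semiuniversal -/

section Semiuniversal

theorem ker_tensorMap {K O : Type u} [Field K] [CommRing O] [Algebra K O] {A B : ArtAlg K}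
    (φ : A →ₐ[K] B) (hφ : Function.Surjective φ) :
    RingHom.ker (tensorMap O φ) = (RingHom.ker φ).map (algebraMap A (A ⊗[K] O)) :=
  Algebra.TensorProduct.rTensor_ker φ hφ

variable {K O : Type u} [Field K] [CommRing O] [Algebra K O] [IsLocalRing O]
  {ID IC : Ideal O} {x y F f : O} {w k : ℕ} {fs : Fin k → O}

/-- The equation `y (f + ∑ vᵢ fᵢ) + x ^ w` of the linear family. -/
noncomputable def familyEquation {A : ArtAlg K} (x y f : O) (w : ℕ) (fs : Fin k → O)
    (v : Fin k → A) : A ⊗[K] O :=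
  (1 ⊗ₜ y) * linearFamily f fs v + 1 ⊗ₜ (x ^ w)

omit [IsLocalRing O] in
theorem tensorMap_familyEquation {A B : ArtAlg K} (φ : A →ₐ[K] B) (v : Fin k → A) :
    tensorMap O φ (familyEquation x y f w fs v) =
      familyEquation x y f w fs fun i => φ (v i) := by
  simp [familyEquation, linearFamily]

omit [IsLocalRing O] in
theorem trivialRed_familyEquation {A : ArtAlg K} (hF : F = y * f + x ^ w) {v : Fin k → A}
    (hv : ∀ i, v i ∈ maximalIdeal A) : trivialRed A O (familyEquation x y f w fs v) = F := by
  rw [familyEquation, map_add, map_mul, trivialRed_linearFamily f fs hv, trivialRed_one_tmul,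
    trivialRed_one_tmul, hF]

omit [IsLocalRing O] in
theorem familyEquation_mem {A : ArtAlg K} (v : Fin k → A) :
    familyEquation x y f w fs v ∈
      Ideal.span {(1 ⊗ₜ (x ^ w) : A ⊗[K] O)} ⊔ Ideal.span {1 ⊗ₜ y} :=
  add_mem (Ideal.mem_sup_right (Ideal.mul_mem_right _ _ (Ideal.mem_span_singleton_self _)))
    (Ideal.mem_sup_left (Ideal.mem_span_singleton_self _))

theorem exists_isGivenBy_familyEquation (hS : IsFormalSmoothSurface K O)
    (hm : maximalIdeal O = Ideal.span {x, y}) (hID : ID = Ideal.span {y})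
    (hIC : IC = Ideal.span {F}) (hF : F = y * f + x ^ w) (hF0 : F ≠ 0) {A : ArtAlg K}
    {v : Fin k → A} (hv : ∀ i, v i ∈ maximalIdeal A) :
    ∃ δ : LogDef ID IC A, δ.ContainsMultiple w ∧
      δ.IsGivenBy (familyEquation x y f w fs v) := by
  have hIDm : ID ≤ maximalIdeal O := by
    rw [hID, hm]
    exact Ideal.span_mono (by simp)
  obtain ⟨δ, hδ⟩ := exists_isGivenBy hS hIDm hIC hF0 (trivialRed_familyEquation (fs := fs) hF hv)
  exact ⟨δ, (hδ.containsMultiple_iff hm hID w).mpr (familyEquation_mem v), hδ⟩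

variable [CharZero K]

/-- Every deformation with constant intersection multiplicity is isomorphic to a member of the
linear family. -/
theorem LogDef.ContainsMultiple.exists_familyEquation (hS : IsFormalSmoothSurface K O)
    (hD : IsFormalSmoothCurve K (O ⧸ ID)) (hm : maximalIdeal O = Ideal.span {x, y})
    (hID : ID = Ideal.span {y}) (hIC : IC = Ideal.span {F}) (hF : F = y * f + x ^ w)
    (hfs : ∀ o : O, ∃ c : Fin k → K, o - ∑ i, c i • fs i ∈ logEquianalyticIdeal K ID F)
    {A : ArtAlg K} {δ : LogDef ID IC A} (hδ : δ.ContainsMultiple w) :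
    ∃ v : Fin k → A, (∀ i, v i ∈ maximalIdeal A) ∧
      δ.IsGivenBy (familyEquation x y f w fs v) := by
  have := hS.isDomain
  obtain ⟨G, hGF, hG⟩ := LogDef.exists_isGivenBy hS hm hID hIC A δ
  rw [hG.containsMultiple_iff hm hID] at hδ
  have : IsLocalHom (trivialRed A O : A ⊗[K] O →+* O) :=
    ⟨fun z hz => isUnit_of_isUnit_trivialRed hz⟩
  obtain ⟨g, hg, hspan⟩ := exists_normal_form (trivialRed A O : A ⊗[K] O →+* O)
    (isFlatDeformation_trivialRed (A := A) (O := O)).surjective (g := f)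
    (fun c hc => (mul_eq_zero.mp hc).resolve_left (by
      rw [RingHom.coe_coe, trivialRed_one_tmul]
      exact hS.ne_zero_of_maximalIdeal_eq hm))
    (fun c hc => by
      rw [RingHom.coe_coe, trivialRed_one_tmul] at hc ⊢
      rw [trivialRed_one_tmul] at hc
      exact hD.dvd_of_dvd_pow_mul hm hID w c hc) hδ
    (by rw [RingHom.coe_coe, trivialRed_one_tmul, trivialRed_one_tmul, hGF, hF])
  have hzero : ∀ _ : Fin k, (0 : A) ∈ maximalIdeal A := fun _ => zero_mem _
  -- The equation agrees with the member `F` of the linear family modulo the maximal ideal.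
  obtain ⟨v, hv, hv'⟩ := exists_linearFamily hm hID hF hfs (le_refl (maximalIdeal A)) hzero
    (hG.span_congr hspan) (by
      rw [← trivialRed_eq_zero_iff, map_sub, trivialRed_linearFamily f fs hzero, sub_eq_zero]
      exact hg)
  exact ⟨v, fun i => by simpa using hv i, hv'⟩

/-- A deformation with constant intersection multiplicity whose restriction along a surjection
belongs to the linear family is isomorphic to a member of the linear family with lifted
parameters. -/
theorem LogDef.ContainsMultiple.exists_familyEquation_lift (hS : IsFormalSmoothSurface K O)
    (hD : IsFormalSmoothCurve K (O ⧸ ID)) (hm : maximalIdeal O = Ideal.span {x, y})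
    (hID : ID = Ideal.span {y}) (hIC : IC = Ideal.span {F}) (hF : F = y * f + x ^ w)
    (hfs : ∀ o : O, ∃ c : Fin k → K, o - ∑ i, c i • fs i ∈ logEquianalyticIdeal K ID F)
    {A' A : ArtAlg K} (p : A' ⟶ A) (hp : Function.Surjective (ArtAlg.Hom.hom p))
    {δ : LogDef ID IC A'} (hδ : δ.ContainsMultiple w) {v : Fin k → A}
    (hv : ∀ i, v i ∈ maximalIdeal A)
    (hδv : (δ.map p).IsGivenBy (familyEquation x y f w fs v)) :
    ∃ v' : Fin k → A', (∀ i, ArtAlg.Hom.hom p (v' i) = v i) ∧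
      δ.IsGivenBy (familyEquation x y f w fs v') := by
  have := hS.isDomain
  set φ := ArtAlg.Hom.hom p
  obtain ⟨G, hGφ, hG⟩ := LogDef.exists_isGivenBy_lift hS hm hID hIC p hp δ hδv
    (trivialRed_familyEquation hF hv)
  rw [hG.containsMultiple_iff hm hID] at hδ
  have hπ : ∀ o : O, tensorMap O φ (1 ⊗ₜ o) = 1 ⊗ₜ o := fun o => by simp
  have : IsLocalHom (tensorMap O φ : A' ⊗[K] O →+* A ⊗[K] O) := ⟨fun z hz =>
    isUnit_of_isUnit_trivialRed (by
      rw [← trivialRed_tensorMap φ]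
      exact hz.map (trivialRed A O))⟩
  obtain ⟨g, hg, hspan⟩ := exists_normal_form (tensorMap O φ : A' ⊗[K] O →+* A ⊗[K] O)
    (Algebra.TensorProduct.map_surjective _ _ hp Function.surjective_id) (g := linearFamily f fs v)
    (fun c hc => by
      rw [RingHom.coe_coe, hπ] at hc
      exact tensor_mul_left_injective (hS.ne_zero_of_maximalIdeal_eq hm) hc)
    (fun c hc => by
      rw [RingHom.coe_coe, hπ] at hc ⊢
      rw [hπ] at hc
      exact tensor_dvd_of_dvd_mul (hD.dvd_of_dvd_pow_mul hm hID w) hc) hδ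
    (by rw [RingHom.coe_coe, hπ, hπ, hGφ, familyEquation])
  choose a ha using fun i => hp (v i)
  have ham : ∀ i, a i ∈ maximalIdeal A' := fun i => by
    rw [ArtAlg.mem_maximalIdeal_iff, ← ArtAlg.res_comp φ, ha, ← ArtAlg.mem_maximalIdeal_iff]
    exact hv i
  -- The equation agrees with the member with parameters `a` modulo the kernel of `p`.
  obtain ⟨v', hv', hv''⟩ := exists_linearFamily hm hID hF hfs
    (IsLocalRing.le_maximalIdeal (RingHom.ker_ne_top φ)) ham (hG.span_congr hspan) (by
      rw [← ker_tensorMap φ hp, RingHom.mem_ker, map_sub, tensorMap_linearFamily, sub_eq_zero]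
      simp only [ha]
      exact hg)
  refine ⟨v', fun i => ?_, hv''⟩
  have := hv' i
  rwa [RingHom.mem_ker, map_sub, sub_eq_zero, ha] at this

end Semiuniversal

section FormalFamily

/-- The power series ring in `k` variables, as an object of `𝒜̂_K`. -/
noncomputable def powerSeriesAlg (K : Type u) [Field K] (k : ℕ) : CompAlg K where
  carrier := MvPowerSeries (Fin k) K
  residue_bijective := residue_bijective_of_algHom
    ({ (MvPowerSeries.constantCoeff : MvPowerSeries (Fin k) K →+* K) with
        commutes' := fun c => MvPowerSeries.constantCoeff_C c } : MvPowerSeries (Fin k) K →ₐ[K] K)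

/-- The variables of the power series ring, as elements of `powerSeriesAlg K k`. -/
noncomputable def powerSeriesVar (K : Type u) [Field K] {k : ℕ} (i : Fin k) : powerSeriesAlg K k :=
  (MvPowerSeries.X i : MvPowerSeries (Fin k) K)

variable {K : Type u} [Field K] {k : ℕ} {A : ArtAlg K}

theorem map_powerSeriesVar_mem (v : powerSeriesAlg K k →ₐ[K] A) (i : Fin k) :
    v (powerSeriesVar K i) ∈ maximalIdeal A := by
  have h : powerSeriesVar K i ∈ maximalIdeal (powerSeriesAlg K k) := by
    change (MvPowerSeries.X i : MvPowerSeries (Fin k) K) ∈ maximalIdeal (MvPowerSeries (Fin k) K)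
    rw [maximalIdeal_mvPowerSeries]
    exact Ideal.subset_span ⟨i, rfl⟩
  rw [← ker_algHom_to_field (A.res.comp v)] at h
  rw [← ker_algHom_to_field A.res]
  exact h

theorem powerSeriesAlg_hom_ext {v v' : powerSeriesAlg K k →ₐ[K] A}
    (h : ∀ i, v (powerSeriesVar K i) = v' (powerSeriesVar K i)) : v = v' :=
  mvPowerSeries_hom_ext (maximalIdeal A) h (map_powerSeriesVar_mem v)

theorem exists_powerSeriesAlg_hom {a : Fin k → A} (ha : ∀ i, a i ∈ maximalIdeal A) :
    ∃ v : powerSeriesAlg K k →ₐ[K] A, ∀ i, v (powerSeriesVar K i) = a i :=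
  exists_mvPowerSeries_hom (maximalIdeal A) a ha

variable {O : Type u} [CommRing O] [Algebra K O] [IsLocalRing O]
  {ID IC : Ideal O} {x y F f : O} {w : ℕ} {fs : Fin k → O}

/-- The formal element `ξ` is the class of the linear family over the quotients of the power series
ring. -/
def IsLinearFormalElement (ξ : FormalElement (defFunctorMult ID IC w) (powerSeriesAlg K k))
    (x y f : O) (fs : Fin k → O) : Prop :=
  ∀ n, ∃ δ : LogDef ID IC ((powerSeriesAlg K k).quot n), (ξ.elt n).1 = Quotient.mk _ δ ∧
    δ.IsGivenBy (familyEquation x y f w fs fun i =>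
      (powerSeriesAlg K k).toQuot n (powerSeriesVar K i))

theorem exists_isLinearFormalElement (hS : IsFormalSmoothSurface K O)
    (hm : maximalIdeal O = Ideal.span {x, y}) (hID : ID = Ideal.span {y})
    (hIC : IC = Ideal.span {F}) (hF : F = y * f + x ^ w) (hF0 : F ≠ 0) (fs : Fin k → O) :
    ∃ ξ : FormalElement (defFunctorMult ID IC w) (powerSeriesAlg K k),
      IsLinearFormalElement ξ x y f fs := by
  choose δ hδw hδ using fun n => exists_isGivenBy_familyEquation (fs := fs) hS hm hID hIC hF hF0
    (map_powerSeriesVar_mem ((powerSeriesAlg K k).toQuot n))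
  refine ⟨{ elt := fun n => ⟨Quotient.mk _ (δ n), δ n, hδw n, rfl⟩, compat := fun n => ?_ },
    fun n => ⟨δ n, rfl, hδ n⟩⟩
  refine Subtype.ext (Quotient.sound ?_)
  have h := (hδ (n + 1)).map ((powerSeriesAlg K k).trans n)
  rw [tensorMap_familyEquation] at h
  exact LogDef.iso_of_isGivenBy h (hδ n)

/-- The morphism of functors associated with the linear family sends `v` to the class of the member
of the linear family with parameters `v(Xᵢ)`. -/
theorem IsLinearFormalElement.toMap_eq_iff
    {ξ : FormalElement (defFunctorMult ID IC w) (powerSeriesAlg K k)}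
    (hξ : IsLinearFormalElement ξ x y f fs) (v : powerSeriesAlg K k →ₐ[K] A) (δ : LogDef ID IC A) :
    (ξ.toMap A v).1 = Quotient.mk _ δ ↔
      δ.IsGivenBy (familyEquation x y f w fs fun i => v (powerSeriesVar K i)) := by
  set n := (exists_pow_le_ker v).choose
  set φ := CompAlg.desc v n (exists_pow_le_ker v).choose_spec
  obtain ⟨δ', h1, h2⟩ := hξ n
  have h3 := h2.map φ
  rw [tensorMap_familyEquation] at h3
  have h4 : (ξ.toMap A v).1 = Quotient.mk _ (δ'.map φ) :=
    congrArg ((defFunctor ID IC).map φ) h1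
  rw [h4]
  constructor
  · intro h
    exact LogDef.IsGivenBy.of_iso h3 (Quotient.exact h)
  · intro h
    exact Quotient.sound (LogDef.iso_of_isGivenBy h3 h)

variable [CharZero K]

theorem IsLinearFormalElement.isSemiuniversal
    {ξ : FormalElement (defFunctorMult ID IC w) (powerSeriesAlg K k)}
    (hξ : IsLinearFormalElement ξ x y f fs) (hS : IsFormalSmoothSurface K O)
    (hD : IsFormalSmoothCurve K (O ⧸ ID)) (hm : maximalIdeal O = Ideal.span {x, y})
    (hID : ID = Ideal.span {y}) (hIC : IC = Ideal.span {F}) (hF : F = y * f + x ^ w)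
    (hF0 : F ≠ 0) (b : Module.Basis (Fin k) K (O ⧸ logEquianalyticIdeal K ID F))
    (hb : ∀ i, b i = Ideal.Quotient.mk _ (fs i)) : ξ.IsSemiuniversal := by
  have hmk : ∀ c : Fin k → K, Ideal.Quotient.mk (logEquianalyticIdeal K ID F) (∑ i, c i • fs i) =
      ∑ i, c i • b i := by
    intro c
    rw [map_sum]
    refine Finset.sum_congr rfl fun i _ => ?_
    rw [hb]
    rfl
  have hspan : ∀ o : O, ∃ c : Fin k → K,
      o - ∑ i, c i • fs i ∈ logEquianalyticIdeal K ID F := by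
    intro o
    refine ⟨b.repr (Ideal.Quotient.mk _ o), ?_⟩
    rw [← Ideal.Quotient.eq, hmk, b.sum_repr]
  have hindep : ∀ c : Fin k → K, ∑ i, c i • fs i ∈ logEquianalyticIdeal K ID F → c = 0 := by
    intro c hc
    rw [← Ideal.Quotient.eq_zero_iff_mem, hmk] at hc
    exact funext (Fintype.linearIndependent_iff.mp b.linearIndependent c hc)
  refine ⟨fun A' A p hp v a' h => ?_, fun v v' h => ?_, fun a => ?_⟩
  · obtain ⟨_, δ, hδ, rfl⟩ := a'
    have h1 : (ξ.toMap A v).1 = Quotient.mk _ (δ.map p) := (congrArg Subtype.val h).symm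
    rw [hξ.toMap_eq_iff] at h1
    obtain ⟨a, ha, hδa⟩ := hδ.exists_familyEquation_lift hS hD hm hID hIC hF hspan p hp
      (map_powerSeriesVar_mem v) h1
    obtain ⟨v', hv'⟩ := exists_powerSeriesAlg_hom (a := a) fun i => by
      rw [ArtAlg.mem_maximalIdeal_iff, ← ArtAlg.res_comp (ArtAlg.Hom.hom p), ha,
        ← ArtAlg.mem_maximalIdeal_iff]
      exact map_powerSeriesVar_mem v i
    refine ⟨v', powerSeriesAlg_hom_ext fun i => ?_, Subtype.ext ((hξ.toMap_eq_iff v' δ).mpr ?_)⟩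
    · rw [AlgHom.comp_apply, hv', ha]
    · simpa only [hv'] using hδa
  · obtain ⟨δ, -, hδ⟩ := exists_isGivenBy_familyEquation (IC := IC) hS hm hID hIC hF hF0 (fs := fs)
      (map_powerSeriesVar_mem v)
    have h1 := (hξ.toMap_eq_iff v δ).mpr hδ
    rw [h, hξ.toMap_eq_iff] at h1
    have := hS.isDomain
    exact powerSeriesAlg_hom_ext (congrFun (eq_of_isGivenBy_linearFamily_dualNumbers hID hF hF0
      hindep (map_powerSeriesVar_mem v) (map_powerSeriesVar_mem v') hδ h1))
  · obtain ⟨_, δ, hδ, rfl⟩ := a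
    obtain ⟨a, ha, hδa⟩ := hδ.exists_familyEquation hS hD hm hID hIC hF hspan
    obtain ⟨v, hv⟩ := exists_powerSeriesAlg_hom ha
    refine ⟨v, Subtype.ext ((hξ.toMap_eq_iff v δ).mpr ?_)⟩
    simpa only [hv] using hδa

end FormalFamily

end LogDeformation

open LogDeformation in
theorem mainTheorem2 {K : Type u} [Field K] [IsAlgClosed K] [CharZero K]
    -- a formal smooth surface pair `(S, D)`, `S = Spec O`
    {O : Type u} [CommRing O] [IsLocalRing O] [Algebra K O] (hS : IsFormalSmoothSurface K O)
    (ID : Ideal O) (hD : IsFormalSmoothCurve K (O ⧸ ID))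
    -- a reduced algebroid curve `C = V(F)` not containing `D`
    (F : O) (hF : F ≠ 0) (hC : IsReduced (O ⧸ Ideal.span {F})) (hCD : ¬ Ideal.span {F} ≤ ID)
    (w : ℕ) (hw : w = intersectionMultiplicity K ID (Ideal.span {F})) :
    (Module.Finite K (O ⧸ logEquianalyticIdeal K ID F) ∧
      ∃ (R : CompAlg K) (ξ : FormalElement (defFunctorMult ID (Ideal.span {F}) w) R),
        ξ.IsSemiuniversal ∧ R.IsSmooth ∧
        Nonempty (R ≃ₐ[K] AffineSpaceCompletion K (O ⧸ logEquianalyticIdeal K ID F))) ∧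
    ∀ x y : O, IsLocalRing.maximalIdeal O = Ideal.span {x, y} → ID = Ideal.span {y} →
      ∀ f : O, F = y * f + x ^ w →
      ∀ (k : ℕ) (fs : Fin k → O)
        (b : Module.Basis (Fin k) K (O ⧸ logEquianalyticIdeal K ID F)),
        (∀ i, b i = Ideal.Quotient.mk _ (fs i)) →
        ∃ (R : CompAlg K) (t : R ≃ₐ[K] MvPowerSeries (Fin k) K)
          (ξ : FormalElement (defFunctorMult ID (Ideal.span {F}) w) R),
          ξ.IsSemiuniversal ∧
          ∀ n, ∃ δ : LogDef ID (Ideal.span {F}) (R.quot n),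
            (ξ.elt n).1 = Quotient.mk _ δ ∧
            δ.IsGivenBy ((1 ⊗ₜ y) * (1 ⊗ₜ f +
              ∑ i, R.toQuot n (t.symm (MvPowerSeries.X i)) ⊗ₜ fs i) + 1 ⊗ₜ (x ^ w)) := by
  -- Multiplication of `F` by the unit `u` changes neither the curve nor its equianalytic ideal.
  obtain ⟨x, y, f, u, hm, hID, hu, hF'⟩ := exists_normal_equation hS hD hCD
  rw [← hw] at hF'
  have hspan : Ideal.span {F} = Ideal.span {u * F} :=
    (Ideal.span_singleton_mul_left_unit hu F).symm
  have hF0 : u * F ≠ 0 := by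
    rw [Ne, hu.mul_right_eq_zero]
    exact hF
  have hfin : Module.Finite K (O ⧸ logEquianalyticIdeal K ID F) := by
    rw [← logEquianalyticIdeal_unit_mul hu]
    exact finite_quotient_logEquianalyticIdeal hS hm hID hF' hF0 (hspan ▸ hC)
  refine ⟨⟨hfin, ?_⟩, fun x y hm hID f hFf k fs b hb => ?_⟩
  · let b := Module.finBasis K (O ⧸ logEquianalyticIdeal K ID F)
    choose fs hfs using fun i => Ideal.Quotient.mk_surjective (b i)
    obtain ⟨ξ, hξ⟩ := exists_isLinearFormalElement hS hm hID hspan hF' hF0 fs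
    have hξ' := fun b hb => hξ.isSemiuniversal hS hD hm hID hspan hF' hF0 b hb
    rw [logEquianalyticIdeal_unit_mul hu] at hξ'
    exact ⟨powerSeriesAlg K _, ξ, hξ' b fun i => (hfs i).symm, ⟨_, ⟨AlgEquiv.refl⟩⟩,
      nonempty_affineSpaceCompletion_equiv b⟩
  · obtain ⟨ξ, hξ⟩ := exists_isLinearFormalElement hS hm hID rfl hFf hF fs
    exact ⟨powerSeriesAlg K k, AlgEquiv.refl, ξ,
      hξ.isSemiuniversal hS hD hm hID rfl hFf hF b hb, hξ⟩
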